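/- Let $d\ge 1$, $p\ge 0$, $r\ge 1$ be integers, $\alpha>0$, and let $\Omega=\{x_1,\dots,x_n\}$ be a set of $n$ distinct points of $\mathbb R^d$. Let $\kappa(x,y)=f(\|x-y\|)$ be a positive definite kernel on $\mathbb R^d$ (Euclidean norm) with $f$ analytic at $0$, $f_i=f^{(i)}(0)/i!$, of smoothness order $r$, i.e. $r=\min\{s\ge 1: f_{2s-1}\neq 0\}$. Put $L_\varepsilon=[f(\varepsilon\|x_i-x_j\|)]_{i,j}$ and, for $\varepsilon>0$, let $X_\varepsilon\sim DPP(\alpha\varepsilon^{-p}L_\varepsilon)$, where $X\sim DPP(L)$ means that $X$ is a random subset of $\{1,\dots,n\}$ with $\mathbb P(X=A)=\det L_A/\det(I+L)$ for every $A$. Notation. $\mathscr P_{k,d}=\binom{k+d}{d}$ is the number of monomials of degree $\le k$ in $d$ variables, $\mathscr P_{-1,d}=0$. $V_{<k}$ (resp. $V_k$) is the matrix, with one row per point of $\Omega$, of the values of all monomials of degree $<k$ (resp. $=k$). For $k\le r-1$, $W_{\le k}=\big[\kappa^{(a,b)}(0,0)/(a!\,b!)\big]_{|a|,|b|\le k}$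 is the Wronskian matrix, where $\kappa^{(a,b)}$ is the partial derivative of multi-index $a$ in $x$ and $b$ in $y$; partitioning it by degree $<k$ and degree $=k$ as $$W_{\le k}=\begin{pmatrix}W_{<k}&W_{\urcorner}\\ W_{\llcorner}&W_{\lrcorner}\end{pmatrix},\qquad \bar W=W_{\lrcorner}-W_{\llcorner}W_{<k}^{-1}W_{\urcorner}.$$ $D^{(q)}=[\|x_i-x_j\|^q]_{i,j}$, and $e_k(M)$ is the $k$-th elementary symmetric polynomial of the eigenvalues of $M$. Let $l$ be the integer among $p/2$, $(p+1)/2$. For an $n\times n$ matrix $M$ let $\widetilde M=(I-QQ^\top)M(I-QQ^\top)$, where the columns of $Q$ are an orthonormal basis of the column span of $V_{<l}$. Assume, unless $r<\frac{p+1}2$, that $V_{<l}$ has full rank $\min(n,\mathscr P_{l-1,d})$ (this is automatic if $d=1$). Then, as $\varepsilon\to0^+$: (0) If $\mathscr P_{l-1,d}\ge n$, then $\mathbb P(|X_\varepsilon|=n)\to1$, whatever $r$. Suppose now that $\mathscr P_{l-1,d}<n$. (1) If $r<\frac{p+1}2$, then $\mathbb P(|X_\varepsilon|=n)\to1$. (2a)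 If $r>\frac{p+1}2$ and $p$ is odd, then $\mathbb P(|X_\varepsilon|=\mathscr P_{l-1,d})\to1$. (2b) If $r>\frac{p+1}2$ and $p$ is even, then for every integer $m\ge0$, with $\bar W$ taken for $k=l$ and $\widetilde L=\widetilde{V_l\bar WV_l^\top}$, $$\mathbb P(|X_\varepsilon|=m)\to\begin{cases}0&\text{if } m<\mathscr P_{l-1,d}\text{ or }m>\mathscr P_{l,d},\\[2pt] \dfrac{e_{m-\mathscr P_{l-1,d}}(\alpha\widetilde L)}{\det(I+\alpha\widetilde L)}&\text{otherwise.}\end{cases}$$ (3) If $r=\frac{p+1}2$ (so that $l=r$), then for every integer $m\ge0$, with $\widetilde L=f_{2r-1}\widetilde{D^{(2r-1)}}$, $$\mathbb P(|X_\varepsilon|=m)\to\begin{cases}0&\text{if } m<\mathscr P_{r-1,d}\text{ or }m>n,\\[2pt] \dfrac{e_{m-\mathscr P_{r-1,d}}(\alpha\widetilde L)}{\det(I+\alpha\widetilde L)}&\text{otherwise.}\end{cases}$$ -/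

import Mathlib

open Filter Topology MeasureTheory Matrix

noncomputable section

namespace FlatLimit

/-! ### Kernels -/

/-- Points of `ℝ^d`, with the Euclidean norm. -/
abbrev Pt (d : ℕ) : Type := EuclideanSpace ℝ (Fin d)

/-- The stationary kernel `κ(x, y) = f(‖x - y‖)`. -/
def stationaryKernel (d : ℕ) (f : ℝ → ℝ) : Pt d → Pt d → ℝ := fun x y => f ‖x - y‖

/-- `κ` is a positive definite kernel: all its Gram matrices are symmetric and positive
semi-definite (points may be repeated, and strictness is not required). -/
def IsPositiveDefiniteKernel {d : ℕ} (κ : Pt d → Pt d → ℝ) : Prop :=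
  ∀ (m : ℕ) (y : Fin m → Pt d), (Matrix.of fun i j => κ (y i) (y j)).PosSemidef

/-- The coefficient `f_i = f^{(i)}(0) / i!`. -/
def taylorCoeff (f : ℝ → ℝ) (i : ℕ) : ℝ := iteratedDeriv i f 0 / (i.factorial : ℝ)

/-- `r ≥ 1` is the smoothness order of `f(‖x - y‖)`: the least `s ≥ 1` with `f_{2s-1} ≠ 0`. -/
def IsSmoothnessOrder (f : ℝ → ℝ) (r : ℕ) : Prop :=
  IsLeast {s : ℕ | 1 ≤ s ∧ taylorCoeff f (2 * s - 1) ≠ 0} r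

/-- The kernel matrix `L_ε = [κ_ε(x_i, x_j)]` with `κ_ε(x, y) = f(ε ‖x - y‖)`. -/
def kernelMatrix {d n : ℕ} (f : ℝ → ℝ) (x : Fin n → Pt d) (ε : ℝ) : Matrix (Fin n) (Fin n) ℝ :=
  Matrix.of fun i j => f (ε * ‖x i - x j‖)

/-- The matrix `D^{(q)} = [‖x_i - x_j‖^q]`. -/
def distMatrix {d n : ℕ} (x : Fin n → Pt d) (q : ℕ) : Matrix (Fin n) (Fin n) ℝ :=
  Matrix.of fun i j => ‖x i - x j‖ ^ q

/-! ### Monomials and Vandermonde matrices -/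

/-- Multi-indices `a ∈ ℕ^d` of degree exactly `k`. -/
def monoEq (d k : ℕ) : Finset (Fin d → ℕ) := Finset.piAntidiag Finset.univ k

/-- Multi-indices `a ∈ ℕ^d` of degree strictly less than `k`. -/
def monoLt (d k : ℕ) : Finset (Fin d → ℕ) := (Finset.range k).biUnion (monoEq d)

/-- The number `H_{k,d} = C(k + d - 1, d - 1)` of monomials of degree `k` in `d ≥ 1` variables. -/
def numHom (k d : ℕ) : ℕ := (k + d - 1).choose (d - 1)

/-- The dimension `H_{0,d} + … + H_{k-1,d}` of the space of polynomials of degree `< k`, that is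
`P_{k-1,d}` (so that `P_{-1,d} = 0`). -/
def dimLt (k d : ℕ) : ℕ := ∑ i ∈ Finset.range k, numHom i d

/-- The evaluation matrix of the monomials with exponents in `A` at the points `x_1, …, x_n`. -/
def vandermondeOn {d n : ℕ} (x : Fin n → Pt d) (A : Finset (Fin d → ℕ)) :
    Matrix (Fin n) A ℝ :=
  Matrix.of fun i a => ∏ j, (x i j) ^ (a.1 j)

/-- `V_{<k}`. -/
def vLt {d n : ℕ} (x : Fin n → Pt d) (k : ℕ) : Matrix (Fin n) (monoLt d k) ℝ :=
  vandermondeOn x (monoLt d k)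

/-- `V_k`. -/
def vEq {d n : ℕ} (x : Fin n → Pt d) (k : ℕ) : Matrix (Fin n) (monoEq d k) ℝ :=
  vandermondeOn x (monoEq d k)

/-! ### Wronskian matrices -/

/-- The partial derivative `∂g/∂x_i`. -/
def partialDeriv {d : ℕ} (i : Fin d) (g : Pt d → ℝ) : Pt d → ℝ :=
  fun x => lineDeriv ℝ g x (EuclideanSpace.single i 1)

/-- The iterated partial derivative `∂^{|a|} g / ∂x_1^{a_1} ⋯ ∂x_d^{a_d}`. -/
def multiDeriv {d : ℕ} (a : Fin d → ℕ) (g : Pt d → ℝ) : Pt d → ℝ :=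
  (List.finRange d).foldr (fun i h => (partialDeriv i)^[a i] h) g

/-- The mixed derivative `κ^{(a,b)}(x, y)`, of order `a` in `x` and `b` in `y`. -/
def mixedDeriv {d : ℕ} (a b : Fin d → ℕ) (κ : Pt d → Pt d → ℝ) (x y : Pt d) : ℝ :=
  multiDeriv a (fun x' => multiDeriv b (κ x') y) x

/-- The block `[κ^{(a,b)}(0,0) / (a! b!)]` with rows `a ∈ A` and columns `b ∈ B` of the
Wronskian matrix of `κ`. -/
def wronskian {d : ℕ} (κ : Pt d → Pt d → ℝ) (A B : Finset (Fin d → ℕ)) : Matrix A B ℝ :=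
  Matrix.of fun a b =>
    mixedDeriv a.1 b.1 κ 0 0 / ((∏ i, ((a.1 i).factorial : ℝ)) * ∏ i, ((b.1 i).factorial : ℝ))

/-- The Schur complement `W̄` of the block `W_{<k}` in `W_{≤k}`. -/
def schurWronskian {d : ℕ} (κ : Pt d → Pt d → ℝ) (k : ℕ) :
    Matrix (monoEq d k) (monoEq d k) ℝ :=
  wronskian κ (monoEq d k) (monoEq d k)
    - wronskian κ (monoEq d k) (monoLt d k) * (wronskian κ (monoLt d k) (monoLt d k))⁻¹
      * wronskian κ (monoLt d k) (monoEq d k)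

/-! ### Linear algebra -/

/-- The `k`-th elementary symmetric polynomial of the eigenvalues of `M`, counted with
multiplicity (used for real symmetric matrices, all of whose eigenvalues are real). -/
def elemSymm {n : ℕ} (k : ℕ) (M : Matrix (Fin n) (Fin n) ℝ) : ℝ := M.charpoly.roots.esymm k

/-- The columns of `Q` form an orthonormal basis of the column span of `V`. -/
def IsOrthonormalBasisOfSpan {n q : ℕ} {ι : Type*} (Q : Matrix (Fin n) (Fin q) ℝ)
    (V : Matrix (Fin n) ι ℝ) : Prop :=
  Qᵀ * Q = 1 ∧ Submodule.span ℝ (Set.range Q.col) = Submodule.span ℝ (Set.range V.col)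

/-- The compression `(I - Q Qᵀ) M (I - Q Qᵀ)`. -/
def compress {n q : ℕ} (Q : Matrix (Fin n) (Fin q) ℝ) (M : Matrix (Fin n) (Fin n) ℝ) :
    Matrix (Fin n) (Fin n) ℝ :=
  (1 - Q * Qᵀ) * M * (1 - Q * Qᵀ)

/-! ### L-ensembles -/

/-- `X ~ DPP(L)`: the random subset `X` of `{1, …, n}`, defined on the probability space
`(S, μ)`, is the L-ensemble based on the positive semi-definite matrix `L`, that is
`P(X = A) = det L_A / det(I + L)` for every subset `A`. -/
structure IsLEnsemble {S : Type*} [MeasurableSpace S] {n : ℕ} (μ : Measure S)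
    (X : S → Finset (Fin n)) (L : Matrix (Fin n) (Fin n) ℝ) : Prop where
  isProbabilityMeasure : IsProbabilityMeasure μ
  posSemidef : L.PosSemidef
  measurableSet_eq : ∀ A : Finset (Fin n), MeasurableSet {s | X s = A}
  prob_eq : ∀ A : Finset (Fin n),
    μ.real {s | X s = A} = (L.submatrix (fun i : A => i.1) (fun i : A => i.1)).det / (1 + L).det

end FlatLimit

end

noncomputable section

namespace FlatLimit

/-! ### The generating polynomial of the cardinality of an L-ensemble -/

/-! Write `L` for the matrix `(α / ε ^ p) • kernelMatrix f x ε`. The cardinality of `X_ε` has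
generating function `t ↦ det (1 + t L) / det (1 + L)`, so it is enough to find the limit of this
ratio for each `t > 0` (`IsLEnsemble.real_card_eq`, `tendsto_coeff_of_tendsto_eval`).

Because `f t = ∑_{j<r} f_{2j} t^{2j} + t^{2r-1} φ t`, the bilinear form of `L_ε` at two weight
vectors on the points is a sum of `ε^{|a|+|b|} w a b` times products of moments, plus `ε^{2r-1}`
times a singular remainder that tends to `f_{2r-1}` times the energy of `D^{(2r-1)}`
(`IsKernelExpansion.bilin_eq`). In degrees below `r` the coefficients `w` are the Wronskian entries
(`IsKernelExpansion.wronskian_apply`). Heuristically, a direction first seen by monomials of degree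
`k < r` has size `ε^{2k}`, and a direction seen by none of them has size `ε^{2r-1}`. After division
by `ε^p`, the large directions are selected almost surely, those of size exactly `ε^p` leave a
nontrivial law, and the small ones disappear.

To make this exact, split the space into the column span of `V_{<l}` and its orthogonal complement,
and rescale each block row by its own power of `ε` (`det_one_add_smul_eq_scaledBlock`). The rescaled
matrix converges to `α` times blocks `W, B, Bᵀ, D` with `W = W_{<l}`, while the identity coming from
`1 + t L` fades on the first block. A Schur complement then gives the limit `t^N det (1 + t α T) /
det (1 + α T)`, where `N` is the number of monomials of degree `< l` and `T = D - Bᵀ W⁻¹ B`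
(`IsKernelExpansion.tendsto_real_card_eq_of_limitEntry`). For odd `p` below the threshold `B = D =
0`. For even `p` the degree `l` moments produce the compressed Wronskian Schur complement. For `p =
2r - 1` only the compressed distance matrix survives. In the remaining cases the least eigenvalue of
`L` diverges and every point is selected.

The analytic core is that `W_{<r}` is positive definite (`IsKernelExpansion.sum_pos`) and that
`f_{2r-1} D^{(2r-1)}` is strictly positive on nonzero weights without moments of degree `< r`
(`IsKernelExpansion.eq_zero_of_energy_eq_zero`). The kernel is only assumed positive semi-definite,
so strictness must come from `f_{2r-1} ≠ 0`. Both proofs perturb a degenerate configuration by a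
multiple `τ` of a finite difference of order `2r`: positivity for every real `τ` forces the cross
energy to vanish. Such a difference kills polynomials of degree `< 2r` but detects the odd power
`‖·‖^{2r-1}` at its singularity, and a limit reads off the weight, or the leading moments, that must
be zero. -/

/-- The polynomial `det (1 + X M)`. -/
def minorPoly {n : ℕ} (M : Matrix (Fin n) (Fin n) ℝ) : Polynomial ℝ :=
  (1 + (Polynomial.X : Polynomial ℝ) • M.map Polynomial.C).det

theorem natDegree_minorPoly_le {n : ℕ} (M : Matrix (Fin n) (Fin n) ℝ) :
    (minorPoly M).natDegree ≤ n := by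
  have h := Polynomial.natDegree_det_X_add_C_le M (1 : Matrix (Fin n) (Fin n) ℝ)
  rw [add_comm, Fintype.card_fin] at h
  simpa [minorPoly, Matrix.map_one] using h

theorem eval_minorPoly {n : ℕ} (M : Matrix (Fin n) (Fin n) ℝ) (t : ℝ) :
    (minorPoly M).eval t = (1 + t • M).det := by
  unfold minorPoly
  rw [← Polynomial.coe_evalRingHom, RingHom.map_det]
  congr 1
  ext i j
  by_cases hij : i = j <;> simp [hij] <;> ring

/-- Both sides are the sum of the principal minors of size `k`. Symmetry makes the characteristic
polynomial split over `ℝ`, so that its multiset of roots has all `n` elements and Vieta's formulas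
apply. -/
theorem elemSymm_eq_coeff_minorPoly {n : ℕ} {M : Matrix (Fin n) (Fin n) ℝ} (hM : M.IsHermitian)
    (k : ℕ) : elemSymm k M = (minorPoly M).coeff k := by
  have hroots := hM.roots_charpoly_eq_eigenvalues
  have hcard : M.charpoly.roots.card = n := by
    rw [hroots]; simp
  rcases le_or_gt k n with hk | hk
  · have h1 := Polynomial.coeff_eq_esymm_roots_of_card
      (p := M.charpoly) (by rw [hcard, M.charpoly_natDegree_eq_dim, Fintype.card_fin])
      (k := n - k) (by rw [M.charpoly_natDegree_eq_dim, Fintype.card_fin]; omega)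
    have h2 := M.charpoly_coeff_eq_sum_minors k (by simpa using hk)
    rw [Fintype.card_fin] at h2
    rw [h1, M.charpoly_natDegree_eq_dim, Fintype.card_fin, M.charpoly_monic.leadingCoeff, one_mul,
      Nat.sub_sub_self hk] at h2
    rw [minorPoly, coeff_det_one_add_X_smul_eq_sum_minors]
    exact mul_left_cancel₀ (pow_ne_zero k (by norm_num : (-1 : ℝ) ≠ 0)) h2
  · rw [Polynomial.coeff_eq_zero_of_natDegree_lt ((natDegree_minorPoly_le M).trans_lt hk), elemSymm,
      Multiset.esymm, Multiset.powersetCard_eq_empty k (by omega)]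
    simp

theorem IsLEnsemble.real_card_eq {S : Type*} [MeasurableSpace S] {n : ℕ} {μ : Measure S}
    {X : S → Finset (Fin n)} {L : Matrix (Fin n) (Fin n) ℝ} (h : IsLEnsemble μ X L) (m : ℕ) :
    μ.real {s | (X s).card = m} = (minorPoly L).coeff m / (1 + L).det := by
  have := h.isProbabilityMeasure
  have hset : {s | (X s).card = m} = ⋃ A ∈ (Finset.univ : Finset (Fin n)).powersetCard m,
      {s | X s = A} := by
    ext s; simp [Finset.mem_powersetCard]
  rw [hset, measureReal_biUnion_finset]
  · rw [minorPoly, coeff_det_one_add_X_smul_eq_sum_minors, Finset.sum_div]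
    exact Finset.sum_congr rfl fun A _ => h.prob_eq A
  · intro A _ B _ hAB
    refine Set.disjoint_left.2 fun s hs hs' => hAB ?_
    rw [← (show X s = A from hs), ← (show X s = B from hs')]
  · exact fun A _ => h.measurableSet_eq A

/-- Pointwise convergence on `(0, ∞)` of polynomials of bounded degree implies convergence of the
coefficients. -/
theorem tendsto_coeff_of_tendsto_eval {β : Type*} {F : Filter β} {P : β → Polynomial ℝ}
    {Q : Polynomial ℝ} {k : ℕ} (hP : ∀ b, (P b).natDegree ≤ k) (hQ : Q.natDegree ≤ k)
    (h : ∀ t : ℝ, 0 < t → Tendsto (fun b => (P b).eval t) F (𝓝 (Q.eval t))) (m : ℕ) :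
    Tendsto (fun b => (P b).coeff m) F (𝓝 (Q.coeff m)) := by
  classical
  -- The nodes are shifted by one because convergence is assumed only for `t > 0`. Each coefficient
  -- is a fixed linear combination of the values at these nodes, by Lagrange interpolation.
  let v : ℕ → ℝ := fun i => i + 1
  have hv : Set.InjOn v (Finset.range (k + 1)) := by
    intro i _ j _ hij
    simpa [v] using hij
  have key : ∀ p : Polynomial ℝ, p.natDegree ≤ k →
      p.coeff m = ∑ i ∈ Finset.range (k + 1), p.eval (v i) *
        (Lagrange.basis (Finset.range (k + 1)) v i).coeff m := by
    intro p hp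
    conv_lhs => rw [Lagrange.eq_interpolate_of_eval_eq (s := Finset.range (k + 1)) (v := v)
      (fun i => p.eval (v i)) hv (by
        rw [Finset.card_range]
        exact lt_of_le_of_lt Polynomial.degree_le_natDegree (by exact_mod_cast Nat.lt_succ_of_le hp))
      (fun _ _ => rfl)]
    rw [Lagrange.interpolate_apply, Polynomial.finsetSum_coeff]
    exact Finset.sum_congr rfl fun i _ => by rw [Polynomial.coeff_C_mul]
  rw [key Q hQ]
  simp_rw [fun b => key (P b) (hP b)]
  exact tendsto_finsetSum _ fun i _ => (h (v i) (by positivity)).mul_const _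

/-- If the smallest eigenvalue of `L_b` tends to infinity, then the L-ensemble is everything with
probability tending to one. -/
theorem tendsto_real_card_eq_of_coercive {n : ℕ} {β : Type*} {F : Filter β} {S : β → Type*}
    [∀ b, MeasurableSpace (S b)] {μ : ∀ b, Measure (S b)} {X : ∀ b, S b → Finset (Fin n)}
    {L : β → Matrix (Fin n) (Fin n) ℝ} (hX : ∀ᶠ b in F, IsLEnsemble (μ b) (X b) (L b))
    {c : β → ℝ} (hc : Tendsto c F atTop)
    (hL : ∀ᶠ b in F, ∀ u : Fin n → ℝ, c b * (u ⬝ᵥ u) ≤ u ⬝ᵥ (L b *ᵥ u)) :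
    Tendsto (fun b => (μ b).real {s | (X b s).card = n}) F (𝓝 1) := by
  -- The probability of selecting everything is `∏ λ_i / (1 + λ_i)`, which is at least this quantity
  -- when all eigenvalues are at least `c b`.
  have hlim : Tendsto (fun b => (c b / (1 + c b)) ^ n) F (𝓝 1) := by
    have h1 : Tendsto (fun b => 1 - 1 / (1 + c b)) F (𝓝 (1 - 0)) :=
      tendsto_const_nhds.sub
        (Tendsto.div_atTop tendsto_const_nhds (tendsto_atTop_add_const_left _ _ hc))
    have h2 : Tendsto (fun b => c b / (1 + c b)) F (𝓝 1) := by
      rw [sub_zero] at h1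
      refine h1.congr' ?_
      filter_upwards [hc.eventually_gt_atTop 0] with b hb
      field_simp
      ring
    simpa using h2.pow n
  refine tendsto_of_tendsto_of_tendsto_of_le_of_le' hlim tendsto_const_nhds ?_ ?_
  · filter_upwards [hX, hL, hc.eventually_gt_atTop 0] with b hX hL hb
    have hH : (L b).IsHermitian := hX.posSemidef.isHermitian
    have heig : ∀ i, c b ≤ hH.eigenvalues i := by
      intro i
      have h1 := hL (hH.eigenvectorBasis i).ofLp
      rw [hH.mulVec_eigenvectorBasis, dotProduct_smul] at h1
      have h2 : (hH.eigenvectorBasis i).ofLp ⬝ᵥ (hH.eigenvectorBasis i).ofLp = 1 := by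
        have := hH.eigenvectorBasis.orthonormal.1 i
        have h3 : inner ℝ (hH.eigenvectorBasis i) (hH.eigenvectorBasis i) = (1 : ℝ) := by
          rw [real_inner_self_eq_norm_sq, this]; norm_num
        rw [EuclideanSpace.inner_eq_star_dotProduct] at h3
        simpa using h3
      rw [h2] at h1
      simpa using h1
    have hdet : (L b).det = ∏ i, hH.eigenvalues i := by
      simpa using hH.det_eq_prod_eigenvalues
    have hdet1 : (1 + L b).det = ∏ i, (1 + hH.eigenvalues i) := by
      have h1 := congrArg (Polynomial.eval (-1)) hH.charpoly_eq
      rw [Matrix.eval_charpoly, Polynomial.eval_prod] at h1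
      have h2 : Matrix.scalar (Fin n) (-1 : ℝ) - L b = -(1 + L b) := by
        ext i j; by_cases hij : i = j <;> simp [hij] <;> ring
      rw [h2, Matrix.det_neg] at h1
      have h3 : ∏ i, Polynomial.eval (-1) (Polynomial.X - Polynomial.C
          ((hH.eigenvalues i : ℝ))) = (-1) ^ n * ∏ i, (1 + hH.eigenvalues i) := by
        have : ∀ i, Polynomial.eval (-1) (Polynomial.X - Polynomial.C
          ((hH.eigenvalues i : ℝ))) = (-1) * (1 + hH.eigenvalues i) := by
          intro i; simp; ring
        simp_rw [this]
        rw [Finset.prod_mul_distrib]; simp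
      rw [Fintype.card_fin] at h1
      exact mul_left_cancel₀ (pow_ne_zero n (by norm_num : (-1 : ℝ) ≠ 0)) (h1.trans h3)
    rw [hX.real_card_eq, minorPoly, coeff_det_one_add_X_smul_eq_sum_minors]
    have hps : (Finset.univ : Finset (Fin n)).powersetCard n = {Finset.univ} := by
      ext A
      simp [Finset.mem_powersetCard, ← Finset.card_eq_iff_eq_univ]
    rw [hps, Finset.sum_singleton]
    have hsub : ((L b).submatrix (Subtype.val : {i // i ∈ (Finset.univ : Finset (Fin n))} → Fin n)
        Subtype.val).det = (L b).det :=
      Matrix.det_submatrix_equiv_self (Equiv.subtypeUnivEquiv Finset.mem_univ) (L b)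
    rw [hsub, hdet, hdet1, ← Finset.prod_div_distrib]
    calc (c b / (1 + c b)) ^ n
        = ∏ _i : Fin n, (c b / (1 + c b)) := by rw [Finset.prod_const, Finset.card_fin]
      _ ≤ _ := by
        refine Finset.prod_le_prod (fun i _ => by positivity) fun i _ => ?_
        have := heig i
        rw [div_le_div_iff₀ (by positivity) (by linarith)]
        nlinarith
  · filter_upwards [hX] with b hX
    have := hX.isProbabilityMeasure
    exact measureReal_le_one

/-! ### Block reduction of `det (1 + t L)` -/

section Block

variable {ι : Type*} [Fintype ι] [DecidableEq ι] {n : ℕ}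

/-- The matrix `[R; Pr] L [Rᵀ, Pr]` with rows and columns indexed by `ι` rescaled by `φ⁻¹`. -/
def scaledBlock (R : Matrix ι (Fin n) ℝ) (Pr L : Matrix (Fin n) (Fin n) ℝ) (φ : ι → ℝ) :
    Matrix (ι ⊕ Fin n) (ι ⊕ Fin n) ℝ :=
  Matrix.diagonal (Sum.elim (fun a => (φ a)⁻¹) fun _ => 1) *
    (Matrix.fromRows R Pr * L * (Matrix.fromRows R Pr)ᵀ) *
    Matrix.diagonal (Sum.elim (fun a => (φ a)⁻¹) fun _ => 1)

/-- Since `[V, Pr] [R; Pr] = 1`, the matrix `L` factors through `ι ⊕ Fin n`, and `det (1 + A B) =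
det (1 + B A)` moves the determinant there. The prefactor does not depend on `t`, so it cancels in
the generating function. -/
theorem det_one_add_smul_eq_scaledBlock {V : Matrix (Fin n) ι ℝ} {R : Matrix ι (Fin n) ℝ}
    {Pr : Matrix (Fin n) (Fin n) ℝ} (hVR : V * R + Pr = 1) (hPP : Pr * Pr = Pr) (hPt : Prᵀ = Pr)
    (hPV : Pr * V = 0) (hS : IsUnit (Vᵀ * V).det) (L : Matrix (Fin n) (Fin n) ℝ)
    {φ : ι → ℝ} (hφ : ∀ a, φ a ≠ 0) (t : ℝ) :
    (1 + t • L).det = ((∏ a, φ a) ^ 2 * (Vᵀ * V).det) *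
      (Matrix.fromBlocks (Matrix.diagonal (fun a => (φ a)⁻¹) * (Vᵀ * V)⁻¹ *
        Matrix.diagonal (fun a => (φ a)⁻¹)) 0 0 1 + t • scaledBlock R Pr L φ).det := by
  set F0 : Matrix ι ι ℝ := Matrix.diagonal φ
  set F0' : Matrix ι ι ℝ := Matrix.diagonal (fun a => (φ a)⁻¹)
  have hF0 : F0 * F0' = 1 := by
    rw [Matrix.diagonal_mul_diagonal]
    simp [hφ]
  have hF0' : F0' * F0 = 1 := by
    rw [Matrix.diagonal_mul_diagonal]
    simp [hφ]
  set K := Matrix.fromRows R Pr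
  set B := Matrix.fromCols V Pr
  have hBK : B * K = 1 := by
    rw [Matrix.fromCols_mul_fromRows, hPP, hVR]
  set F : Matrix (ι ⊕ Fin n) (ι ⊕ Fin n) ℝ := Matrix.fromBlocks F0 0 0 1 with hF
  set F' : Matrix (ι ⊕ Fin n) (ι ⊕ Fin n) ℝ := Matrix.fromBlocks F0' 0 0 1 with hF'
  set C1 : Matrix (ι ⊕ Fin n) (ι ⊕ Fin n) ℝ := Matrix.fromBlocks (F0 * (Vᵀ * V)) 0 0 1 with hC1
  have hdiag : Matrix.diagonal (Sum.elim (fun a => (φ a)⁻¹) fun _ : Fin n => (1 : ℝ)) = F' := by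
    rw [hF', ← Matrix.diagonal_one, Matrix.fromBlocks_diagonal]
  have hFF' : F * F' = 1 := by
    rw [hF, hF', Matrix.fromBlocks_multiply]; simp [hF0, Matrix.fromBlocks_one]
  have hF'F : F' * F = 1 := by
    rw [hF, hF', Matrix.fromBlocks_multiply]; simp [hF0', Matrix.fromBlocks_one]
  have hG : scaledBlock R Pr L φ = F' * (K * L * Kᵀ) * F' := by
    rw [scaledBlock, hdiag]
  -- `Bᵀ * B` is in general singular, because its second block is the projection `Pr`. All the
  -- degeneracy is put into `J`, which the scaled block absorbs since `Pr` is idempotent; what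
  -- remains is the block diagonal `C1`.
  set J : Matrix (ι ⊕ Fin n) (ι ⊕ Fin n) ℝ := Matrix.fromBlocks 1 0 0 Pr with hJ
  have hBB : Bᵀ * B = Matrix.fromBlocks (Vᵀ * V) 0 0 Pr := by
    rw [Matrix.transpose_fromCols, Matrix.fromRows_mul_fromCols, hPt, hPP, hPV]
    have : Vᵀ * Pr = 0 := by
      rw [← Matrix.transpose_transpose (Vᵀ * Pr), Matrix.transpose_mul, Matrix.transpose_transpose,
        hPt, hPV, Matrix.transpose_zero]
    rw [this]
  have hFBB : F * (Bᵀ * B) = J * C1 := by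
    rw [hBB, hF, hJ, hC1, Matrix.fromBlocks_multiply, Matrix.fromBlocks_multiply]
    simp
  have hKJ : Kᵀ * F' * J = Kᵀ * F' := by
    have : F' * J = J * F' := by
      rw [hF', hJ, Matrix.fromBlocks_multiply, Matrix.fromBlocks_multiply]; simp
    rw [Matrix.mul_assoc, this, ← Matrix.mul_assoc]
    congr 1
    rw [Matrix.transpose_fromRows, hJ, Matrix.fromCols_mul_fromBlocks, hPt, hPP]
    simp
  have hGJ : scaledBlock R Pr L φ * J = scaledBlock R Pr L φ := by
    rw [hG]
    calc F' * (K * L * Kᵀ) * F' * J = F' * (K * L) * (Kᵀ * F' * J) := by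
          simp only [Matrix.mul_assoc]
      _ = _ := by rw [hKJ]; simp only [Matrix.mul_assoc]
  have hFGF : F * scaledBlock R Pr L φ * F = K * L * Kᵀ := by
    rw [hG]
    calc F * (F' * (K * L * Kᵀ) * F') * F = (F * F') * (K * L * Kᵀ) * (F' * F) := by
          simp only [Matrix.mul_assoc]
      _ = _ := by rw [hFF', hF'F]; simp
  have hL : L = B * (K * L * Kᵀ * Bᵀ) := by
    calc L = (B * K) * L * (B * K)ᵀ := by rw [hBK]; simp
      _ = _ := by rw [Matrix.transpose_mul]; simp only [Matrix.mul_assoc]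
  have h1 : (1 + t • L).det = (1 + (t • (K * L * Kᵀ)) * (Bᵀ * B)).det := by
    conv_lhs => rw [hL, ← Matrix.mul_smul, Matrix.det_one_add_mul_comm]
    simp only [Matrix.smul_mul, Matrix.mul_assoc]
  have h2 : F * (Matrix.fromBlocks (F0' * (Vᵀ * V)⁻¹ * F0') 0 0 1 + t • scaledBlock R Pr L φ) * C1
      = 1 + (t • (K * L * Kᵀ)) * (Bᵀ * B) := by
    rw [Matrix.mul_add, Matrix.add_mul]
    congr 1
    · rw [hF, hC1, Matrix.fromBlocks_multiply, Matrix.fromBlocks_multiply]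
      have : F0 * (F0' * (Vᵀ * V)⁻¹ * F0') * (F0 * (Vᵀ * V)) = 1 := by
        calc _ = (F0 * F0') * (Vᵀ * V)⁻¹ * (F0' * F0) * (Vᵀ * V) := by simp only [Matrix.mul_assoc]
          _ = 1 := by
            rw [hF0, hF0', Matrix.one_mul, Matrix.mul_one, Matrix.nonsing_inv_mul _ hS]
      simp [this, Matrix.fromBlocks_one]
    · rw [← hFGF]
      calc _ = t • (F * scaledBlock R Pr L φ * C1) := by simp
        _ = t • (F * (scaledBlock R Pr L φ * J) * C1) := by rw [hGJ]
        _ = t • (F * scaledBlock R Pr L φ * (J * C1)) := by simp only [Matrix.mul_assoc]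
        _ = _ := by rw [← hFBB]; simp only [Matrix.mul_assoc, Matrix.smul_mul]
  rw [h1, ← h2, Matrix.det_mul, Matrix.det_mul, hF, hC1, Matrix.det_fromBlocks_zero₂₁,
    Matrix.det_fromBlocks_zero₂₁, Matrix.det_mul, Matrix.det_diagonal]
  simp only [Matrix.det_one]
  ring

/-- Limit of the law of the cardinality when the rescaled block matrices converge. -/
theorem tendsto_real_card_eq_of_tendsto_scaledBlock {V : Matrix (Fin n) ι ℝ}
    {R : Matrix ι (Fin n) ℝ} {Pr : Matrix (Fin n) (Fin n) ℝ} (hVR : V * R + Pr = 1)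
    (hPP : Pr * Pr = Pr) (hPt : Prᵀ = Pr) (hPV : Pr * V = 0) (hS : IsUnit (Vᵀ * V).det)
    {β : Type*} {F : Filter β} [F.NeBot] {S : β → Type*}
    [∀ b, MeasurableSpace (S b)] {μ : ∀ b, Measure (S b)} {X : ∀ b, S b → Finset (Fin n)}
    {L : β → Matrix (Fin n) (Fin n) ℝ} (hX : ∀ᶠ b in F, IsLEnsemble (μ b) (X b) (L b))
    {φ : β → ι → ℝ} (hφ : ∀ᶠ b in F, ∀ a, φ b a ≠ 0)
    (hφ' : ∀ a, Tendsto (fun b => (φ b a)⁻¹) F (𝓝 0))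
    {W : Matrix ι ι ℝ} {B : Matrix ι (Fin n) ℝ} {D : Matrix (Fin n) (Fin n) ℝ} (hW : W.PosDef)
    (hG : Tendsto (fun b => scaledBlock R Pr (L b) (φ b)) F (𝓝 (Matrix.fromBlocks W B Bᵀ D)))
    (m : ℕ) :
    Tendsto (fun b => (μ b).real {s | (X b s).card = m}) F
      (𝓝 ((Polynomial.X ^ Fintype.card ι * minorPoly (D - Bᵀ * W⁻¹ * B)).coeff m /
        (1 + (D - Bᵀ * W⁻¹ * B)).det)) := by
  set T := D - Bᵀ * W⁻¹ * B with hT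
  -- Positive semi-definiteness passes to the limit, hence to the Schur complement `T`. This yields
  -- `det (1 + T) > 0`, so the limiting quotient makes sense.
  have hGpsd : (Matrix.fromBlocks W B Bᵀ D).PosSemidef := by
    have hev : ∀ᶠ b in F, (scaledBlock R Pr (L b) (φ b)).PosSemidef := by
      filter_upwards [hX] with b hb
      have h1 := (hb.posSemidef.mul_mul_conjTranspose_same (Matrix.fromRows R Pr))
      have h2 := h1.mul_mul_conjTranspose_same
        (Matrix.diagonal (Sum.elim (fun a => (φ b a)⁻¹) fun _ : Fin n => (1 : ℝ)))
      simpa [scaledBlock, Matrix.conjTranspose_eq_transpose_of_trivial, Matrix.diagonal_transpose]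
        using h2
    refine Matrix.PosSemidef.of_dotProduct_mulVec_nonneg ?_ fun u => ?_
    · have h1 : Tendsto (fun b => (scaledBlock R Pr (L b) (φ b))ᴴ) F
          (𝓝 (Matrix.fromBlocks W B Bᵀ D)ᴴ) :=
        (continuous_id.matrix_conjTranspose.tendsto _).comp hG
      refine tendsto_nhds_unique (h1.congr' ?_) hG
      filter_upwards [hev] with b hb using hb.isHermitian
    · have hcont : Continuous fun A : Matrix (ι ⊕ Fin n) (ι ⊕ Fin n) ℝ => star u ⬝ᵥ (A *ᵥ u) :=
        Continuous.dotProduct continuous_const (continuous_id.matrix_mulVec continuous_const)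
      refine ge_of_tendsto ((hcont.tendsto _).comp hG) ?_
      filter_upwards [hev] with b hb using hb.dotProduct_mulVec_nonneg u
  let _ : Invertible W := hW.isUnit.invertible
  have hTpsd : T.PosSemidef := by
    have := (Matrix.PosDef.fromBlocks₁₁ B D hW).1 (by
      simpa [Matrix.conjTranspose_eq_transpose_of_trivial] using hGpsd)
    simpa [Matrix.conjTranspose_eq_transpose_of_trivial] using this
  have hT1 : 0 < (1 + T).det := (Matrix.PosDef.one.add_posSemidef hTpsd).det_pos
  have hWdet : 0 < W.det := hW.det_pos
  set D1 : β → Matrix (ι ⊕ Fin n) (ι ⊕ Fin n) ℝ := fun b =>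
    Matrix.fromBlocks (Matrix.diagonal (fun a => (φ b a)⁻¹) * (Vᵀ * V)⁻¹ *
        Matrix.diagonal (fun a => (φ b a)⁻¹)) 0 0 1 with hD1
  have hD1lim : Tendsto D1 F (𝓝 (Matrix.fromBlocks 0 0 0 1)) := by
    have hd : Tendsto (fun b => Matrix.diagonal (fun a => (φ b a)⁻¹)) F (𝓝 (0 : Matrix ι ι ℝ)) := by
      have h0 : Tendsto (fun b => fun a => (φ b a)⁻¹) F (𝓝 (0 : ι → ℝ)) := tendsto_pi_nhds.2 hφ'
      have := ((continuous_id.matrix_diagonal).tendsto (0 : ι → ℝ)).comp h0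
      simpa [Function.comp_def] using this
    have h1 : Tendsto (fun b => Matrix.diagonal (fun a => (φ b a)⁻¹) * (Vᵀ * V)⁻¹ *
        Matrix.diagonal (fun a => (φ b a)⁻¹)) F (𝓝 (0 : Matrix ι ι ℝ)) := by
      have hc : Continuous fun p : Matrix ι ι ℝ × Matrix ι ι ℝ => p.1 * (Vᵀ * V)⁻¹ * p.2 :=
        (continuous_fst.matrix_mul continuous_const).matrix_mul continuous_snd
      have := (hc.tendsto (0, 0)).comp (hd.prodMk_nhds hd)
      simpa [Function.comp_def] using this
    have hc : Continuous fun A : Matrix ι ι ℝ =>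
        (Matrix.fromBlocks A 0 0 1 : Matrix (ι ⊕ Fin n) (ι ⊕ Fin n) ℝ) :=
      continuous_id.matrix_fromBlocks continuous_const continuous_const continuous_const
    exact (hc.tendsto _).comp h1
  -- In the limit the first diagonal block is `t W` alone, and `(t Bᵀ) (t W)⁻¹ (t B) = t Bᵀ W⁻¹ B`.
  -- The power of `t` counts the directions that are selected almost surely.
  have hdetlim : ∀ t : ℝ, 0 < t →
      Tendsto (fun b => (D1 b + t • scaledBlock R Pr (L b) (φ b)).det) F
        (𝓝 (t ^ Fintype.card ι * W.det * (1 + t • T).det)) := by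
    intro t ht
    have h1 := ((continuous_id.matrix_det).tendsto _).comp (hD1lim.add (hG.const_smul t))
    have h2 : (Matrix.fromBlocks 0 0 0 1 + t • Matrix.fromBlocks W B Bᵀ D).det =
        t ^ Fintype.card ι * W.det * (1 + t • T).det := by
      have hu : IsUnit (t • W).det := by
        rw [Matrix.det_smul]; exact (mul_pos (pow_pos ht _) hWdet).ne'.isUnit
      let _ : Invertible (t • W) := Matrix.invertibleOfIsUnitDet _ hu
      rw [Matrix.fromBlocks_smul, Matrix.fromBlocks_add, zero_add, zero_add, zero_add,
        Matrix.det_fromBlocks₁₁, Matrix.det_smul, Matrix.invOf_eq_nonsing_inv]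
      congr 2
      have hinv : (t • W)⁻¹ = t⁻¹ • W⁻¹ := by
        refine Matrix.inv_eq_right_inv ?_
        rw [Matrix.smul_mul, Matrix.mul_smul, smul_smul, mul_inv_cancel₀ ht.ne', one_smul,
          Matrix.mul_nonsing_inv _ hWdet.ne'.isUnit]
      rw [hinv, hT]
      simp only [Matrix.smul_mul, Matrix.mul_smul, smul_smul, smul_sub]
      rw [inv_mul_cancel₀ ht.ne', mul_one, add_sub_assoc]
    rw [← h2]
    exact h1
  have hdet1 := hdetlim 1 one_pos
  simp only [one_smul, one_pow, one_mul] at hdet1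
  have hlim1 : W.det * (1 + T).det ≠ 0 := (mul_pos hWdet hT1).ne'
  set q : Polynomial ℝ := Polynomial.C ((1 + T).det)⁻¹ *
    (Polynomial.X ^ Fintype.card ι * minorPoly T) with hq
  set P : β → Polynomial ℝ := fun b => Polynomial.C ((1 + L b).det)⁻¹ * minorPoly (L b) with hPdef
  have hcoeff : Tendsto (fun b => (P b).coeff m) F (𝓝 (q.coeff m)) := by
    refine tendsto_coeff_of_tendsto_eval (k := Fintype.card ι + n) (fun b => ?_) ?_ ?_ m
    · exact (Polynomial.natDegree_C_mul_le _ _).trans ((natDegree_minorPoly_le _).trans (by omega))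
    · refine (Polynomial.natDegree_C_mul_le _ _).trans (Polynomial.natDegree_mul_le.trans ?_)
      exact add_le_add (Polynomial.natDegree_X_pow_le _) (natDegree_minorPoly_le _)
    · intro t ht
      have h1 : Tendsto (fun b => (D1 b + t • scaledBlock R Pr (L b) (φ b)).det /
          (D1 b + scaledBlock R Pr (L b) (φ b)).det) F
          (𝓝 (t ^ Fintype.card ι * W.det * (1 + t • T).det / (W.det * (1 + T).det))) :=
        (hdetlim t ht).div hdet1 hlim1
      have h2 : t ^ Fintype.card ι * W.det * (1 + t • T).det / (W.det * (1 + T).det) = q.eval t := by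
        rw [hq]
        simp only [Polynomial.eval_mul, Polynomial.eval_C, Polynomial.eval_pow, Polynomial.eval_X,
          eval_minorPoly]
        field_simp
      rw [h2] at h1
      refine h1.congr' ?_
      filter_upwards [hφ] with b hb
      have hb' : (∏ a, φ b a) ^ 2 * (Vᵀ * V).det ≠ 0 :=
        mul_ne_zero (pow_ne_zero _ (Finset.prod_ne_zero_iff.2 fun a _ => hb a)) hS.ne_zero
      have e1 := det_one_add_smul_eq_scaledBlock hVR hPP hPt hPV hS (L b) hb t
      have e2 := det_one_add_smul_eq_scaledBlock hVR hPP hPt hPV hS (L b) hb 1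
      simp only [one_smul] at e2
      rw [hPdef]
      simp only [Polynomial.eval_mul, Polynomial.eval_C, eval_minorPoly]
      rw [e1, e2, ← div_eq_inv_mul, mul_div_mul_left _ _ hb']
  rw [hq] at hcoeff
  rw [Polynomial.coeff_C_mul, ← div_eq_inv_mul] at hcoeff
  refine hcoeff.congr' ?_
  filter_upwards [hX] with b hb
  rw [hb.real_card_eq, hPdef]
  simp only [Polynomial.coeff_C_mul]
  rw [div_eq_inv_mul]

end Block

/-! ### Monomials and moments -/

/-- The monomial `x ^ a`. -/
def monoVal {d : ℕ} (x : Pt d) (a : Fin d → ℕ) : ℝ := ∏ j, x j ^ a j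

/-- The moment of order `a` of the signed measure `∑ i, u i δ_{y i}`. -/
def moment {d : ℕ} {ι : Type*} [Fintype ι] (y : ι → Pt d) (u : ι → ℝ) (a : Fin d → ℕ) : ℝ :=
  ∑ i, u i * monoVal (y i) a

theorem mem_monoEq {d k : ℕ} {a : Fin d → ℕ} : a ∈ monoEq d k ↔ ∑ i, a i = k := by
  simp [monoEq]

theorem mem_monoLt {d k : ℕ} {a : Fin d → ℕ} : a ∈ monoLt d k ↔ ∑ i, a i < k := by
  simp [monoLt, mem_monoEq]

theorem card_monoEq {d : ℕ} (hd : 1 ≤ d) (k : ℕ) : (monoEq d k).card = numHom k d := by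
  rw [monoEq, ← Finset.map_sym_eq_piAntidiag, Finset.card_map, numHom]
  rw [Finset.sym_univ, Finset.card_univ, Sym.card_sym_eq_choose, Fintype.card_fin, add_comm d k,
    ← Nat.choose_symm_of_eq_add]
  omega

theorem card_monoLt {d : ℕ} (hd : 1 ≤ d) (k : ℕ) : (monoLt d k).card = dimLt k d := by
  rw [monoLt, Finset.card_biUnion, dimLt]
  · exact Finset.sum_congr rfl fun i _ => card_monoEq hd i
  · intro i _ j _ hij
    refine Finset.disjoint_left.2 fun a ha hb => hij ?_
    rw [mem_monoEq] at ha hb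
    omega

theorem monoVal_smul {d : ℕ} (c : ℝ) (x : Pt d) (a : Fin d → ℕ) :
    monoVal (c • x) a = c ^ (∑ i, a i) * monoVal x a := by
  simp only [monoVal, PiLp.smul_apply, smul_eq_mul, mul_pow]
  rw [Finset.prod_mul_distrib, Finset.prod_pow_eq_pow_sum]

theorem moment_smul {d : ℕ} {ι : Type*} [Fintype ι] (y : ι → Pt d) (c : ℝ) (u : ι → ℝ)
    (a : Fin d → ℕ) : moment y (c • u) a = c * moment y u a := by
  simp only [moment, Pi.smul_apply, smul_eq_mul, mul_assoc, Finset.mul_sum]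

theorem moment_sum {d : ℕ} {ι κ : Type*} [Fintype ι] (s : Finset κ) (y : ι → Pt d)
    (u : κ → ι → ℝ) (a : Fin d → ℕ) :
    moment y (fun i => ∑ k ∈ s, u k i) a = ∑ k ∈ s, moment y (u k) a := by
  simp only [moment, Finset.sum_mul]
  exact Finset.sum_comm

theorem moment_scale {d : ℕ} {ι : Type*} [Fintype ι] (c : ℝ) (y : ι → Pt d) (u : ι → ℝ)
    (a : Fin d → ℕ) : moment (fun i => c • y i) u a = c ^ (∑ i, a i) * moment y u a := by
  simp only [moment, monoVal_smul, Finset.mul_sum]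
  exact Finset.sum_congr rfl fun i _ => by ring

theorem moment_sumElim {d : ℕ} {ι κ : Type*} [Fintype ι] [Fintype κ] (y : ι → Pt d)
    (z : κ → Pt d) (u : ι → ℝ) (v : κ → ℝ) (a : Fin d → ℕ) :
    moment (Sum.elim y z) (Sum.elim u v) a = moment y u a + moment z v a := by
  simp [moment, Fintype.sum_sum_type]

theorem eval_eq_sum_piAntidiag {σ : Type*} [Fintype σ] [DecidableEq σ] {P : MvPolynomial σ ℝ}
    {e : ℕ} (hP : P.IsHomogeneous e) (x : σ → ℝ) :
    MvPolynomial.eval x P = ∑ a ∈ Finset.piAntidiag Finset.univ e,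
      P.coeff (Finsupp.equivFunOnFinite.symm a) * ∏ i, x i ^ a i := by
  rw [MvPolynomial.eval_eq']
  have hmem : ∀ m ∈ P.support, (m : σ → ℕ) ∈ Finset.piAntidiag Finset.univ e := by
    intro m hm
    have := hP (MvPolynomial.mem_support_iff.1 hm)
    rw [Finset.mem_piAntidiag]
    refine ⟨?_, by simp⟩
    rw [← this, Finsupp.weight_apply, Finsupp.sum_fintype _ _ (by simp)]
    simp
  have hinj : Set.InjOn (fun m : σ →₀ ℕ => (m : σ → ℕ)) P.support :=
    fun a _ b _ hab => DFunLike.coe_injective hab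
  rw [← Finset.sum_subset (s₁ := P.support.image fun m : σ →₀ ℕ => (m : σ → ℕ))]
  · rw [Finset.sum_image hinj]
    refine Finset.sum_congr rfl fun m _ => ?_
    congr 2
    ext i; simp
  · intro a ha
    obtain ⟨m, hm, rfl⟩ := Finset.mem_image.1 ha
    exact hmem m hm
  · intro a _ ha
    have : P.coeff (Finsupp.equivFunOnFinite.symm a) = 0 := by
      by_contra h
      exact ha (Finset.mem_image.2 ⟨_, MvPolynomial.mem_support_iff.2 h, by ext; simp⟩)
    rw [this, zero_mul]

theorem sum_mul_eval_eq_zero {d : ℕ} {ι : Type*} [Fintype ι] {y : ι → Pt d} {u : ι → ℝ} {e : ℕ}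
    (h : ∀ a ∈ monoEq d e, moment y u a = 0) {P : MvPolynomial (Fin d) ℝ}
    (hP : P.IsHomogeneous e) : ∑ i, u i * MvPolynomial.eval (y i).ofLp P = 0 := by
  simp_rw [eval_eq_sum_piAntidiag hP, Finset.mul_sum]
  rw [Finset.sum_comm]
  refine Finset.sum_eq_zero fun a ha => ?_
  have := h a ha
  rw [moment] at this
  rw [← mul_zero (P.coeff (Finsupp.equivFunOnFinite.symm a)), ← this, Finset.mul_sum]
  exact Finset.sum_congr rfl fun i _ => by rw [monoVal]; ring

theorem norm_sq_eq_sum {d : ℕ} (x : Pt d) : ‖x‖ ^ 2 = ∑ i, x i ^ 2 := by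
  rw [EuclideanSpace.norm_sq_eq]; simp

/-- `‖x - y‖ ^ (2 j)` is a homogeneous polynomial in the `2 d` coordinates of `x` and `y`; a
monomial in them is a pair of multi-indices. The coefficients `c` are chosen before `k`, so they do
not depend on the truncation. -/
theorem exists_coeff_norm_sub_pow (d j : ℕ) : ∃ c : (Fin d → ℕ) → (Fin d → ℕ) → ℝ,
    (∀ a b, ∑ i, a i + ∑ i, b i ≠ 2 * j → c a b = 0) ∧
    ∀ (k : ℕ), 2 * j < k → ∀ x y : Pt d, ‖x - y‖ ^ (2 * j) =
      ∑ a ∈ monoLt d k, ∑ b ∈ monoLt d k, c a b * (monoVal x a * monoVal y b) := by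
  classical
  let P : MvPolynomial (Fin d ⊕ Fin d) ℝ :=
    (∑ i, (MvPolynomial.X (Sum.inl i) - MvPolynomial.X (Sum.inr i)) ^ 2) ^ j
  have hP : P.IsHomogeneous (2 * j) := by
    refine MvPolynomial.IsHomogeneous.pow (MvPolynomial.IsHomogeneous.sum _ _ _ fun i _ => ?_) j
    exact ((MvPolynomial.isHomogeneous_X ℝ (Sum.inl i : Fin d ⊕ Fin d)).sub
      (MvPolynomial.isHomogeneous_X ℝ (Sum.inr i : Fin d ⊕ Fin d))).pow 2
  refine ⟨fun a b => P.coeff (Finsupp.equivFunOnFinite.symm (Sum.elim a b)), ?_, ?_⟩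
  · intro a b hab
    refine hP.coeff_eq_zero ?_
    rw [Finsupp.degree_eq_sum]
    simpa using hab
  · intro k hk x y
    have h1 : ‖x - y‖ ^ (2 * j) = MvPolynomial.eval (Sum.elim x.ofLp y.ofLp) P := by
      rw [pow_mul, norm_sq_eq_sum]
      simp [P]
    rw [h1, eval_eq_sum_piAntidiag hP, ← Finset.sum_product']
    symm
    rw [← Finset.sum_filter_of_ne (p := fun q => ∑ i, q.1 i + ∑ i, q.2 i = 2 * j)]
    · refine Finset.sum_nbij' (fun q => Sum.elim q.1 q.2) (fun a => (a ∘ Sum.inl, a ∘ Sum.inr))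
        ?_ ?_ ?_ ?_ ?_
      · intro q hq
        simpa using (Finset.mem_filter.1 hq).2
      · intro a ha
        have : ∑ i, a (Sum.inl i) + ∑ i, a (Sum.inr i) = 2 * j := by simpa using ha
        simp only [Finset.mem_filter, Finset.mem_product, mem_monoLt, Function.comp_apply]
        exact ⟨⟨by omega, by omega⟩, this⟩
      · intro q _; rfl
      · intro a _; ext i; rcases i with i | i <;> rfl
      · intro q _
        simp [monoVal]
    · intro q _ hq
      by_contra h
      refine hq ?_
      dsimp only
      rw [hP.coeff_eq_zero, zero_mul]
      rw [Finsupp.degree_eq_sum]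
      simpa using h

/-! ### Expansion of the kernel at the origin -/

/-- The remainder is the `n`-fold iterated slope at `0`. It is analytic at `0`, and the identity
defining a slope holds at every `t`, so no smallness condition is needed. -/
theorem exists_eq_sum_coeff_add {f : ℝ → ℝ} {p : FormalMultilinearSeries ℝ ℝ ℝ}
    (hp : HasFPowerSeriesAt f p 0) (n : ℕ) :
    ∃ φ : ℝ → ℝ, AnalyticAt ℝ φ 0 ∧ φ 0 = p.coeff n ∧
      ∀ t, f t = ∑ i ∈ Finset.range n, p.coeff i * t ^ i + t ^ n * φ t := by
  have hval : ∀ k, ((Function.swap dslope 0)^[k] f) 0 = p.coeff k := by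
    intro k
    have h := hp.has_fpower_series_iterate_dslope_fslope k
    rw [← h.coeff_zero 1]
    have := FormalMultilinearSeries.coeff_iterate_fslope (p := p) k 0
    rw [zero_add] at this
    rw [← this]
    rfl
  refine ⟨(Function.swap dslope 0)^[n] f,
    (hp.has_fpower_series_iterate_dslope_fslope n).analyticAt, hval n, fun t => ?_⟩
  induction n with
  | zero => simp
  | succ n ih =>
    rw [ih, Finset.sum_range_succ, add_assoc]
    congr 1
    rw [Function.iterate_succ_apply']
    have h := sub_smul_dslope ((Function.swap dslope 0)^[n] f) 0 t
    rw [hval n, sub_zero, smul_eq_mul] at h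
    rw [pow_succ, mul_assoc]
    have h' : (Function.swap dslope 0)^[n] f t = p.coeff n +
      t * dslope ((Function.swap dslope 0)^[n] f) 0 t := by rw [h]; ring
    rw [h']
    change _ = p.coeff n * t ^ n + t ^ n * (t * dslope ((Function.swap dslope 0)^[n] f) 0 t)
    ring

theorem exists_eq_sum_taylorCoeff_add {f : ℝ → ℝ} (hf : AnalyticAt ℝ f 0) (n : ℕ) :
    ∃ φ : ℝ → ℝ, AnalyticAt ℝ φ 0 ∧ φ 0 = taylorCoeff f n ∧
      ∀ t, f t = ∑ i ∈ Finset.range n, taylorCoeff f i * t ^ i + t ^ n * φ t := by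
  have h := exists_eq_sum_coeff_add hf.hasFPowerSeriesAt n
  simpa [FormalMultilinearSeries.coeff_ofScalars, taylorCoeff] using h

theorem sum_range_two_mul_add_one {M : Type*} [AddCommMonoid M] (g : ℕ → M) (m : ℕ) :
    ∑ i ∈ Finset.range (2 * m + 1), g i =
      ∑ j ∈ Finset.range (m + 1), g (2 * j) + ∑ j ∈ Finset.range m, g (2 * j + 1) := by
  induction m with
  | zero => simp
  | succ m ih =>
    rw [show 2 * (m + 1) + 1 = 2 * m + 1 + 1 + 1 by ring, Finset.sum_range_succ,
      Finset.sum_range_succ, ih, Finset.sum_range_succ _ (m + 1), Finset.sum_range_succ _ m]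
    rw [Finset.sum_range_succ _ m, show 2 * (m + 1) = 2 * m + 1 + 1 by ring]
    abel

/-- The profile `f` is `∑_{j < r} f_{2j} t^{2j} + t^{2r-1} φ(t)`, and `w` holds the coefficients of
the polynomial part of the kernel. -/
structure IsKernelExpansion (d : ℕ) (f : ℝ → ℝ) (r : ℕ) (w : (Fin d → ℕ) → (Fin d → ℕ) → ℝ)
    (φ : ℝ → ℝ) : Prop where
  one_le : 1 ≤ r
  coeff_eq_zero : ∀ a b, 2 * r ≤ ∑ i, a i + ∑ i, b i → w a b = 0
  coeff_symm : ∀ a b, w a b = w b a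
  sum_eq : ∀ x y : Pt d, ∑ j ∈ Finset.range r, taylorCoeff f (2 * j) * ‖x - y‖ ^ (2 * j) =
    ∑ a ∈ monoLt d (2 * r), ∑ b ∈ monoLt d (2 * r), w a b * (monoVal x a * monoVal y b)
  analyticAt : AnalyticAt ℝ φ 0
  apply_zero : φ 0 = taylorCoeff f (2 * r - 1)
  ne_zero : taylorCoeff f (2 * r - 1) ≠ 0
  eq_add : ∀ t, f t = ∑ j ∈ Finset.range r, taylorCoeff f (2 * j) * t ^ (2 * j) +
    t ^ (2 * r - 1) * φ t

theorem exists_isKernelExpansion (d : ℕ) {f : ℝ → ℝ} {r : ℕ} (hf : AnalyticAt ℝ f 0)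
    (hr : IsSmoothnessOrder f r) : ∃ w φ, IsKernelExpansion d f r w φ := by
  obtain ⟨φ, hφ, hφ0, hφe⟩ := exists_eq_sum_taylorCoeff_add hf (2 * r - 1)
  choose c hc0 hc using exists_coeff_norm_sub_pow d
  have hr1 : 1 ≤ r := hr.1.1
  -- Averaging over the exchange of `x` and `y` makes the coefficients symmetric without changing
  -- the kernel.
  refine ⟨fun a b => ∑ j ∈ Finset.range r, taylorCoeff f (2 * j) * ((c j a b + c j b a) / 2), φ,
    hr1, ?_, ?_, ?_, hφ, hφ0, hr.1.2, ?_⟩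
  · intro a b hab
    refine Finset.sum_eq_zero fun j hj => ?_
    have := Finset.mem_range.1 hj
    rw [hc0 j a b (by omega), hc0 j b a (by omega)]; simp
  · intro a b
    exact Finset.sum_congr rfl fun j _ => by rw [add_comm]
  · intro x y
    have h1 : ∀ j ∈ Finset.range r, ‖x - y‖ ^ (2 * j) = ∑ a ∈ monoLt d (2 * r),
        ∑ b ∈ monoLt d (2 * r), ((c j a b + c j b a) / 2) * (monoVal x a * monoVal y b) := by
      intro j hj
      have hj' := Finset.mem_range.1 hj
      have e1 := hc j (2 * r) (by omega) x y
      have e2 := hc j (2 * r) (by omega) y x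
      rw [norm_sub_rev, Finset.sum_comm] at e2
      have : ‖x - y‖ ^ (2 * j) = (‖x - y‖ ^ (2 * j) + ‖x - y‖ ^ (2 * j)) / 2 := by ring
      rw [this]
      conv_lhs =>
        congr
        · congr
          · rw [e1]
          · rw [e2]
      rw [← Finset.sum_add_distrib, Finset.sum_div]
      refine Finset.sum_congr rfl fun a _ => ?_
      rw [← Finset.sum_add_distrib, Finset.sum_div]
      exact Finset.sum_congr rfl fun b _ => by ring
    rw [Finset.sum_congr rfl fun j hj => by rw [h1 j hj]]
    simp_rw [Finset.mul_sum, Finset.sum_mul]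
    rw [Finset.sum_comm]
    refine Finset.sum_congr rfl fun a _ => ?_
    rw [Finset.sum_comm]
    exact Finset.sum_congr rfl fun b _ => Finset.sum_congr rfl fun j _ => by ring
  · intro t
    rw [hφe t]
    congr 1
    obtain ⟨m, rfl⟩ : ∃ m, r = m + 1 := ⟨r - 1, by omega⟩
    rw [show 2 * (m + 1) - 1 = 2 * m + 1 by omega,
      sum_range_two_mul_add_one fun i => taylorCoeff f i * t ^ i]
    rw [add_eq_left]
    refine Finset.sum_eq_zero fun j hj => ?_
    have hj' := Finset.mem_range.1 hj
    -- Minimality of `r`: an odd coefficient of index below `2 r - 1` must vanish.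
    have : taylorCoeff f (2 * j + 1) = 0 := by
      by_contra h
      have := hr.2 (show j + 1 ∈ _ from ⟨by omega, by
        rwa [show 2 * (j + 1) - 1 = 2 * j + 1 by omega]⟩)
      omega
    rw [this, zero_mul]

/-- The basic expansion in `ε`: the polynomial part sees the weights only through their moments, and
the singular part carries the power `ε ^ (2 r - 1)`. -/
theorem IsKernelExpansion.bilin_eq {d r : ℕ} {f : ℝ → ℝ} {w : (Fin d → ℕ) → (Fin d → ℕ) → ℝ}
    {φ : ℝ → ℝ} (h : IsKernelExpansion d f r w φ) {ι : Type*} [Fintype ι] (y : ι → Pt d)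
    (u v : ι → ℝ) {ε : ℝ} (hε : 0 < ε) :
    ∑ i, ∑ j, u i * v j * f (ε * ‖y i - y j‖) =
      ∑ a ∈ monoLt d (2 * r), ∑ b ∈ monoLt d (2 * r),
        ε ^ (∑ i, a i + ∑ i, b i) * w a b * (moment y u a * moment y v b) +
      ε ^ (2 * r - 1) * ∑ i, ∑ j, u i * v j *
        (‖y i - y j‖ ^ (2 * r - 1) * φ (ε * ‖y i - y j‖)) := by
  have h1 : ∀ i j, f (ε * ‖y i - y j‖) = (∑ a ∈ monoLt d (2 * r), ∑ b ∈ monoLt d (2 * r),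
      ε ^ (∑ i, a i + ∑ i, b i) * w a b * (monoVal (y i) a * monoVal (y j) b)) +
      ε ^ (2 * r - 1) * (‖y i - y j‖ ^ (2 * r - 1) * φ (ε * ‖y i - y j‖)) := by
    intro i j
    rw [h.eq_add]
    congr 1
    · have := h.sum_eq (ε • y i) (ε • y j)
      rw [← smul_sub, norm_smul, Real.norm_of_nonneg hε.le] at this
      rw [this]
      refine Finset.sum_congr rfl fun a _ => Finset.sum_congr rfl fun b _ => ?_
      rw [monoVal_smul, monoVal_smul, pow_add]
      ring
    · rw [mul_pow]; ring
  simp_rw [h1, mul_add, Finset.sum_add_distrib]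
  congr 1
  · simp only [moment, Finset.sum_mul_sum]
    simp_rw [Finset.mul_sum]
    have e : ∀ i : ι, ∑ j, ∑ a ∈ monoLt d (2 * r), ∑ b ∈ monoLt d (2 * r), u i * v j *
        (ε ^ (∑ i, a i + ∑ i, b i) * w a b * (monoVal (y i) a * monoVal (y j) b)) =
        ∑ a ∈ monoLt d (2 * r), ∑ b ∈ monoLt d (2 * r), ∑ j, ε ^ (∑ i, a i + ∑ i, b i) * w a b *
          (u i * monoVal (y i) a * (v j * monoVal (y j) b)) := by
      intro i
      rw [Finset.sum_comm]
      refine Finset.sum_congr rfl fun a _ => ?_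
      rw [Finset.sum_comm]
      exact Finset.sum_congr rfl fun b _ => Finset.sum_congr rfl fun j _ => by ring
    rw [Finset.sum_congr rfl fun i _ => e i, Finset.sum_comm]
    refine Finset.sum_congr rfl fun a _ => ?_
    rw [Finset.sum_comm]
  · simp_rw [Finset.mul_sum]
    exact Finset.sum_congr rfl fun i _ => Finset.sum_congr rfl fun j _ => by ring

/-! ### Iterated partial derivatives -/

section PartialDeriv

variable {d : ℕ}

/-- The iterated partial derivative along a list of directions. -/
def listDeriv (L : List (Fin d)) (g : Pt d → ℝ) : Pt d → ℝ := L.foldr partialDeriv g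

/-- The list of directions in which `multiDeriv a` differentiates. -/
def directions (a : Fin d → ℕ) : List (Fin d) :=
  (List.finRange d).flatMap fun i => List.replicate (a i) i

theorem length_directions (a : Fin d → ℕ) : (directions a).length = ∑ i, a i := by
  simp [directions, List.length_flatMap, List.sum_ofFn, ← List.ofFn_eq_map]

theorem multiDeriv_eq_listDeriv (a : Fin d → ℕ) (g : Pt d → ℝ) :
    multiDeriv a g = listDeriv (directions a) g := by
  have h1 : ∀ (i : Fin d) (m : ℕ) (h : Pt d → ℝ),
      (List.replicate m i).foldr partialDeriv h = (partialDeriv i)^[m] h := by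
    intro i m h
    induction m with
    | zero => rfl
    | succ m ih => rw [List.replicate_succ, List.foldr_cons, ih, Function.iterate_succ_apply']
  unfold multiDeriv listDeriv directions
  induction List.finRange d with
  | nil => rfl
  | cons i l ih => rw [List.foldr_cons, List.flatMap_cons, List.foldr_append, ih, h1]

theorem listDeriv_congr {g g' : Pt d → ℝ} {x : Pt d} (L : List (Fin d)) (h : g =ᶠ[𝓝 x] g') :
    listDeriv L g =ᶠ[𝓝 x] listDeriv L g' := by
  induction L with
  | nil => exact h
  | cons i L ih =>
    filter_upwards [ih.eventuallyEq_nhds] with y hy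
    exact hy.lineDeriv_eq

theorem partialDeriv_eventuallyEq {g : Pt d → ℝ} {x : Pt d} (hg : ContDiffAt ℝ 1 g x) (i : Fin d) :
    partialDeriv i g =ᶠ[𝓝 x] fun y => fderiv ℝ g y (EuclideanSpace.single i 1) := by
  filter_upwards [hg.eventually (by simp)] with y hy
  exact (hy.differentiableAt (by simp)).lineDeriv_eq_fderiv

theorem contDiffAt_partialDeriv {g : Pt d → ℝ} {x : Pt d} {k : ℕ} (i : Fin d)
    (hg : ContDiffAt ℝ (k + 1 : ℕ) g x) : ContDiffAt ℝ k (partialDeriv i g) x := by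
  refine ContDiffAt.congr_of_eventuallyEq ?_
    (partialDeriv_eventuallyEq (hg.of_le (by exact_mod_cast Nat.le_add_left 1 k)) i)
  exact (hg.fderiv_right (m := k) (by norm_cast)).clm_apply contDiffAt_const

theorem contDiffAt_listDeriv {g : Pt d → ℝ} {x : Pt d} {k : ℕ} (L : List (Fin d))
    (hg : ContDiffAt ℝ (k + L.length : ℕ) g x) : ContDiffAt ℝ k (listDeriv L g) x := by
  induction L generalizing k with
  | nil => exact hg
  | cons i L ih =>
    refine contDiffAt_partialDeriv i (ih ?_)
    rw [List.length_cons] at hg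
    rwa [add_right_comm, add_assoc]

theorem listDeriv_add {g g' : Pt d → ℝ} {x : Pt d} (L : List (Fin d))
    (hg : ContDiffAt ℝ L.length g x) (hg' : ContDiffAt ℝ L.length g' x) :
    listDeriv L (fun y => g y + g' y) =ᶠ[𝓝 x] fun y => listDeriv L g y + listDeriv L g' y := by
  induction L with
  | nil => exact EventuallyEq.rfl
  | cons i L ih =>
    rw [List.length_cons] at hg hg'
    have h1 := contDiffAt_listDeriv (k := 1) (g := g) L (by rwa [add_comm])
    have h2 := contDiffAt_listDeriv (k := 1) (g := g') L (by rwa [add_comm])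
    have h0 := ih (hg.of_le (by exact_mod_cast Nat.le_succ _))
      (hg'.of_le (by exact_mod_cast Nat.le_succ _))
    filter_upwards [h0.eventuallyEq_nhds, h1.eventually (by simp), h2.eventually (by simp)]
      with y hy hy1 hy2
    have e1 := (hy1.differentiableAt (by simp)).hasFDerivAt.hasLineDerivAt
      (EuclideanSpace.single i (1 : ℝ))
    have e2 := (hy2.differentiableAt (by simp)).hasFDerivAt.hasLineDerivAt
      (EuclideanSpace.single i (1 : ℝ))
    refine (hy.lineDeriv_eq (v := EuclideanSpace.single i (1 : ℝ))).trans ?_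
    change _ = lineDeriv ℝ (listDeriv L g) y _ + lineDeriv ℝ (listDeriv L g') y _
    rw [e1.lineDeriv, e2.lineDeriv]
    exact HasLineDerivAt.lineDeriv (HasDerivAt.add e1 e2)

theorem listDeriv_const_mul (L : List (Fin d)) (c : ℝ) (g : Pt d → ℝ) :
    listDeriv L (fun y => c * g y) = fun y => c * listDeriv L g y := by
  induction L with
  | nil => rfl
  | cons i L ih =>
    ext y
    change lineDeriv ℝ (listDeriv L fun y => c * g y) y _ = c * lineDeriv ℝ (listDeriv L g) y _
    rw [ih, lineDeriv, lineDeriv, deriv_const_mul_field]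

theorem listDeriv_zero (L : List (Fin d)) :
    listDeriv L (fun _ => 0) = fun _ => 0 := by
  simpa using listDeriv_const_mul L 0 (fun _ => 0)

theorem listDeriv_sum {κ : Type*} (s : Finset κ) {g : κ → Pt d → ℝ} {x : Pt d} (c : κ → ℝ)
    (L : List (Fin d)) (hg : ∀ k ∈ s, ContDiffAt ℝ L.length (g k) x) :
    listDeriv L (fun y => ∑ k ∈ s, c k * g k y) =ᶠ[𝓝 x]
      fun y => ∑ k ∈ s, c k * listDeriv L (g k) y := by
  classical
  induction s using Finset.induction_on with
  | empty => simp [listDeriv_zero]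
  | insert k s hk ih =>
    simp_rw [Finset.sum_insert hk]
    have hg' := ih fun j hj => hg j (Finset.mem_insert_of_mem hj)
    have h1 : ContDiffAt ℝ L.length (fun y => c k * g k y) x :=
      contDiffAt_const.mul (hg k (Finset.mem_insert_self _ _))
    have h2 : ContDiffAt ℝ L.length (fun y => ∑ k ∈ s, c k * g k y) x :=
      ContDiffAt.sum fun j hj => contDiffAt_const.mul (hg j (Finset.mem_insert_of_mem hj))
    filter_upwards [listDeriv_add L h1 h2, hg'] with y hy hy'
    rw [hy, hy', listDeriv_const_mul]

theorem listDeriv_const_sub (L : List (Fin d)) (g : Pt d → ℝ) (z : Pt d) :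
    listDeriv L (fun y => g (z - y)) = fun y => (-1) ^ L.length * listDeriv L g (z - y) := by
  induction L with
  | nil => simp [listDeriv]
  | cons i L ih =>
    ext y
    change lineDeriv ℝ (listDeriv L fun y => g (z - y)) y _ =
      _ * lineDeriv ℝ (listDeriv L g) (z - y) _
    rw [ih, lineDeriv, lineDeriv, deriv_const_mul_field, List.length_cons, pow_succ]
    have := deriv_comp_neg (fun t : ℝ => listDeriv L g (z - y + t • EuclideanSpace.single i 1)) 0
    rw [neg_zero] at this
    rw [mul_assoc, neg_one_mul, ← this]
    congr 2
    ext t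
    congr 1
    rw [neg_smul]
    abel

theorem contDiff_monoVal (c : Fin d → ℕ) {N : WithTop ℕ∞} :
    ContDiff ℝ N fun y : Pt d => monoVal y c := by
  unfold monoVal
  fun_prop

theorem partialDeriv_monoVal (i : Fin d) (c : Fin d → ℕ) :
    partialDeriv i (fun y => monoVal y c) =
      fun y => (c i : ℝ) * monoVal y (Function.update c i (c i - 1)) := by
  ext y
  have h : ∀ (z : Pt d) (e : Fin d → ℕ), monoVal z e =
      z i ^ e i * ∏ j ∈ Finset.univ.erase i, z j ^ e j := fun z e =>
    (Finset.mul_prod_erase Finset.univ (fun j => z j ^ e j) (Finset.mem_univ i)).symm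
  rw [partialDeriv, lineDeriv]
  have h1 : (fun t : ℝ => monoVal (y + t • EuclideanSpace.single i (1 : ℝ)) c) =
      fun t => (y i + t) ^ c i * ∏ j ∈ Finset.univ.erase i, y j ^ c j := by
    ext t
    rw [h]
    congr 1
    · simp
    · refine Finset.prod_congr rfl fun j hj => ?_
      simp [Finset.ne_of_mem_erase hj]
  rw [h1, deriv_mul_const_field, h, Function.update_self]
  have h2 : ∏ j ∈ Finset.univ.erase i, y j ^ Function.update c i (c i - 1) j =
      ∏ j ∈ Finset.univ.erase i, y j ^ c j :=
    Finset.prod_congr rfl fun j hj => by rw [Function.update_of_ne (Finset.ne_of_mem_erase hj)]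
  rw [h2, ← mul_assoc]
  congr 1
  have h3 : HasDerivAt (fun t : ℝ => (y i + t) ^ c i) (c i * (y i + 0) ^ (c i - 1) * 1) 0 :=
    ((hasDerivAt_id 0).const_add (y i)).pow (c i)
  rw [h3.deriv]
  simp

theorem iterate_partialDeriv_monoVal (i : Fin d) (m : ℕ) (c : Fin d → ℕ) :
    (partialDeriv i)^[m] (fun y => monoVal y c) =
      fun y => ((c i).descFactorial m : ℝ) * monoVal y (Function.update c i (c i - m)) := by
  induction m with
  | zero => simp
  | succ m ih =>
    rw [Function.iterate_succ_apply', ih]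
    have h1 := listDeriv_const_mul [i] ((c i).descFactorial m : ℝ)
      (fun y => monoVal y (Function.update c i (c i - m)))
    have h2 := partialDeriv_monoVal i (Function.update c i (c i - m))
    simp only [listDeriv, List.foldr_cons, List.foldr_nil] at h1
    rw [h1, h2]
    ext y
    rw [Function.update_self, Function.update_idem, Nat.sub_sub, Nat.descFactorial_succ]
    push_cast
    ring

/-- A coordinate with `c i < b i` is differentiated to zero, and one with `c i > b i` leaves a
positive power, which vanishes at the origin. -/
theorem multiDeriv_monoVal_zero (b c : Fin d → ℕ) :
    multiDeriv b (fun y => monoVal y c) 0 = if c = b then ∏ i, ((b i).factorial : ℝ) else 0 := by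
  have key : ∀ l : List (Fin d), l.Nodup →
      l.foldr (fun i h => (partialDeriv i)^[b i] h) (fun y => monoVal y c) =
      fun y => (l.map fun i => ((c i).descFactorial (b i) : ℝ)).prod *
        monoVal y (fun i => if i ∈ l then c i - b i else c i) := by
    intro l hl
    induction l with
    | nil => simp
    | cons i l ih =>
      rw [List.nodup_cons] at hl
      rw [List.foldr_cons, ih hl.2]
      have h1 := listDeriv_const_mul (List.replicate (b i) i)
        (l.map fun i => ((c i).descFactorial (b i) : ℝ)).prod
        (fun y => monoVal y (fun i => if i ∈ l then c i - b i else c i))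
      have h0 : ∀ (m : ℕ) (h : Pt d → ℝ),
          listDeriv (List.replicate m i) h = (partialDeriv i)^[m] h := by
        intro m h
        induction m with
        | zero => rfl
        | succ m ih' =>
          rw [Function.iterate_succ_apply', ← ih']
          rfl
      rw [h0, h0, iterate_partialDeriv_monoVal] at h1
      rw [h1]
      ext y
      rw [List.map_cons, List.prod_cons]
      simp only [hl.1, if_false]
      rw [← mul_assoc, mul_comm (List.prod _)]
      congr 2
      ext j
      by_cases hj : j = i
      · subst hj; simp
      · simp [hj]
  rw [multiDeriv, key _ (List.nodup_finRange d)]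
  simp only [List.mem_finRange, if_true]
  rw [← List.ofFn_eq_map, List.prod_ofFn]
  split_ifs with h
  · subst h
    simp [monoVal, Nat.descFactorial_self]
  · obtain ⟨i, hi⟩ := Function.ne_iff.1 h
    rcases lt_or_gt_of_ne hi with hi | hi
    · rw [Finset.prod_eq_zero (Finset.mem_univ i), zero_mul]
      rw [Nat.descFactorial_eq_zero_iff_lt.2 hi]; simp
    · have : monoVal (0 : Pt d) (fun i => c i - b i) = 0 := by
        rw [monoVal]
        refine Finset.prod_eq_zero (Finset.mem_univ i) ?_
        simp; omega
      rw [this, mul_zero]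

end PartialDeriv

/-! ### Flat functions -/

section Flat

variable {d : ℕ}

/-- `h` is `k` times continuously differentiable at `0` and its derivatives of order `≤ k` vanish
there. -/
def IsFlat (k : ℕ) (h : Pt d → ℝ) : Prop :=
  ContDiffAt ℝ k h 0 ∧ ∀ j ≤ k, iteratedFDeriv ℝ j h 0 = 0

theorem exists_norm_le_pow_of_homogeneous {F : Type*} [NormedAddCommGroup F] [NormedSpace ℝ F]
    (h : Pt d → F) {s : ℕ} (hs : 0 < s) (hc : ∀ x ≠ 0, ContinuousAt h x)
    (hh : ∀ t : ℝ, 0 < t → ∀ x, h (t • x) = t ^ s • h x) :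
    ∃ C, ∀ x, ‖h x‖ ≤ C * ‖x‖ ^ s := by
  obtain ⟨C, hC⟩ := (isCompact_sphere (0 : Pt d) 1).exists_bound_of_continuousOn (f := h)
    fun x hx => (hc x (by rintro rfl; simp at hx)).continuousWithinAt
  refine ⟨C, fun x => ?_⟩
  by_cases hx : x = 0
  · have h0 : h 0 = 0 := by
      have := hh 2 two_pos 0
      rw [smul_zero] at this
      have h2 : ((2 : ℝ) ^ s - 1) • h 0 = 0 := by rw [sub_smul, one_smul, ← this, sub_self]
      have h3 : (1 : ℝ) < 2 ^ s := one_lt_pow₀ one_lt_two hs.ne'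
      exact (smul_eq_zero.1 h2).resolve_left (by linarith)
    rw [hx, h0, norm_zero, norm_zero, zero_pow hs.ne', mul_zero]
  · have hx' : 0 < ‖x‖ := norm_pos_iff.2 hx
    have h1 : x = ‖x‖ • (‖x‖⁻¹ • x) := by rw [smul_smul, mul_inv_cancel₀ hx'.ne', one_smul]
    have h2 := hC (‖x‖⁻¹ • x) (by simp [norm_smul, hx'.ne'])
    conv_lhs => rw [h1, hh _ hx', norm_smul, norm_pow, norm_norm]
    rw [mul_comm]
    exact mul_le_mul_of_nonneg_right h2 (by positivity)

/-- Induction on `k`: the derivative of a function homogeneous of degree `s` is homogeneous of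
degree `s - 1`. The target space is quantified inside the statement because it changes when passing
to `fderiv`. -/
theorem contDiff_of_homogeneous (k : ℕ) : ∀ {F : Type} [NormedAddCommGroup F] [NormedSpace ℝ F]
    (h : Pt d → F) (s : ℕ), k < s → (∀ x ≠ 0, ContDiffAt ℝ k h x) →
    (∀ t : ℝ, 0 < t → ∀ x, h (t • x) = t ^ s • h x) →
    ContDiff ℝ k h ∧ ∀ j ≤ k, iteratedFDeriv ℝ j h 0 = 0 := by
  induction k with
  | zero =>
    intro F _ _ h s hs hsm hh
    obtain ⟨C, hC⟩ := exists_norm_le_pow_of_homogeneous h (s := s) (by omega)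
      (fun x hx => (hsm x hx).continuousAt) hh
    have h0 : h 0 = 0 := by
      have := hC 0
      rw [norm_zero, zero_pow (by omega), mul_zero] at this
      exact norm_le_zero_iff.1 this
    refine ⟨?_, fun j hj => ?_⟩
    · rw [Nat.cast_zero, contDiff_zero, continuous_iff_continuousAt]
      intro x
      by_cases hx : x = 0
      · subst hx
        rw [ContinuousAt, h0]
        refine squeeze_zero_norm hC ?_
        have : Continuous fun x : Pt d => C * ‖x‖ ^ s := by fun_prop
        have h1 := this.tendsto 0
        simpa [hs.ne'] using h1
      · exact (hsm x hx).continuousAt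
    · obtain rfl : j = 0 := by omega
      ext v
      simpa using h0
  | succ k ih =>
    intro F _ _ h s hs hsm hh
    obtain ⟨C, hC⟩ := exists_norm_le_pow_of_homogeneous h (s := s) (by omega)
      (fun x hx => (hsm x hx).continuousAt) hh
    have h0 : h 0 = 0 := by
      have := hC 0
      rw [norm_zero, zero_pow (by omega), mul_zero] at this
      exact norm_le_zero_iff.1 this
    -- The bound `‖h x‖ ≤ C ‖x‖ ^ s` with `s ≥ 2` gives a vanishing derivative at the origin.
    have hd0 : HasFDerivAt h (0 : Pt d →L[ℝ] F) 0 := by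
      have hO : h =O[𝓝 0] fun x : Pt d => ‖x - 0‖ ^ s := by
        refine Asymptotics.IsBigO.of_bound C (Eventually.of_forall fun x => ?_)
        rw [sub_zero, norm_pow, norm_norm]
        exact hC x
      exact hO.hasFDerivAt (by omega)
    have hd : Differentiable ℝ h := by
      intro x
      by_cases hx : x = 0
      · subst hx; exact hd0.differentiableAt
      · exact (hsm x hx).differentiableAt (by simp)
    have ih' := ih (fderiv ℝ h) (s - 1) (by omega)
      (fun x hx => (hsm x hx).fderiv_right (by norm_cast)) (by
        intro t ht x
        have h1 : HasFDerivAt (fun y => h (t • y)) (t • fderiv ℝ h (t • x)) x := by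
          have := (hd (t • x)).hasFDerivAt.comp x ((hasFDerivAt_id x).const_smul t)
          refine this.congr_fderiv ?_
          ext v; simp
        have h2 : HasFDerivAt (fun y => h (t • y)) (t ^ s • fderiv ℝ h x) x := by
          have := (hd x).hasFDerivAt.const_smul (t ^ s)
          refine this.congr_of_eventuallyEq (Eventually.of_forall fun y => hh t ht y)
        have h3 := h1.unique h2
        rw [show s = (s - 1) + 1 by omega, pow_succ', mul_smul] at h3
        exact smul_right_injective _ ht.ne' h3)
    refine ⟨?_, fun j hj => ?_⟩
    · have : ((k + 1 : ℕ) : WithTop ℕ∞) = k + 1 := by norm_cast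
      rw [this, contDiff_succ_iff_fderiv]
      exact ⟨hd, by simp, ih'.1⟩
    · rcases j with _ | j
      · ext v
        simpa using h0
      · rw [← norm_eq_zero, ← norm_iteratedFDeriv_fderiv, ih'.2 j (by omega), norm_zero]

theorem IsFlat.congr {k : ℕ} {h h' : Pt d → ℝ} (hh : IsFlat k h) (e : h' =ᶠ[𝓝 0] h) :
    IsFlat k h' :=
  ⟨hh.1.congr_of_eventuallyEq e, fun j hj => by rw [(e.iteratedFDeriv ℝ j).eq_of_nhds, hh.2 j hj]⟩

theorem IsFlat.add {k : ℕ} {h h' : Pt d → ℝ} (hh : IsFlat k h) (hh' : IsFlat k h') :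
    IsFlat k fun x => h x + h' x := by
  refine ⟨hh.1.add hh'.1, fun j hj => ?_⟩
  have hjk : (j : WithTop ℕ∞) ≤ k := by exact_mod_cast hj
  have := iteratedFDeriv_add_apply (𝕜 := ℝ) (hh.1.of_le hjk) (hh'.1.of_le hjk)
  rw [hh.2 j hj, hh'.2 j hj, add_zero] at this
  exact this

theorem IsFlat.mul {k : ℕ} {h g : Pt d → ℝ} (hh : IsFlat k h) (hg : ContDiffAt ℝ k g 0) :
    IsFlat k fun x => h x * g x := by
  refine ⟨hh.1.mul hg, fun j hj => ?_⟩
  have hjk : (j : WithTop ℕ∞) ≤ k := by exact_mod_cast hj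
  obtain ⟨u, hu, hu'⟩ := hh.1.contDiffOn (m := k) le_rfl (by simp)
  obtain ⟨v, hv, hv'⟩ := hg.contDiffOn (m := k) le_rfl (by simp)
  obtain ⟨o, ho, hoo, h0⟩ := mem_nhds_iff.1 (inter_mem hu hv)
  -- In the Leibniz bound every term contains a derivative of `h` of order at most `k`, and these
  -- vanish at `0`.
  have hle := norm_iteratedFDerivWithin_mul_le (hu'.mono fun x hx => (ho hx).1)
    (hv'.mono fun x hx => (ho hx).2) hoo.uniqueDiffOn h0 hjk
  rw [iteratedFDerivWithin_of_isOpen j hoo h0] at hle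
  rw [← norm_le_zero_iff]
  refine hle.trans (le_of_eq (Finset.sum_eq_zero fun i hi => ?_))
  rw [iteratedFDerivWithin_of_isOpen i hoo h0, hh.2 i (by have := Finset.mem_range.1 hi; omega)]
  simp

theorem IsFlat.partialDeriv {k : ℕ} {h : Pt d → ℝ} (hh : IsFlat (k + 1) h) (i : Fin d) :
    IsFlat k (partialDeriv i h) := by
  have h1 : ContDiffAt ℝ k (fderiv ℝ h) 0 := hh.1.fderiv_right (by norm_cast)
  have hfl : IsFlat k fun y => fderiv ℝ h y (EuclideanSpace.single i 1) := by
    refine ⟨h1.clm_apply contDiffAt_const, fun j hj => ?_⟩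
    rw [← norm_le_zero_iff]
    refine (norm_iteratedFDeriv_clm_apply_const h1 (by exact_mod_cast hj)).trans (le_of_eq ?_)
    rw [norm_iteratedFDeriv_fderiv, hh.2 (j + 1) (by omega)]
    simp
  exact hfl.congr
    (partialDeriv_eventuallyEq (hh.1.of_le (by exact_mod_cast Nat.le_add_left 1 k)) i)

theorem IsFlat.listDeriv {k : ℕ} {h : Pt d → ℝ} (L : List (Fin d)) (hh : IsFlat (k + L.length) h) :
    IsFlat k (listDeriv L h) := by
  induction L generalizing k with
  | nil => exact hh
  | cons i L ih =>
    refine (ih ?_).partialDeriv i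
    rw [List.length_cons] at hh
    rwa [add_right_comm, add_assoc]

theorem IsFlat.apply_zero {k : ℕ} {h : Pt d → ℝ} (hh : IsFlat k h) : h 0 = 0 := by
  have := hh.2 0 (Nat.zero_le _)
  have h1 := congrArg (fun m => m 0) this
  simpa using h1

theorem isFlat_norm_pow {k s : ℕ} (hks : k < s) : IsFlat k fun x : Pt d => ‖x‖ ^ s := by
  have := contDiff_of_homogeneous k (fun x : Pt d => ‖x‖ ^ s) s hks
    (fun x hx => (contDiffAt_norm ℝ hx).pow s) (fun t ht x => by
      rw [norm_smul, Real.norm_of_nonneg ht.le, mul_pow, smul_eq_mul])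
  exact ⟨this.1.contDiffAt, this.2⟩

/-- If the terms of the series are bounded at `t = δ / 2`, then the coefficients of index `2 n + o`
define a power series of radius at least `(δ / 2) ^ 2` in the variable `t ^ 2`. -/
theorem hasSum_even_part {φ : ℝ → ℝ} (c : ℕ → ℝ)
    (h : ∀ᶠ t in 𝓝 (0 : ℝ), HasSum (fun n => t ^ n * c n) (φ t)) (o : ℕ) :
    ∃ A : ℝ → ℝ, AnalyticAt ℝ A 0 ∧
      ∀ᶠ t in 𝓝 (0 : ℝ), HasSum (fun n => (t ^ 2) ^ n * c (2 * n + o)) (A (t ^ 2)) := by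
  set q : FormalMultilinearSeries ℝ ℝ ℝ :=
    FormalMultilinearSeries.ofScalars ℝ (fun n => c (2 * n + o)) with hq
  obtain ⟨δ, hδ, hδ'⟩ := Metric.eventually_nhds_iff.1 h
  have hsum : Summable fun n => (δ / 2) ^ n * c n :=
    (hδ' (by rw [Real.dist_eq, sub_zero, abs_of_pos (by positivity)]; linarith)).summable
  obtain ⟨C, hC⟩ := (Metric.isBounded_range_of_tendsto _
    hsum.tendsto_atTop_zero).exists_norm_le
  have hrad : 0 < q.radius := by
    obtain ⟨ρ, hρ⟩ : ∃ ρ : NNReal, (ρ : ℝ) = (δ / 2) ^ 2 := ⟨⟨_, by positivity⟩, rfl⟩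
    have h1 : (ρ : ENNReal) ≤ q.radius := by
      refine q.le_radius_of_bound (C / (δ / 2) ^ o) fun n => ?_
      rw [hq, FormalMultilinearSeries.ofScalars_norm]
      have h2 := hC _ (Set.mem_range_self (2 * n + o))
      rw [norm_mul, norm_pow, Real.norm_of_nonneg (by positivity : (0 : ℝ) ≤ δ / 2)] at h2
      rw [le_div_iff₀ (by positivity), hρ]
      refine le_trans (le_of_eq ?_) h2
      rw [pow_add, pow_mul]
      ring
    refine lt_of_lt_of_le ?_ h1
    rw [ENNReal.coe_pos, ← NNReal.coe_pos, hρ]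
    positivity
  have hball := q.hasFPowerSeriesOnBall hrad
  refine ⟨q.sum, hball.analyticAt, ?_⟩
  have hev := (hasFPowerSeriesAt_iff.1 hball.hasFPowerSeriesAt)
  have hlim : Tendsto (fun t : ℝ => t ^ 2) (𝓝 0) (𝓝 0) := by
    have : Continuous fun t : ℝ => t ^ 2 := by fun_prop
    simpa using this.tendsto 0
  filter_upwards [hlim.eventually hev] with t ht
  rw [zero_add] at ht
  simpa [hq, FormalMultilinearSeries.coeff_ofScalars] using ht

/-- An analytic function is `A(t²) + t B(t²)` with `A` and `B` analytic. -/
theorem exists_even_add_odd {φ : ℝ → ℝ} (hφ : AnalyticAt ℝ φ 0) :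
    ∃ A B : ℝ → ℝ, AnalyticAt ℝ A 0 ∧ AnalyticAt ℝ B 0 ∧
      ∀ᶠ t in 𝓝 (0 : ℝ), φ t = A (t ^ 2) + t * B (t ^ 2) := by
  obtain ⟨p, hp⟩ := hφ
  have h : ∀ᶠ t in 𝓝 (0 : ℝ), HasSum (fun n => t ^ n * p.coeff n) (φ t) := by
    simpa using hasFPowerSeriesAt_iff.1 hp
  obtain ⟨A, hA, hA'⟩ := hasSum_even_part p.coeff h 0
  obtain ⟨B, hB, hB'⟩ := hasSum_even_part p.coeff h 1
  refine ⟨A, B, hA, hB, ?_⟩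
  filter_upwards [h, hA', hB'] with t h1 h2 h3
  have h4 : HasSum (fun n => t ^ (2 * n) * p.coeff (2 * n)) (A (t ^ 2)) := by
    simpa [pow_mul] using h2
  have h5 : HasSum (fun n => t ^ (2 * n + 1) * p.coeff (2 * n + 1)) (t * B (t ^ 2)) := by
    refine (h3.mul_left t).congr_fun ?_
    intro n
    rw [pow_succ, pow_mul]; ring
  exact h1.unique (h4.even_add_odd h5)

/-! ### The Wronskian matrix -/

/-- Splitting `φ` as `A (t²) + t B (t²)` turns the function into `‖x‖ ^ (2r-1)` and `‖x‖ ^ (2r)`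
times functions of `‖x‖²`, which are smooth near `0`. Both powers exceed `2 r - 2`, so homogeneity
makes them flat to that order. -/
theorem IsKernelExpansion.isFlat {r : ℕ} {f : ℝ → ℝ} {w : (Fin d → ℕ) → (Fin d → ℕ) → ℝ}
    {φ : ℝ → ℝ} (h : IsKernelExpansion d f r w φ) :
    IsFlat (2 * r - 2) fun x : Pt d => ‖x‖ ^ (2 * r - 1) * φ ‖x‖ := by
  have hr := h.one_le
  obtain ⟨A, B, hA, hB, hAB⟩ := exists_even_add_odd h.analyticAt
  have hsq : ContDiff ℝ (2 * r - 2 : ℕ) fun x : Pt d => ‖x‖ ^ 2 := contDiff_norm_sq ℝ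
  have hcomp : ∀ g : ℝ → ℝ, AnalyticAt ℝ g 0 →
      ContDiffAt ℝ (2 * r - 2 : ℕ) (fun x : Pt d => g (‖x‖ ^ 2)) 0 := by
    intro g hg
    refine ContDiffAt.comp (0 : Pt d) (g := g) ?_ hsq.contDiffAt
    simpa using hg.contDiffAt
  have h1 := ((isFlat_norm_pow (d := d) (k := 2 * r - 2) (s := 2 * r - 1) (by omega)).mul
    (hcomp A hA)).add
    ((isFlat_norm_pow (d := d) (k := 2 * r - 2) (s := 2 * r) (by omega)).mul (hcomp B hB))
  refine h1.congr ?_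
  have hlim : Tendsto (fun x : Pt d => ‖x‖) (𝓝 0) (𝓝 0) := by
    simpa using (continuous_norm (E := Pt d)).tendsto 0
  filter_upwards [hlim.eventually hAB] with x hx
  rw [hx]
  obtain ⟨m, rfl⟩ : ∃ m, r = m + 1 := ⟨r - 1, by omega⟩
  rw [show 2 * (m + 1) - 1 = 2 * m + 1 by omega]
  ring

/-- The total order `|a| + |b|` is at most `2 r - 2`, the order to which the singular part is flat.
So only the polynomial part contributes, and its derivatives at the origin are its coefficients. -/
theorem IsKernelExpansion.mixedDeriv_eq {r : ℕ} {f : ℝ → ℝ}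
    {w : (Fin d → ℕ) → (Fin d → ℕ) → ℝ} {φ : ℝ → ℝ} (h : IsKernelExpansion d f r w φ)
    {a b : Fin d → ℕ} (ha : ∑ i, a i < r) (hb : ∑ i, b i < r) :
    mixedDeriv a b (stationaryKernel d f) 0 0 =
      w a b * ((∏ i, ((a i).factorial : ℝ)) * ∏ i, ((b i).factorial : ℝ)) := by
  set ρ : Pt d → ℝ := fun x => ‖x‖ ^ (2 * r - 1) * φ ‖x‖ with hρ
  have hflat := h.isFlat
  have hker : ∀ x y : Pt d, stationaryKernel d f x y =
      ∑ b' ∈ monoLt d (2 * r), (∑ a' ∈ monoLt d (2 * r), w a' b' * monoVal x a') * monoVal y b' +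
        ρ (x - y) := by
    intro x y
    rw [stationaryKernel, h.eq_add, h.sum_eq, Finset.sum_comm]
    congr 1
    refine Finset.sum_congr rfl fun b' _ => ?_
    rw [Finset.sum_mul]
    exact Finset.sum_congr rfl fun a' _ => by ring
  have hbm : b ∈ monoLt d (2 * r) := mem_monoLt.2 (by omega)
  have ham : a ∈ monoLt d (2 * r) := mem_monoLt.2 (by omega)
  have hlb := length_directions b
  have hla := length_directions a
  -- The inner derivative is needed for all `x` near `0`, not only at `0`, since it is
  -- differentiated again in `x`.
  have hinner : (fun x => multiDeriv b (stationaryKernel d f x) 0) =ᶠ[𝓝 0] fun x =>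
      (∏ i, ((b i).factorial : ℝ)) * (∑ a' ∈ monoLt d (2 * r), w a' b * monoVal x a') +
        (-1) ^ (directions b).length * listDeriv (directions b) ρ x := by
    filter_upwards [hflat.1.eventually (by simp)] with x hx
    rw [multiDeriv_eq_listDeriv]
    have hk : stationaryKernel d f x = fun y =>
      (∑ b' ∈ monoLt d (2 * r), (∑ a' ∈ monoLt d (2 * r), w a' b' * monoVal x a') * monoVal y b') +
        ρ (x - y) := funext (hker x)
    have hx' : ContDiffAt ℝ (2 * r - 2 : ℕ) (fun y => ρ (x - y)) 0 := by
      refine ContDiffAt.comp (0 : Pt d) (g := ρ) ?_ (contDiffAt_const.sub contDiffAt_id)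
      simpa using hx
    rw [hk, (listDeriv_add (directions b) (ContDiffAt.sum fun b' _ =>
      contDiffAt_const.mul (contDiff_monoVal b').contDiffAt)
      (hx'.of_le (by rw [hlb]; exact_mod_cast (by omega)))).eq_of_nhds,
      (listDeriv_sum _ _ _ fun b' _ => (contDiff_monoVal b').contDiffAt).eq_of_nhds,
      listDeriv_const_sub]
    simp only [sub_zero]
    congr 1
    rw [Finset.sum_eq_single b]
    · rw [← multiDeriv_eq_listDeriv, multiDeriv_monoVal_zero, if_pos rfl, mul_comm]
    · intro b' _ hne
      rw [← multiDeriv_eq_listDeriv, multiDeriv_monoVal_zero, if_neg hne, mul_zero]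
    · exact fun hn => absurd hbm hn
  have hfl : IsFlat (∑ i, a i) (listDeriv (directions b) ρ) := by
    have : IsFlat (∑ i, a i + (directions b).length) ρ := by
      rw [hlb]
      exact ⟨hflat.1.of_le (by exact_mod_cast (by omega)), fun j hj => hflat.2 j (by omega)⟩
    exact this.listDeriv _
  rw [mixedDeriv, multiDeriv_eq_listDeriv, (listDeriv_congr _ hinner).eq_of_nhds,
    (listDeriv_add (directions a) (contDiffAt_const.mul (ContDiffAt.sum fun a' _ =>
      contDiffAt_const.mul (contDiff_monoVal a').contDiffAt))
      (contDiffAt_const.mul (by rw [hla]; exact hfl.1))).eq_of_nhds,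
    listDeriv_const_mul, listDeriv_const_mul]
  simp only []
  rw [(listDeriv_sum _ _ _ fun a' _ => (contDiff_monoVal a').contDiffAt).eq_of_nhds]
  have h0 : listDeriv (directions a) (listDeriv (directions b) ρ) 0 = 0 := by
    have : IsFlat (0 + (directions a).length) (listDeriv (directions b) ρ) := by
      rw [hla, zero_add]; exact hfl
    exact (this.listDeriv _).apply_zero
  rw [h0, mul_zero, add_zero, Finset.sum_eq_single a]
  · rw [← multiDeriv_eq_listDeriv, multiDeriv_monoVal_zero, if_pos rfl]; ring
  · intro a' _ hne
    rw [← multiDeriv_eq_listDeriv, multiDeriv_monoVal_zero, if_neg hne, mul_zero]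
  · exact fun hn => absurd ham hn

theorem IsKernelExpansion.wronskian_apply {r : ℕ} {f : ℝ → ℝ}
    {w : (Fin d → ℕ) → (Fin d → ℕ) → ℝ} {φ : ℝ → ℝ} (h : IsKernelExpansion d f r w φ)
    {A B : Finset (Fin d → ℕ)} (a : A) (b : B) (ha : ∑ i, a.1 i < r) (hb : ∑ i, b.1 i < r) :
    wronskian (stationaryKernel d f) A B a b = w a.1 b.1 := by
  rw [wronskian, Matrix.of_apply, h.mixedDeriv_eq ha hb, mul_div_assoc, div_self, mul_one]
  refine mul_ne_zero ?_ ?_ <;>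
  exact Finset.prod_ne_zero_iff.2 fun i _ => by exact_mod_cast Nat.factorial_ne_zero _

end Flat

/-! ### Energies of signed measures -/

section Energy

variable {d r : ℕ} {f : ℝ → ℝ} {w : (Fin d → ℕ) → (Fin d → ℕ) → ℝ} {φ : ℝ → ℝ}

theorem IsPositiveDefiniteKernel.sum_nonneg {κ : Pt d → Pt d → ℝ} (hκ : IsPositiveDefiniteKernel κ)
    {ι : Type*} [Fintype ι] (y : ι → Pt d) (u : ι → ℝ) :
    0 ≤ ∑ i, ∑ j, u i * u j * κ (y i) (y j) := by
  let e := Fintype.equivFin ι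
  have h := (hκ (Fintype.card ι) (y ∘ e.symm)).dotProduct_mulVec_nonneg (u ∘ e.symm)
  rw [← e.symm.sum_comp]
  simp_rw [← e.symm.sum_comp (fun j => u _ * u j * κ _ (y j))]
  refine h.trans (le_of_eq ?_)
  simp only [dotProduct, Matrix.mulVec, Finset.mul_sum, star_trivial, Function.comp_apply,
    Matrix.of_apply]
  exact Finset.sum_congr rfl fun i _ => Finset.sum_congr rfl fun j _ => by ring

/-- The energy `∑ u_i v_k ‖y_i - z_k‖ ^ s`. -/
def energy (s : ℕ) {ι κ : Type*} [Fintype ι] [Fintype κ] (y : ι → Pt d) (z : κ → Pt d) (u : ι → ℝ)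
    (v : κ → ℝ) : ℝ :=
  ∑ i, ∑ k, u i * v k * ‖y i - z k‖ ^ s

theorem energy_comm (s : ℕ) {ι κ : Type*} [Fintype ι] [Fintype κ] (y : ι → Pt d) (z : κ → Pt d)
    (u : ι → ℝ) (v : κ → ℝ) : energy s y z u v = energy s z y v u := by
  rw [energy, energy, Finset.sum_comm]
  exact Finset.sum_congr rfl fun i _ => Finset.sum_congr rfl fun j _ => by
    rw [norm_sub_rev, mul_comm (u j)]

theorem energy_sumElim (s : ℕ) {ι κ : Type*} [Fintype ι] [Fintype κ] (y : ι → Pt d) (z : κ → Pt d)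
    (u : ι → ℝ) (v : κ → ℝ) :
    energy s (Sum.elim y z) (Sum.elim y z) (Sum.elim u v) (Sum.elim u v) =
      energy s y y u u + 2 * energy s y z u v + energy s z z v v := by
  have h := energy_comm s y z u v
  simp only [energy, Fintype.sum_sum_type, Sum.elim_inl, Sum.elim_inr, Finset.sum_add_distrib]
    at h ⊢
  linarith

theorem energy_smul (s : ℕ) {ι κ : Type*} [Fintype ι] [Fintype κ] (y : ι → Pt d) (z : κ → Pt d)
    (a b : ℝ) (u : ι → ℝ) (v : κ → ℝ) :
    energy s y z (a • u) (b • v) = a * b * energy s y z u v := by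
  simp only [energy, Pi.smul_apply, smul_eq_mul, Finset.mul_sum]
  exact Finset.sum_congr rfl fun i _ => Finset.sum_congr rfl fun j _ => by ring

theorem energy_scale (s : ℕ) {ι κ : Type*} [Fintype ι] [Fintype κ] (y : ι → Pt d) (z : κ → Pt d)
    {c : ℝ} (hc : 0 ≤ c) (u : ι → ℝ) (v : κ → ℝ) :
    energy s (fun i => c • y i) (fun i => c • z i) u v = c ^ s * energy s y z u v := by
  simp only [energy, Finset.mul_sum]
  refine Finset.sum_congr rfl fun i _ => Finset.sum_congr rfl fun j _ => ?_
  rw [← smul_sub, norm_smul, Real.norm_of_nonneg hc, mul_pow]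
  ring

/-- If the polynomial part of the kernel contributes a nonpositive amount, then the leading singular
part is nonnegative in the limit. -/
theorem IsKernelExpansion.energy_nonneg_of_tendsto (h : IsKernelExpansion d f r w φ)
    (hκ : IsPositiveDefiniteKernel (stationaryKernel d f)) {ι : Type*} [Fintype ι] (y : ι → Pt d)
    {U : ℝ → ι → ℝ} {u : ι → ℝ} (hU : ∀ i, Tendsto (fun ε => U ε i) (𝓝[>] 0) (𝓝 (u i)))
    (hpoly : ∀ ε > 0, ∑ a ∈ monoLt d (2 * r), ∑ b ∈ monoLt d (2 * r),
      ε ^ (∑ i, a i + ∑ i, b i) * w a b * (moment y (U ε) a * moment y (U ε) b) ≤ 0) :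
    0 ≤ taylorCoeff f (2 * r - 1) * energy (2 * r - 1) y y u u := by
  have hlim : Tendsto (fun ε => ∑ i, ∑ j, U ε i * U ε j *
      (‖y i - y j‖ ^ (2 * r - 1) * φ (ε * ‖y i - y j‖))) (𝓝[>] 0)
      (𝓝 (taylorCoeff f (2 * r - 1) * energy (2 * r - 1) y y u u)) := by
    rw [energy, Finset.mul_sum]
    simp_rw [Finset.mul_sum]
    refine tendsto_finsetSum _ fun i _ => tendsto_finsetSum _ fun j _ => ?_
    have h1 : Tendsto (fun ε : ℝ => φ (ε * ‖y i - y j‖)) (𝓝[>] 0)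
        (𝓝 (taylorCoeff f (2 * r - 1))) := by
      rw [← h.apply_zero]
      refine h.analyticAt.continuousAt.tendsto.comp ?_
      have : Continuous fun ε : ℝ => ε * ‖y i - y j‖ := by fun_prop
      have h0 := this.tendsto 0
      rw [zero_mul] at h0
      exact h0.mono_left nhdsWithin_le_nhds
    have h2 := ((hU i).mul (hU j)).mul (h1.const_mul (‖y i - y j‖ ^ (2 * r - 1)))
    convert! h2 using 2
    ring
  refine ge_of_tendsto hlim ?_
  filter_upwards [self_mem_nhdsWithin] with ε hε
  have hε' : (0 : ℝ) < ε := hε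
  have h1 := hκ.sum_nonneg (fun i => ε • y i) (U ε)
  have h2 : ∑ i, ∑ j, U ε i * U ε j * stationaryKernel d f (ε • y i) (ε • y j) =
      ∑ i, ∑ j, U ε i * U ε j * f (ε * ‖y i - y j‖) := by
    refine Finset.sum_congr rfl fun i _ => Finset.sum_congr rfl fun j _ => ?_
    rw [stationaryKernel, ← smul_sub, norm_smul, Real.norm_of_nonneg hε'.le]
  rw [h2, h.bilin_eq y (U ε) (U ε) hε'] at h1
  have h3 := hpoly ε hε'
  have h4 : 0 ≤ ε ^ (2 * r - 1) * ∑ i, ∑ j, U ε i * U ε j *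
      (‖y i - y j‖ ^ (2 * r - 1) * φ (ε * ‖y i - y j‖)) := by linarith
  exact nonneg_of_mul_nonneg_right h4 (pow_pos hε' _)

/-- Every surviving coefficient has `|a| + |b| < 2 r`, so one of the two degrees is below `r` and
the polynomial part vanishes identically. -/
theorem IsKernelExpansion.energy_nonneg (h : IsKernelExpansion d f r w φ)
    (hκ : IsPositiveDefiniteKernel (stationaryKernel d f)) {ι : Type*} [Fintype ι] (y : ι → Pt d)
    {u : ι → ℝ} (hu : ∀ a ∈ monoLt d r, moment y u a = 0) :
    0 ≤ taylorCoeff f (2 * r - 1) * energy (2 * r - 1) y y u u := by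
  refine h.energy_nonneg_of_tendsto hκ y (U := fun _ => u) (fun _ => tendsto_const_nhds)
    fun ε _ => le_of_eq ?_
  refine Finset.sum_eq_zero fun a _ => Finset.sum_eq_zero fun b _ => ?_
  by_cases ha : ∑ i, a i < r
  · rw [hu a (mem_monoLt.2 ha)]; ring
  by_cases hb : ∑ i, b i < r
  · rw [hu b (mem_monoLt.2 hb)]; ring
  · rw [h.coeff_eq_zero a b (by omega)]; ring

/-- For small `τ` the linear term dominates and changes sign with `τ`. This is the equality case of
Cauchy–Schwarz: a null vector of a nonnegative form is orthogonal to everything. The sign of `γ` is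
left free. -/
theorem eq_zero_of_forall_quadratic_nonneg {β γ : ℝ} (h : ∀ τ : ℝ, 0 ≤ 2 * τ * β + τ ^ 2 * γ) :
    β = 0 := by
  by_contra hβ
  have h1 := h (-β / (|γ| + 1))
  have h2 : 0 < |γ| + 1 := by positivity
  have h3 : 2 * (-β / (|γ| + 1)) * β + (-β / (|γ| + 1)) ^ 2 * γ =
      (β / (|γ| + 1)) ^ 2 * (γ - 2 * (|γ| + 1)) := by
    field_simp; ring
  rw [h3] at h1
  have h4 : 0 < (β / (|γ| + 1)) ^ 2 := by positivity
  have h5 : γ - 2 * (|γ| + 1) < 0 := by linarith [le_abs_self γ, abs_nonneg γ]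
  linarith [mul_neg_of_pos_of_neg h4 h5]

/-! ### Finite differences -/

/-- The weights of the `M`-th finite difference. -/
def diffWeight (M : ℕ) (k : Fin (M + 1)) : ℝ := (-1) ^ (M - k.1) * (M.choose k.1 : ℝ)

theorem sum_diffWeight_eval {M : ℕ} {P : Polynomial ℝ} (hP : P.natDegree < M) :
    ∑ k : Fin (M + 1), diffWeight M k * P.eval ((k : ℝ) - 1) = 0 := by
  have h := congrFun (Polynomial.fwdDiff_iter_eq_zero_of_degree_lt hP) (-1)
  rw [fwdDiff_iter_eq_sum_shift, Finset.sum_range] at h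
  simp only [Pi.zero_apply, nsmul_eq_mul, mul_one] at h
  rw [← h]
  refine Finset.sum_congr rfl fun k _ => ?_
  rw [diffWeight, zsmul_eq_mul]
  push_cast
  rw [neg_add_eq_sub]

/-- Without the absolute value the sum vanishes, since `X ^ (m + K)` has degree below `2 r`. The
nodes are `-1, 0, …, 2r - 1`, so for odd `m` the two sums differ only at the single negative node,
whose weight is `1`. -/
theorem sum_diffWeight_abs_pow {m K r : ℕ} (hm : Odd m) (hmK : m + K < 2 * r) :
    ∑ k : Fin (2 * r + 1), diffWeight (2 * r) k * (|(k : ℝ) - 1| ^ m * ((k : ℝ) - 1) ^ K) =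
      2 * (-1) ^ K := by
  have h := sum_diffWeight_eval (M := 2 * r) (P := Polynomial.X ^ (m + K))
    (by rwa [Polynomial.natDegree_X_pow])
  rw [Fin.sum_univ_succ] at h ⊢
  simp only [Polynomial.eval_pow, Polynomial.eval_X] at h
  have h0 : diffWeight (2 * r) 0 = 1 := by simp [diffWeight]
  have h1 : ∀ k : Fin (2 * r), |(((k.succ : Fin (2 * r + 1)) : ℕ) : ℝ) - 1| ^ m *
      ((((k.succ : Fin (2 * r + 1)) : ℕ) : ℝ) - 1) ^ K =
      ((((k.succ : Fin (2 * r + 1)) : ℕ) : ℝ) - 1) ^ (m + K) := by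
    intro k
    rw [abs_of_nonneg (by simp), pow_add]
  simp_rw [h1]
  have h2 : ((-1 : ℝ)) ^ (m + K) = - (-1) ^ K := by
    rw [pow_add, hm.neg_one_pow]; ring
  simp only [Fin.coe_ofNat_eq_mod, Nat.zero_mod, Nat.cast_zero, zero_sub, h0, h2, abs_neg,
    abs_one, one_pow, one_mul] at h ⊢
  linarith

theorem moment_line_eq_zero {r : ℕ} (p v : Pt d) {a : Fin d → ℕ} (ha : ∑ i, a i < 2 * r) :
    moment (fun k : Fin (2 * r + 1) => p + ((k : ℝ) - 1) • v) (diffWeight (2 * r)) a = 0 := by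
  let P : Polynomial ℝ := ∏ j, (Polynomial.C (p j) + Polynomial.C (v j) * Polynomial.X) ^ a j
  have hP : P.natDegree < 2 * r := by
    refine lt_of_le_of_lt (Polynomial.natDegree_prod_le _ _) (lt_of_le_of_lt ?_ ha)
    refine Finset.sum_le_sum fun j _ => ?_
    refine Polynomial.natDegree_pow_le.trans ?_
    have : (Polynomial.C (p j) + Polynomial.C (v j) * Polynomial.X).natDegree ≤ 1 := by
      compute_degree
    calc _ ≤ a j * 1 := Nat.mul_le_mul_left _ this
      _ = a j := mul_one _
  rw [← sum_diffWeight_eval hP, moment]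
  refine Finset.sum_congr rfl fun k _ => ?_
  congr 1
  simp only [P, monoVal, Polynomial.eval_prod, Polynomial.eval_pow, Polynomial.eval_add,
    Polynomial.eval_mul, Polynomial.eval_C, Polynomial.eval_X, PiLp.add_apply, PiLp.smul_apply,
    smul_eq_mul]
  exact Finset.prod_congr rfl fun j _ => by rw [mul_comm]

end Energy

/-! ### Strict conditional positivity of odd powers of the distance -/

section StrictCPD

variable {d r : ℕ} {f : ℝ → ℝ} {w : (Fin d → ℕ) → (Fin d → ℕ) → ℝ} {φ : ℝ → ℝ}

theorem analyticAt_norm_sub_smul_pow {c v : Pt d} (hc : c ≠ 0) (s : ℕ) :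
    AnalyticAt ℝ (fun t : ℝ => ‖c - t • v‖ ^ s) 0 := by
  have hq : ∀ t : ℝ, ‖c - t • v‖ ^ 2 = ‖c‖ ^ 2 - 2 * (t * inner ℝ c v) + t ^ 2 * ‖v‖ ^ 2 := by
    intro t
    rw [norm_sub_sq_real, norm_smul, inner_smul_right, mul_pow, Real.norm_eq_abs, sq_abs]
  have ha : AnalyticAt ℝ (fun t : ℝ => ‖c - t • v‖ ^ 2) 0 := by
    simp_rw [hq]
    fun_prop
  have hpos : 0 < ‖c - (0 : ℝ) • v‖ ^ 2 := by
    rw [zero_smul, sub_zero]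
    exact pow_pos (norm_pos_iff.2 hc) 2
  have h1 : AnalyticAt ℝ (fun t : ℝ => Real.exp (Real.log (‖c - t • v‖ ^ 2) / 2) ^ s) 0 :=
    (((ha.log hpos).div analyticAt_const two_ne_zero).rexp').pow s
  refine h1.congr ?_
  filter_upwards [ha.continuousAt.eventually (lt_mem_nhds hpos)] with t ht
  have ht' : 0 < ‖c - t • v‖ := by
    rcases (norm_nonneg (c - t • v)).eq_or_lt with h | h
    · rw [← h] at ht; simp at ht
    · exact h
  congr 1
  rw [Real.log_pow]
  push_cast
  rw [mul_div_cancel_left₀ _ two_ne_zero, Real.exp_log ht']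

/-- A difference of order `2 r` annihilates the Taylor polynomial of degree `< 2 r`, so the sum is
`O (t ^ (2 r))`, one power better than the denominator. -/
theorem tendsto_diffWeight_sum {F : ℝ → ℝ} (hF : AnalyticAt ℝ F 0) (hr : 1 ≤ r) :
    Tendsto (fun t : ℝ => (∑ k : Fin (2 * r + 1), diffWeight (2 * r) k * F (t * ((k : ℝ) - 1))) /
      t ^ (2 * r - 1)) (𝓝[>] 0) (𝓝 0) := by
  obtain ⟨ψ, hψ, -, hF'⟩ := exists_eq_sum_taylorCoeff_add hF (2 * r)
  have h1 : ∀ t : ℝ, ∑ k : Fin (2 * r + 1), diffWeight (2 * r) k * F (t * ((k : ℝ) - 1)) =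
      t ^ (2 * r) * ∑ k : Fin (2 * r + 1), diffWeight (2 * r) k *
        (((k : ℝ) - 1) ^ (2 * r) * ψ (t * ((k : ℝ) - 1))) := by
    intro t
    simp_rw [hF', mul_add, Finset.sum_add_distrib]
    have h0 : ∑ k : Fin (2 * r + 1), diffWeight (2 * r) k *
        ∑ i ∈ Finset.range (2 * r), taylorCoeff F i * (t * ((k : ℝ) - 1)) ^ i = 0 := by
      simp_rw [Finset.mul_sum]
      rw [Finset.sum_comm]
      refine Finset.sum_eq_zero fun i hi => ?_
      have h2 := sum_diffWeight_eval (M := 2 * r) (P := Polynomial.X ^ i)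
        (by rw [Polynomial.natDegree_X_pow]; exact Finset.mem_range.1 hi)
      rw [← mul_zero (taylorCoeff F i * t ^ i), ← h2, Finset.mul_sum]
      refine Finset.sum_congr rfl fun k _ => ?_
      rw [mul_pow, Polynomial.eval_pow, Polynomial.eval_X]
      ring
    rw [h0, zero_add, Finset.mul_sum]
    exact Finset.sum_congr rfl fun k _ => by rw [mul_pow]; ring
  have hψc : Tendsto (fun t : ℝ => t * ∑ k : Fin (2 * r + 1), diffWeight (2 * r) k *
      (((k : ℝ) - 1) ^ (2 * r) * ψ (t * ((k : ℝ) - 1)))) (𝓝[>] 0)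
      (𝓝 (0 * ∑ k : Fin (2 * r + 1), diffWeight (2 * r) k *
      (((k : ℝ) - 1) ^ (2 * r) * ψ 0))) := by
    have hid : Tendsto (fun t : ℝ => t) (𝓝[>] 0) (𝓝 0) := tendsto_id.mono_left nhdsWithin_le_nhds
    refine hid.mul (tendsto_finsetSum _ fun k _ => Tendsto.const_mul _ (Tendsto.const_mul _ ?_))
    refine hψ.continuousAt.tendsto.comp ?_
    simpa using hid.mul_const ((k : ℝ) - 1)
  rw [zero_mul] at hψc
  refine hψc.congr' ?_
  filter_upwards [self_mem_nhdsWithin] with t ht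
  have ht' : (0 : ℝ) < t := ht
  rw [h1, eq_div_iff (pow_pos ht' _).ne']
  conv_rhs => rw [show 2 * r = 2 * r - 1 + 1 by omega, pow_succ]
  rw [show 2 * r - 1 + 1 = 2 * r by omega]
  ring

/-- Strict conditional positivity of `f_{2r-1} D^{(2r-1)}`. -/
theorem IsKernelExpansion.eq_zero_of_energy_eq_zero (h : IsKernelExpansion d f r w φ)
    (hκ : IsPositiveDefiniteKernel (stationaryKernel d f)) (hd : 1 ≤ d) {ι : Type*} [Fintype ι]
    {y : ι → Pt d} (hy : Function.Injective y) {u : ι → ℝ}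
    (hu : ∀ a ∈ monoLt d r, moment y u a = 0)
    (h0 : energy (2 * r - 1) y y u u = 0) : u = 0 := by
  classical
  have hr := h.one_le
  obtain ⟨s, hs⟩ : ∃ s, s = 2 * r - 1 := ⟨_, rfl⟩
  have hodd : Odd s := ⟨r - 1, by omega⟩
  rw [← hs] at h0
  have hne := h.ne_zero
  rw [← hs] at hne
  set v : Pt d := EuclideanSpace.single ⟨0, hd⟩ 1 with hv
  have hv1 : ‖v‖ = 1 := by simp [hv]
  ext i₀
  -- A finite-difference stencil of step `t` through `y i₀`, which is the node `k = 1`. Its moments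
  -- of degree `< 2 r` vanish, so adding any multiple of it to `u` keeps the configuration
  -- admissible.
  let z : ℝ → Fin (2 * r + 1) → Pt d := fun t k => y i₀ + ((k : ℝ) - 1) • (t • v)
  have hzero : ∀ t, energy s y (z t) u (diffWeight (2 * r)) = 0 := by
    intro t
    have key : taylorCoeff f s * energy s y (z t) u (diffWeight (2 * r)) = 0 := by
      refine eq_zero_of_forall_quadratic_nonneg (γ := taylorCoeff f s *
        energy s (z t) (z t) (diffWeight (2 * r)) (diffWeight (2 * r))) fun τ => ?_
      have h1 := h.energy_nonneg hκ (Sum.elim y (z t)) (u := Sum.elim u (τ • diffWeight (2 * r)))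
        (by
          intro a ha
          rw [moment_sumElim, hu a ha, moment_smul, moment_line_eq_zero]
          · ring
          · have := mem_monoLt.1 ha; omega)
      rw [← hs, energy_sumElim, h0, energy_smul] at h1
      have h2 := energy_smul s y (z t) 1 τ u (diffWeight (2 * r))
      rw [one_smul] at h2
      rw [h2] at h1
      refine h1.trans (le_of_eq ?_)
      ring
    exact (mul_eq_zero.1 key).resolve_left hne
  -- Away from `y i₀` the distance power is analytic along the stencil and contributes nothing in
  -- the limit; at `y i₀` the singularity contributes `2`. As the cross energy is zero, this forces
  -- `u i₀ = 0`.
  have hlim : Tendsto (fun t : ℝ => energy s y (z t) u (diffWeight (2 * r)) / t ^ s) (𝓝[>] 0)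
      (𝓝 (∑ i, u i * if i = i₀ then 2 else 0)) := by
    have e : ∀ t : ℝ, energy s y (z t) u (diffWeight (2 * r)) / t ^ s = ∑ i, u i *
        ((∑ k : Fin (2 * r + 1), diffWeight (2 * r) k *
          ‖(y i - y i₀) - (t * ((k : ℝ) - 1)) • v‖ ^ s) / t ^ s) := by
      intro t
      rw [energy, Finset.sum_div]
      refine Finset.sum_congr rfl fun i _ => ?_
      rw [← mul_div_assoc, Finset.mul_sum]
      congr 1
      refine Finset.sum_congr rfl fun k _ => ?_
      rw [mul_assoc, sub_sub, mul_comm t, ← smul_smul]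
    simp_rw [e]
    refine tendsto_finsetSum _ fun i _ => Tendsto.const_mul _ ?_
    split_ifs with hi
    · refine tendsto_const_nhds.congr' ?_
      filter_upwards [self_mem_nhdsWithin] with t ht
      have ht' : (0 : ℝ) < t := ht
      rw [eq_div_iff (pow_pos ht' _).ne']
      have h1 := sum_diffWeight_abs_pow (m := s) (K := 0) (r := r) hodd (by omega)
      simp only [pow_zero, mul_one] at h1
      have h2 : ∀ k : ℝ, ‖y i - y i₀ - (t * (k - 1)) • v‖ ^ s = |k - 1| ^ s * t ^ s := by
        intro k
        rw [hi, sub_self, zero_sub, norm_neg, norm_smul, hv1, mul_one, Real.norm_eq_abs, abs_mul,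
          abs_of_pos ht', mul_pow, mul_comm]
      simp_rw [h2, ← mul_assoc]
      rw [← Finset.sum_mul, h1]
    · have h1 := tendsto_diffWeight_sum (F := fun t => ‖(y i - y i₀) - t • v‖ ^ s)
        (analyticAt_norm_sub_smul_pow (sub_ne_zero.2 fun h => hi (hy h)) s) hr
      rwa [← hs] at h1
  simp_rw [hzero, zero_div] at hlim
  have h1 := tendsto_nhds_unique hlim tendsto_const_nhds
  simp only [mul_ite, mul_zero, Finset.sum_ite_eq', Finset.mem_univ, if_true] at h1
  simpa using h1

end StrictCPD

/-! ### Dual weights and the leading term of a concentrated measure -/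

section WronskianPosDef

variable {d r : ℕ} {f : ℝ → ℝ} {w : (Fin d → ℕ) → (Fin d → ℕ) → ℝ} {φ : ℝ → ℝ}

/-- A unisolvent grid avoiding the origin, with weights dual to the monomials. -/
theorem exists_dual_weights (hd : 1 ≤ d) (M : ℕ) :
    ∃ (Y : (Fin d → Fin M) → Pt d) (z : (Fin d → ℕ) → (Fin d → Fin M) → ℝ), (∀ i, Y i ≠ 0) ∧
      ∀ a ∈ monoLt d M, ∀ b ∈ monoLt d M, moment Y (z a) b = if b = a then 1 else 0 := by
  classical
  -- The one-dimensional nodes `1, …, M` are positive, which keeps the grid away from the origin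
  -- when `d ≥ 1`. The dual weights are tensor products of rows of the inverse Vandermonde matrix.
  let A : Matrix (Fin M) (Fin M) ℝ := Matrix.vandermonde fun k => (k : ℝ) + 1
  have hA : IsUnit A.det := by
    refine (Matrix.det_vandermonde_ne_zero_iff.2 ?_).isUnit
    intro i j hij
    have : ((i : ℕ) : ℝ) = (j : ℕ) := by simpa using hij
    exact Fin.ext (by exact_mod_cast this)
  let lam : ℕ → Fin M → ℝ := fun e k => if h : e < M then A⁻¹ ⟨e, h⟩ k else 0
  have hlam : ∀ e e' : ℕ, e < M → e' < M →
      ∑ k, lam e k * ((k : ℝ) + 1) ^ e' = if e' = e then 1 else 0 := by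
    intro e e' he he'
    have h1 := congrFun (congrFun (Matrix.nonsing_inv_mul A hA) ⟨e, he⟩) ⟨e', he'⟩
    rw [Matrix.mul_apply, Matrix.one_apply] at h1
    simp only [Fin.mk.injEq] at h1
    simp only [lam, he, dif_pos]
    rw [show (if e' = e then (1 : ℝ) else 0) = if e = e' then 1 else 0 by simp only [eq_comm], ← h1]
    rfl
  refine ⟨fun k => WithLp.toLp 2 fun j => ((k j : ℕ) : ℝ) + 1, fun a k => ∏ j, lam (a j) (k j),
    ?_, ?_⟩
  · intro k hk
    have := congrArg (fun p : Pt d => p ⟨0, hd⟩) hk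
    simp only [PiLp.zero_apply] at this
    have h2 : (0 : ℝ) ≤ ((k ⟨0, hd⟩ : ℕ) : ℝ) := Nat.cast_nonneg _
    linarith
  · intro a ha b hb
    have hlt : ∀ c ∈ monoLt d M, ∀ j, c j < M := fun c hc j =>
      lt_of_le_of_lt (Finset.single_le_sum (fun _ _ => Nat.zero_le _) (Finset.mem_univ j))
        (mem_monoLt.1 hc)
    have h1 : moment (fun k : Fin d → Fin M => (WithLp.toLp 2 fun j => ((k j : ℕ) : ℝ) + 1 : Pt d))
        (fun k => ∏ j, lam (a j) (k j)) b =
        ∏ j, ∑ k, lam (a j) k * ((k : ℝ) + 1) ^ b j := by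
      rw [Fintype.prod_sum, moment]
      refine Finset.sum_congr rfl fun k _ => ?_
      rw [monoVal, ← Finset.prod_mul_distrib]
    rw [h1, Finset.prod_congr rfl fun j _ => hlam (a j) (b j) (hlt a ha j) (hlt b hb j)]
    split_ifs with hab
    · simp [hab]
    · obtain ⟨j, hj⟩ := Function.ne_iff.1 hab
      exact Finset.prod_eq_zero (Finset.mem_univ j) (if_neg hj)

/-- All the factors `σ, σ - 1, …, σ - q + 1` are positive. This is applied to `σ = r - 1/2` and `q <
r`. -/
theorem choose_pos_of_lt {σ : ℝ} {q : ℕ} (h : (q : ℝ) - 1 < σ) : 0 < Ring.choose σ q := by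
  have h1 := Ring.descPochhammer_eq_factorial_smul_choose σ q
  have h2 : (descPochhammer ℤ q).smeval σ = (descPochhammer ℝ q).eval σ := by
    rw [← Polynomial.aeval_eq_smeval, Polynomial.aeval_def, ← Polynomial.eval_map,
      descPochhammer_map]
  rw [h2] at h1
  have h3 := descPochhammer_pos h
  rw [h1, nsmul_eq_mul] at h3
  exact pos_of_mul_pos_right h3 (Nat.cast_nonneg _)

/-- Gram powers `⟪x_i, x_j⟫ ^ m` have the moments as features. -/
theorem sum_mul_inner_pow {ι κ : Type*} [Fintype ι] [Fintype κ] (y : ι → Pt d) (z : κ → Pt d)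
    (u : ι → ℝ) (v : κ → ℝ) (m : ℕ) :
    ∑ i, ∑ k, u i * v k * (inner ℝ (y i) (z k)) ^ m = ∑ a ∈ monoEq d m,
      (Nat.multinomial Finset.univ a : ℝ) * (moment y u a * moment z v a) := by
  have h1 : ∀ i k, (inner ℝ (y i) (z k)) ^ m = ∑ a ∈ monoEq d m,
      (Nat.multinomial Finset.univ a : ℝ) * (monoVal (y i) a * monoVal (z k) a) := by
    intro i k
    have : (inner ℝ (y i) (z k) : ℝ) = ∑ j, y i j * z k j := by
      rw [PiLp.inner_apply]
      exact Finset.sum_congr rfl fun j _ => by simp [mul_comm]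
    rw [this, Finset.sum_pow_eq_sum_piAntidiag]
    refine Finset.sum_congr rfl fun a _ => ?_
    congr 1
    rw [monoVal, monoVal, ← Finset.prod_mul_distrib]
    exact Finset.prod_congr rfl fun j _ => by rw [mul_pow]
  simp_rw [h1, moment, Finset.sum_mul_sum, Finset.mul_sum]
  have e : ∀ i, ∑ k, ∑ a ∈ monoEq d m, u i * v k * ((Nat.multinomial Finset.univ a : ℝ) *
      (monoVal (y i) a * monoVal (z k) a)) = ∑ a ∈ monoEq d m, ∑ k,
        (Nat.multinomial Finset.univ a : ℝ) * (u i * monoVal (y i) a * (v k * monoVal (z k) a)) := by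
    intro i
    rw [Finset.sum_comm]
    exact Finset.sum_congr rfl fun a _ => Finset.sum_congr rfl fun k _ => by ring
  rw [Finset.sum_congr rfl fun i _ => e i, Finset.sum_comm]

/-- For fixed `y` the summand is a homogeneous polynomial of degree `m + 2 j` in `Y i`. -/
theorem sum_mul_inner_pow_mul_norm_pow_eq_zero {ι : Type*} [Fintype ι] {Y : ι → Pt d} {ν : ι → ℝ}
    {m j : ℕ} (h : ∀ a ∈ monoEq d (m + 2 * j), moment Y ν a = 0) (y : Pt d) (b c : ℝ) :
    ∑ i, ν i * ((c * inner ℝ (Y i) y) ^ m * (‖Y i‖ ^ 2 * b) ^ j) = 0 := by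
  let P : MvPolynomial (Fin d) ℝ :=
    (∑ l, MvPolynomial.C (c * y l) * MvPolynomial.X l) ^ m *
      (∑ l, MvPolynomial.C b * MvPolynomial.X l ^ 2) ^ j
  have hP : P.IsHomogeneous (m + 2 * j) := by
    have h1 : (∑ l, MvPolynomial.C (c * y l) * MvPolynomial.X l : MvPolynomial (Fin d) ℝ).IsHomogeneous
        1 := MvPolynomial.IsHomogeneous.sum _ _ _ fun l _ => by
      simpa using (MvPolynomial.isHomogeneous_C (Fin d) (c * y l)).mul
        (MvPolynomial.isHomogeneous_X ℝ l)
    have h2 : (∑ l, MvPolynomial.C b * MvPolynomial.X l ^ 2 : MvPolynomial (Fin d) ℝ).IsHomogeneous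
        2 := MvPolynomial.IsHomogeneous.sum _ _ _ fun l _ => by
      simpa using (MvPolynomial.isHomogeneous_C (Fin d) b).mul
        ((MvPolynomial.isHomogeneous_X ℝ l).pow 2)
    have h3 := (h1.pow m).mul (h2.pow j)
    rwa [one_mul] at h3
  rw [← sum_mul_eval_eq_zero h hP]
  refine Finset.sum_congr rfl fun i _ => ?_
  congr 1
  simp only [P, map_mul, map_pow, map_sum, MvPolynomial.eval_C, MvPolynomial.eval_X]
  congr 2
  · rw [PiLp.inner_apply, Finset.mul_sum]
    exact Finset.sum_congr rfl fun l _ => by simp [mul_assoc]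
  · rw [norm_sq_eq_sum, mul_comm, Finset.mul_sum]

/-- Up to the factor `‖y‖ ^ (s - 2 K)`, the leading coefficient of `∑ ν_i ‖t Y_i - y‖ ^ s` as
`t → 0`, for `ν` whose moments of degree different from `K` vanish. -/
def leadingForm {ι : Type*} [Fintype ι] (σ : ℝ) (K : ℕ) (Y : ι → Pt d) (ν : ι → ℝ) (y : Pt d) : ℝ :=
  ∑ q ∈ Finset.range (K + 1), ∑ j ∈ Finset.range (q + 1), if q + j = K then
    Ring.choose σ q * (q.choose j : ℝ) *
      (∑ i, ν i * ((-2 * inner ℝ (Y i) y) ^ (q - j) * ‖Y i‖ ^ (2 * j))) * ‖y‖ ^ (2 * j) else 0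

theorem leadingForm_smul {ι : Type*} [Fintype ι] (σ : ℝ) (K : ℕ) (Y : ι → Pt d) (ν : ι → ℝ)
    (t : ℝ) (y : Pt d) : leadingForm σ K Y ν (t • y) = t ^ K * leadingForm σ K Y ν y := by
  unfold leadingForm
  rw [Finset.mul_sum]
  refine Finset.sum_congr rfl fun q _ => ?_
  rw [Finset.mul_sum]
  refine Finset.sum_congr rfl fun j hj => ?_
  split_ifs with h
  · have hjq : j ≤ q := Nat.lt_succ_iff.1 (Finset.mem_range.1 hj)
    have e1 : ∑ i, ν i * ((-2 * inner ℝ (Y i) (t • y)) ^ (q - j) * ‖Y i‖ ^ (2 * j)) =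
        t ^ (q - j) * ∑ i, ν i * ((-2 * inner ℝ (Y i) y) ^ (q - j) * ‖Y i‖ ^ (2 * j)) := by
      rw [Finset.mul_sum]
      refine Finset.sum_congr rfl fun i _ => ?_
      rw [inner_smul_right, mul_left_comm, mul_pow]
      ring
    have e2 : ‖t • y‖ ^ (2 * j) = t ^ (2 * j) * ‖y‖ ^ (2 * j) := by
      rw [norm_smul, mul_pow, Real.norm_eq_abs, pow_mul, sq_abs, ← pow_mul]
    rw [e1, e2, show t ^ K = t ^ (q - j) * t ^ (2 * j) by rw [← pow_add]; congr 1; omega]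
    ring
  · rw [mul_zero]

/-- Write `‖t Y_i - y‖² = ‖y‖² (1 + t p_i(t))` and use the binomial series with exponent `s / 2`.
The term with indices `q, j` has power `t ^ (q + j)` and coefficient a moment of the same degree `(q
- j) + 2 j`. Since `q + j ≤ 2 K`, the hypothesis leaves only `q + j = K`; the remainder is `O (t ^
(K + 1))`. -/
theorem tendsto_sum_norm_pow_div {ι : Type*} [Fintype ι] {Y : ι → Pt d} {ν : ι → ℝ} {K s : ℕ}
    (hK : 2 * K < s) (hν : ∀ a, ∑ i, a i ≤ 2 * K → ∑ i, a i ≠ K → moment Y ν a = 0) {y : Pt d}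
    (hy : y ≠ 0) :
    Tendsto (fun t : ℝ => (∑ i, ν i * ‖t • Y i - y‖ ^ s) / t ^ K) (𝓝[>] 0)
      (𝓝 (‖y‖ ^ (s - 2 * K) * leadingForm ((s : ℝ) / 2) K Y ν y)) := by
  set σ : ℝ := (s : ℝ) / 2 with hσ
  have hy' : 0 < ‖y‖ := norm_pos_iff.2 hy
  obtain ⟨Φ, hΦ, -, hG⟩ := exists_eq_sum_coeff_add
    (Real.one_add_rpow_hasFPowerSeriesAt_zero (a := σ)) (K + 1)
  have hcoeff : ∀ i, (binomialSeries ℝ σ).coeff i = Ring.choose σ i := fun i => by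
    simp [binomialSeries, FormalMultilinearSeries.coeff_ofScalars]
  simp_rw [hcoeff] at hG
  set β : ℝ := (‖y‖ ^ 2)⁻¹ with hβ
  set p : ι → ℝ → ℝ := fun i t => (-2 * β) * inner ℝ (Y i) y + ‖Y i‖ ^ 2 * (t * β) with hp
  have hpow : ∀ i (t : ℝ), ‖t • Y i - y‖ ^ s = ‖y‖ ^ s * (1 + t * p i t) ^ σ := by
    intro i t
    have h1 : ‖t • Y i - y‖ ^ 2 = ‖y‖ ^ 2 * (1 + t * p i t) := by
      rw [norm_sub_sq_real, norm_smul, inner_smul_left, mul_pow, Real.norm_eq_abs, sq_abs, hp, hβ]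
      simp only [conj_trivial]
      field_simp
      ring
    have h2 : 0 ≤ 1 + t * p i t := by
      have : 0 ≤ ‖y‖ ^ 2 * (1 + t * p i t) := by rw [← h1]; positivity
      exact nonneg_of_mul_nonneg_right this (by positivity)
    have h3 : ∀ x : ℝ, 0 ≤ x → x ^ s = (x ^ 2) ^ σ := by
      intro x hx
      rw [hσ, ← Real.rpow_natCast x 2, ← Real.rpow_mul hx, ← Real.rpow_natCast]
      congr 1
      push_cast
      ring
    rw [h3 _ (norm_nonneg _), h1, Real.mul_rpow (by positivity) h2, ← h3 _ hy'.le]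
  have hpoly : ∀ t : ℝ, ∑ i, ν i * ∑ q ∈ Finset.range (K + 1), Ring.choose σ q * (t * p i t) ^ q =
      t ^ K * ((‖y‖ ^ (2 * K))⁻¹ * leadingForm σ K Y ν y) := by
    intro t
    have e1 : ∀ i q, (t * p i t) ^ q = ∑ j ∈ Finset.range (q + 1), t ^ (q + j) *
        ((q.choose j : ℝ) * (((-2 * β) * inner ℝ (Y i) y) ^ (q - j) * (‖Y i‖ ^ 2 * β) ^ j)) := by
      intro i q
      have hp' : p i t = ‖Y i‖ ^ 2 * (t * β) + (-2 * β) * inner ℝ (Y i) y := add_comm _ _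
      rw [mul_pow, hp', add_pow, Finset.mul_sum]
      refine Finset.sum_congr rfl fun j _ => ?_
      simp only [mul_pow]
      ring
    simp_rw [e1, Finset.mul_sum]
    rw [Finset.sum_comm, leadingForm]
    simp_rw [Finset.mul_sum]
    refine Finset.sum_congr rfl fun q hq => ?_
    rw [Finset.sum_comm]
    refine Finset.sum_congr rfl fun j hj => ?_
    have hjq : j ≤ q := Nat.lt_succ_iff.1 (Finset.mem_range.1 hj)
    have hqK : q ≤ K := Nat.lt_succ_iff.1 (Finset.mem_range.1 hq)
    have e2 : ∑ i, ν i * (Ring.choose σ q * (t ^ (q + j) * ((q.choose j : ℝ) *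
        (((-2 * β) * inner ℝ (Y i) y) ^ (q - j) * (‖Y i‖ ^ 2 * β) ^ j)))) =
        Ring.choose σ q * t ^ (q + j) * (q.choose j : ℝ) *
        ∑ i, ν i * (((-2 * β) * inner ℝ (Y i) y) ^ (q - j) * (‖Y i‖ ^ 2 * β) ^ j) := by
      rw [Finset.mul_sum]
      exact Finset.sum_congr rfl fun i _ => by ring
    rw [e2]
    split_ifs with hqj
    · have e3 : ∑ i, ν i * (((-2 * β) * inner ℝ (Y i) y) ^ (q - j) * (‖Y i‖ ^ 2 * β) ^ j) =
          β ^ q * ∑ i, ν i * ((-2 * inner ℝ (Y i) y) ^ (q - j) * ‖Y i‖ ^ (2 * j)) := by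
        rw [Finset.mul_sum]
        refine Finset.sum_congr rfl fun i _ => ?_
        rw [show β ^ q = β ^ (q - j) * β ^ j by rw [← pow_add]; congr 1; omega, pow_mul]
        simp only [mul_pow]
        ring
      have e4 : β ^ q = (‖y‖ ^ (2 * K))⁻¹ * ‖y‖ ^ (2 * j) := by
        rw [hβ, inv_pow, ← pow_mul, show 2 * K = 2 * q + 2 * j by omega, pow_add, mul_inv, mul_assoc,
          inv_mul_cancel₀ (by positivity), mul_one]
      rw [e3, e4, hqj]
      simp only [mul_assoc, Finset.sum_mul, Finset.mul_sum]
      refine Finset.sum_congr rfl fun i _ => ?_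
      ring
    · rw [sum_mul_inner_pow_mul_norm_pow_eq_zero, mul_zero, mul_zero, mul_zero]
      intro a ha
      rw [mem_monoEq] at ha
      exact hν a (by omega) (by omega)
  have hlim : Tendsto (fun t : ℝ => ‖y‖ ^ s * ((‖y‖ ^ (2 * K))⁻¹ * leadingForm σ K Y ν y) +
      t * (‖y‖ ^ s * ∑ i, ν i * (p i t ^ (K + 1) * Φ (t * p i t)))) (𝓝[>] 0)
      (𝓝 (‖y‖ ^ s * ((‖y‖ ^ (2 * K))⁻¹ * leadingForm σ K Y ν y) +
        0 * (‖y‖ ^ s * ∑ i, ν i * (p i 0 ^ (K + 1) * Φ 0)))) := by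
    have hid : Tendsto (fun t : ℝ => t) (𝓝[>] 0) (𝓝 0) := tendsto_id.mono_left nhdsWithin_le_nhds
    have hpc : ∀ i, Tendsto (fun t => p i t) (𝓝[>] 0) (𝓝 (p i 0)) := by
      intro i
      have : Continuous (p i) := by rw [hp]; fun_prop
      exact (this.tendsto 0).mono_left nhdsWithin_le_nhds
    refine tendsto_const_nhds.add (hid.mul (Tendsto.const_mul _ (tendsto_finsetSum _ fun i _ =>
      Tendsto.const_mul _ (((hpc i).pow _).mul ?_))))
    refine hΦ.continuousAt.tendsto.comp ?_
    simpa using hid.mul (hpc i)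
  have hfin : ‖y‖ ^ s * ((‖y‖ ^ (2 * K))⁻¹ * leadingForm σ K Y ν y) +
        0 * (‖y‖ ^ s * ∑ i, ν i * (p i 0 ^ (K + 1) * Φ 0)) =
      ‖y‖ ^ (s - 2 * K) * leadingForm σ K Y ν y := by
    rw [zero_mul, add_zero, ← mul_assoc, pow_sub₀ _ hy'.ne' hK.le]
  rw [hfin] at hlim
  refine hlim.congr' ?_
  filter_upwards [self_mem_nhdsWithin] with t ht
  have ht' : (0 : ℝ) < t := ht
  rw [eq_div_iff (pow_pos ht' _).ne']
  have e : ∑ i, ν i * ‖t • Y i - y‖ ^ s = ‖y‖ ^ s * (∑ i, ν i * ∑ q ∈ Finset.range (K + 1),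
      Ring.choose σ q * (t * p i t) ^ q) +
      ‖y‖ ^ s * ∑ i, ν i * ((t * p i t) ^ (K + 1) * Φ (t * p i t)) := by
    rw [← mul_add, ← Finset.sum_add_distrib, Finset.mul_sum]
    refine Finset.sum_congr rfl fun i _ => ?_
    rw [hpow, hG]
    ring
  rw [e, hpoly]
  have e' : ∑ i, ν i * ((t * p i t) ^ (K + 1) * Φ (t * p i t)) =
      t ^ (K + 1) * ∑ i, ν i * (p i t ^ (K + 1) * Φ (t * p i t)) := by
    rw [Finset.mul_sum]
    exact Finset.sum_congr rfl fun i _ => by rw [mul_pow]; ring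
  rw [e', pow_succ]
  ring

end WronskianPosDef

/-! ### Positive definiteness of the Wronskian matrix -/

section WronskianPosDef

variable {d r : ℕ} {f : ℝ → ℝ} {w : (Fin d → ℕ) → (Fin d → ℕ) → ℝ} {φ : ℝ → ℝ}

/-- The weights `u` have only the top-degree part of `c` as moments. Small weights `U ε` on an
auxiliary grid supply the lower moments `ε ^ (K - |a|) c a`, so that the polynomial part becomes `ε
^ (2 K)` times the form of `c`, which is nonpositive. Since `U ε → 0`, the limiting energy involves
`u` alone. -/
theorem IsKernelExpansion.energy_nonneg_of_moment_eq (h : IsKernelExpansion d f r w φ)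
    (hκ : IsPositiveDefiniteKernel (stationaryKernel d f)) (hd : 1 ≤ d) {K : ℕ} (hK : K < r)
    {c : (Fin d → ℕ) → ℝ} (hc : ∀ a, K < ∑ i, a i → c a = 0)
    (hW : ∑ a ∈ monoLt d (2 * r), ∑ b ∈ monoLt d (2 * r), c a * w a b * c b ≤ 0)
    {ι : Type*} [Fintype ι] (y : ι → Pt d) {u : ι → ℝ}
    (hu : ∀ a ∈ monoLt d (2 * r), moment y u a = if ∑ i, a i = K then c a else 0) :
    0 ≤ taylorCoeff f (2 * r - 1) * energy (2 * r - 1) y y u u := by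
  obtain ⟨Y, z, -, hz⟩ := exists_dual_weights hd (2 * r)
  let U : ℝ → (Fin d → Fin (2 * r)) → ℝ := fun ε i =>
    ∑ a ∈ monoLt d K, (ε ^ (K - ∑ i, a i) * c a) * z a i
  have hU : ∀ i, Tendsto (fun ε => U ε i) (𝓝[>] 0) (𝓝 0) := by
    intro i
    have hcont : Continuous fun ε => U ε i := by
      simp only [U]
      fun_prop
    have h0 : U 0 i = 0 := by
      refine Finset.sum_eq_zero fun a ha => ?_
      have := mem_monoLt.1 ha
      rw [zero_pow (by omega)]
      ring
    have := (hcont.tendsto 0).mono_left (nhdsWithin_le_nhds (s := Set.Ioi 0))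
    rwa [h0] at this
  have hmom : ∀ ε, ∀ a ∈ monoLt d (2 * r), moment (Sum.elim y Y) (Sum.elim u (U ε)) a =
      ε ^ (K - ∑ i, a i) * c a := by
    intro ε a ha
    have h1 : moment Y (U ε) a = ∑ b ∈ monoLt d K, (ε ^ (K - ∑ i, b i) * c b) *
        moment Y (z b) a := by
      have := moment_sum (monoLt d K) Y (fun b => (ε ^ (K - ∑ i, b i) * c b) • z b) a
      simp_rw [moment_smul] at this
      exact this
    have h2 : moment Y (U ε) a = if ∑ i, a i < K then ε ^ (K - ∑ i, a i) * c a else 0 := by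
      rw [h1]
      have h3 : ∀ b ∈ monoLt d K, (ε ^ (K - ∑ i, b i) * c b) * moment Y (z b) a =
          if a = b then ε ^ (K - ∑ i, b i) * c b else 0 := by
        intro b hb
        have := mem_monoLt.1 hb
        rw [hz b (mem_monoLt.2 (by omega)) a ha, mul_ite, mul_one, mul_zero]
      rw [Finset.sum_congr rfl h3, Finset.sum_ite_eq]
      simp only [mem_monoLt]
    rw [moment_sumElim, hu a ha, h2]
    rcases lt_trichotomy (∑ i, a i) K with h3 | h3 | h3
    · rw [if_neg h3.ne, if_pos h3, zero_add]
    · rw [if_pos h3, if_neg h3.not_lt, h3]; simp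
    · rw [if_neg h3.ne', if_neg h3.not_gt, hc a h3]; simp
  have key := h.energy_nonneg_of_tendsto hκ (Sum.elim y Y)
    (U := fun ε => Sum.elim u (U ε)) (u := Sum.elim u fun _ => 0) (by
      rintro (i | i)
      · exact tendsto_const_nhds
      · exact hU i) (by
      intro ε hε
      have h1 : ∀ a ∈ monoLt d (2 * r), ∀ b ∈ monoLt d (2 * r),
          ε ^ (∑ i, a i + ∑ i, b i) * w a b * (moment (Sum.elim y Y) (Sum.elim u (U ε)) a *
            moment (Sum.elim y Y) (Sum.elim u (U ε)) b) = ε ^ (2 * K) * (c a * w a b * c b) := by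
        intro a ha b hb
        rw [hmom ε a ha, hmom ε b hb]
        by_cases h2 : K < ∑ i, a i
        · rw [hc a h2]; ring
        by_cases h3 : K < ∑ i, b i
        · rw [hc b h3]; ring
        rw [show 2 * K = (∑ i, a i + ∑ i, b i) + (K - ∑ i, a i) + (K - ∑ i, b i) by omega,
          pow_add, pow_add]
        ring
      rw [Finset.sum_congr rfl fun a ha => Finset.sum_congr rfl fun b hb => h1 a ha b hb]
      simp_rw [← Finset.mul_sum]
      exact mul_nonpos_of_nonneg_of_nonpos (by positivity) hW)
  rw [energy_sumElim] at key
  have e1 : energy (2 * r - 1) y Y u (fun _ => 0) = 0 := by simp [energy]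
  have e2 : energy (2 * r - 1) Y Y (fun _ => 0) (fun _ => 0) = 0 := by simp [energy]
  rw [e1, e2] at key
  simpa using key

/-- If the form is nonpositive at `c`, energies of measures with the leading moments of `c` are
nonnegative after multiplication by `f_{2r-1}`. Shrinking such a measure to the origin removes its
self-energy, so its cross energy with a finite difference must vanish in the limit. This kills the
leading form of `ν`; pairing it with `ν` gives a sum of squares containing the squared degree `K`
coefficients of `c`. -/
theorem IsKernelExpansion.coeff_eq_zero_of_top (h : IsKernelExpansion d f r w φ)
    (hκ : IsPositiveDefiniteKernel (stationaryKernel d f)) (hd : 1 ≤ d) {K : ℕ} (hK : K < r)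
    {c : (Fin d → ℕ) → ℝ} (hc : ∀ a, K < ∑ i, a i → c a = 0)
    (hW : ∑ a ∈ monoLt d (2 * r), ∑ b ∈ monoLt d (2 * r), c a * w a b * c b ≤ 0)
    {a₀ : Fin d → ℕ} (ha₀ : ∑ i, a₀ i = K) : c a₀ = 0 := by
  obtain ⟨Y, z, hY, hz⟩ := exists_dual_weights hd (2 * r)
  obtain ⟨s, hs⟩ : ∃ s, s = 2 * r - 1 := ⟨_, rfl⟩
  have hne := h.ne_zero
  rw [← hs] at hne
  set ν : (Fin d → Fin (2 * r)) → ℝ := fun i => ∑ a ∈ monoEq d K, c a * z a i with hν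
  have hmom : ∀ a ∈ monoLt d (2 * r), moment Y ν a = if ∑ i, a i = K then c a else 0 := by
    intro a ha
    have h1 : moment Y ν a = ∑ b ∈ monoEq d K, c b * moment Y (z b) a := by
      have := moment_sum (monoEq d K) Y (fun b => c b • z b) a
      simp_rw [moment_smul] at this
      exact this
    have h3 : ∀ b ∈ monoEq d K, c b * moment Y (z b) a = if a = b then c b else 0 := by
      intro b hb
      have := mem_monoEq.1 hb
      rw [hz b (mem_monoLt.2 (by omega)) a ha, mul_ite, mul_one, mul_zero]
    rw [h1, Finset.sum_congr rfl h3, Finset.sum_ite_eq]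
    simp only [mem_monoEq]
  set σ : ℝ := (s : ℝ) / 2 with hσ
  have hlead : ∀ y : Pt d, y ≠ 0 → leadingForm σ K Y ν y = 0 := by
    intro y hy
    have hy' : 0 < ‖y‖ := norm_pos_iff.2 hy
    set η := diffWeight (2 * r) with hη
    let p : Fin (2 * r + 1) → Pt d := fun k => ((k : ℝ) - 1) • y
    have hpη : ∀ a ∈ monoLt d (2 * r), moment p η a = 0 := by
      intro a ha
      have := moment_line_eq_zero (r := r) 0 y (mem_monoLt.1 ha)
      simpa using this
    -- The test measure is `t ^ (-K) ν` moved to the grid `t Y`, plus `τ η` on the line through `y`.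
    -- The factor `t ^ (-K)` restores the degree `K` moments, and leaves a self-energy of order `t ^
    -- (s - 2 K)`, which tends to `0` because `K < r`.
    have hineq : ∀ τ : ℝ, ∀ t > 0, 0 ≤ taylorCoeff f s * (t ^ (s - 2 * K) * energy s Y Y ν ν +
        2 * (τ * (energy s (fun i => t • Y i) p ν η / t ^ K)) + τ ^ 2 * energy s p p η η) := by
      intro τ t ht
      have h1 := h.energy_nonneg_of_moment_eq hκ hd hK hc hW
        (Sum.elim (fun i => t • Y i) p) (u := Sum.elim ((t ^ K)⁻¹ • ν) (τ • η)) (by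
          intro a ha
          rw [moment_sumElim, moment_smul, moment_smul, moment_scale, hpη a ha, hmom a ha]
          split_ifs with haK
          · rw [haK, mul_zero, add_zero, ← mul_assoc, inv_mul_cancel₀ (by positivity), one_mul]
          · simp)
      rw [← hs, energy_sumElim, energy_smul, energy_smul, energy_smul, energy_scale _ _ _ ht.le] at h1
      refine h1.trans (le_of_eq ?_)
      congr 1
      have e1 : t ^ s = t ^ (s - 2 * K) * (t ^ K * t ^ K) := by
        rw [← pow_add, ← pow_add]; congr 1; omega
      rw [e1]
      field_simp
    have hlim : Tendsto (fun t : ℝ => energy s (fun i => t • Y i) p ν η / t ^ K) (𝓝[>] 0)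
        (𝓝 (∑ k, η k * (|(k : ℝ) - 1| ^ (s - 2 * K) * ((k : ℝ) - 1) ^ K *
          (‖y‖ ^ (s - 2 * K) * leadingForm σ K Y ν y)))) := by
      have e : ∀ t : ℝ, energy s (fun i => t • Y i) p ν η / t ^ K =
          ∑ k, η k * ((∑ i, ν i * ‖t • Y i - p k‖ ^ s) / t ^ K) := by
        intro t
        rw [energy, Finset.sum_comm, Finset.sum_div]
        refine Finset.sum_congr rfl fun k _ => ?_
        rw [← mul_div_assoc, Finset.mul_sum]
        congr 1
        exact Finset.sum_congr rfl fun i _ => by ring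
      simp_rw [e]
      refine tendsto_finsetSum _ fun k _ => Tendsto.const_mul _ ?_
      -- The node at the origin is excluded from `tendsto_sum_norm_pow_div`. There the sum is
      -- exactly of order `t ^ s` with `s > K`, so it contributes zero.
      by_cases hk : (k : ℝ) - 1 = 0
      · have hp0 : p k = 0 := by simp only [p, hk, zero_smul]
        rw [hk, abs_zero, zero_pow (by omega), zero_mul, zero_mul]
        have hid : Tendsto (fun t : ℝ => t ^ (s - K) * ∑ i, ν i * ‖Y i‖ ^ s) (𝓝[>] 0) (𝓝 0) := by
          have hcont : Continuous fun t : ℝ => t ^ (s - K) * ∑ i, ν i * ‖Y i‖ ^ s := by fun_prop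
          have := (hcont.tendsto 0).mono_left (nhdsWithin_le_nhds (s := Set.Ioi 0))
          rwa [zero_pow (by omega), zero_mul] at this
        refine hid.congr' ?_
        filter_upwards [self_mem_nhdsWithin] with t ht
        have ht' : (0 : ℝ) < t := ht
        rw [eq_div_iff (by positivity), hp0, mul_right_comm, ← pow_add,
          show s - K + K = s by omega, Finset.mul_sum]
        refine Finset.sum_congr rfl fun i _ => ?_
        rw [sub_zero, norm_smul, Real.norm_of_nonneg ht'.le, mul_pow]
        ring
      · have h1 := tendsto_sum_norm_pow_div (Y := Y) (ν := ν) (K := K) (s := s) (by omega) (by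
          intro a ha hne
          rw [hmom a (mem_monoLt.2 (by omega)), if_neg hne]) (y := p k) (smul_ne_zero hk hy)
        have e2 : ‖p k‖ ^ (s - 2 * K) * leadingForm σ K Y ν (p k) =
            |(k : ℝ) - 1| ^ (s - 2 * K) * ((k : ℝ) - 1) ^ K *
              (‖y‖ ^ (s - 2 * K) * leadingForm σ K Y ν y) := by
          rw [leadingForm_smul, norm_smul, Real.norm_eq_abs, mul_pow]
          ring
        rw [← e2]
        exact h1
    have hsum : ∑ k, η k * (|(k : ℝ) - 1| ^ (s - 2 * K) * ((k : ℝ) - 1) ^ K *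
          (‖y‖ ^ (s - 2 * K) * leadingForm σ K Y ν y)) =
        2 * (-1) ^ K * (‖y‖ ^ (s - 2 * K) * leadingForm σ K Y ν y) := by
      rw [← sum_diffWeight_abs_pow (m := s - 2 * K) (K := K) (r := r) ⟨r - 1 - K, by omega⟩ (by omega),
        Finset.sum_mul]
      exact Finset.sum_congr rfl fun k _ => by ring
    rw [hsum] at hlim
    set β := 2 * (-1) ^ K * (‖y‖ ^ (s - 2 * K) * leadingForm σ K Y ν y) with hβ
    have hq : taylorCoeff f s * β = 0 := by
      refine eq_zero_of_forall_quadratic_nonneg (γ := taylorCoeff f s * energy s p p η η)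
        fun τ => ?_
      have hlim0 : Tendsto (fun t : ℝ => t ^ (s - 2 * K) * energy s Y Y ν ν) (𝓝[>] 0) (𝓝 0) := by
        have hcont : Continuous fun t : ℝ => t ^ (s - 2 * K) * energy s Y Y ν ν := by fun_prop
        have := (hcont.tendsto 0).mono_left (nhdsWithin_le_nhds (s := Set.Ioi 0))
        rwa [zero_pow (by omega), zero_mul] at this
      have h2 := (((hlim0.add ((hlim.const_mul τ).const_mul 2)).add_const
        (τ ^ 2 * energy s p p η η))).const_mul (taylorCoeff f s)
      have h3 := ge_of_tendsto h2 (by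
        filter_upwards [self_mem_nhdsWithin] with t ht using hineq τ t ht)
      refine h3.trans (le_of_eq ?_)
      ring
    have hβ0 : β = 0 := (mul_eq_zero.1 hq).resolve_left hne
    rw [hβ] at hβ0
    have h1 : (2 * (-1) ^ K : ℝ) ≠ 0 := by
      refine mul_ne_zero two_ne_zero (pow_ne_zero _ (by norm_num))
    have h2 : ‖y‖ ^ (s - 2 * K) ≠ 0 := by positivity
    simpa [h2] using hβ0
  -- Sum the leading form against `ν`: all terms have the same sign.
  set T : ℕ → ℕ → ℝ := fun q j => if q + j = K then
    Ring.choose σ q * (q.choose j : ℝ) * (2 ^ (q - j) * ∑ a ∈ monoEq d (q - j),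
      (Nat.multinomial Finset.univ a : ℝ) * (moment Y (fun i => ν i * ‖Y i‖ ^ (2 * j)) a) ^ 2)
    else 0 with hT
  have hTnn : ∀ q ∈ Finset.range (K + 1), ∀ j ∈ Finset.range (q + 1), 0 ≤ T q j := by
    intro q hq j hj
    have hqK : q ≤ K := Nat.lt_succ_iff.1 (Finset.mem_range.1 hq)
    simp only [hT]
    split_ifs with hqj
    · have : 0 < Ring.choose σ q := by
        refine choose_pos_of_lt ?_
        have h1 : (q : ℝ) + 1 ≤ r := by exact_mod_cast (by omega : q + 1 ≤ r)
        have h2 : (s : ℝ) + 1 = 2 * r := by exact_mod_cast (by omega : s + 1 = 2 * r)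
        rw [hσ]
        linarith
      refine mul_nonneg (by positivity) (mul_nonneg (by positivity) ?_)
      exact Finset.sum_nonneg fun a _ => mul_nonneg (Nat.cast_nonneg _) (sq_nonneg _)
    · exact le_rfl
  have hsum0 : ∑ q ∈ Finset.range (K + 1), ∑ j ∈ Finset.range (q + 1), T q j = 0 := by
    have h1 : ∑ i', ν i' * leadingForm σ K Y ν (Y i') = 0 :=
      Finset.sum_eq_zero fun i' _ => by rw [hlead _ (hY i'), mul_zero]
    have h2 : ∑ i', ν i' * leadingForm σ K Y ν (Y i') =
        (-1) ^ K * ∑ q ∈ Finset.range (K + 1), ∑ j ∈ Finset.range (q + 1), T q j := by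
      simp_rw [leadingForm, Finset.mul_sum]
      rw [Finset.sum_comm]
      refine Finset.sum_congr rfl fun q _ => ?_
      rw [Finset.sum_comm]
      refine Finset.sum_congr rfl fun j hj => ?_
      have hjq : j ≤ q := Nat.lt_succ_iff.1 (Finset.mem_range.1 hj)
      simp only [hT]
      split_ifs with hqj
      · have e1 := sum_mul_inner_pow Y Y (fun i => ν i * ‖Y i‖ ^ (2 * j))
          (fun i => ν i * ‖Y i‖ ^ (2 * j)) (q - j)
        simp_rw [pow_two (moment _ _ _)]
        rw [← e1]
        have e2 : ((-1 : ℝ)) ^ K = (-1) ^ (q - j) := by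
          rw [show K = (q - j) + 2 * j by omega, pow_add, pow_mul (-1 : ℝ) 2 j]
          norm_num
        rw [e2]
        simp only [Finset.mul_sum, Finset.sum_mul]
        rw [Finset.sum_comm]
        refine Finset.sum_congr rfl fun i _ => Finset.sum_congr rfl fun i' _ => ?_
        rw [mul_pow, show (-2 : ℝ) = -1 * 2 by norm_num, mul_pow]
        ring
      · simp
    rw [h2] at h1
    exact (mul_eq_zero.1 h1).resolve_left (pow_ne_zero _ (by norm_num))
  -- Only the term `q = K`, `j = 0` is needed: its squares are those of the degree `K` moments of
  -- `ν`, that is, of the leading coefficients `c a`.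
  have h1 := (Finset.sum_eq_zero_iff_of_nonneg fun q hq =>
    Finset.sum_nonneg fun j hj => hTnn q hq j hj).1 hsum0 K (Finset.self_mem_range_succ K)
  have h2 := (Finset.sum_eq_zero_iff_of_nonneg fun j hj =>
    hTnn K (Finset.self_mem_range_succ K) j hj).1 h1 0 (Finset.mem_range.2 (Nat.succ_pos _))
  simp only [hT, add_zero, if_true, Nat.sub_zero, mul_zero, pow_zero, mul_one, Nat.choose_zero_right,
    Nat.cast_one] at h2
  have hpos : 0 < Ring.choose σ K := by
    refine choose_pos_of_lt ?_
    have h1 : (K : ℝ) + 1 ≤ r := by exact_mod_cast (by omega : K + 1 ≤ r)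
    have h2 : (s : ℝ) + 1 = 2 * r := by exact_mod_cast (by omega : s + 1 = 2 * r)
    rw [hσ]
    linarith
  have h3 := (mul_eq_zero.1 ((mul_eq_zero.1 h2).resolve_left hpos.ne')).resolve_left (by positivity)
  have h4 := (Finset.sum_eq_zero_iff_of_nonneg fun a _ =>
    mul_nonneg (Nat.cast_nonneg _) (sq_nonneg _)).1 h3 a₀ (mem_monoEq.2 ha₀)
  have h5 : (Nat.multinomial Finset.univ a₀ : ℝ) ≠ 0 := by
    exact_mod_cast (Nat.multinomial_pos _ _).ne'
  have h6 := pow_eq_zero_iff (two_ne_zero) |>.1 ((mul_eq_zero.1 h4).resolve_left h5)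
  rw [hmom a₀ (mem_monoLt.2 (by omega)), if_pos ha₀] at h6
  exact h6

/-- Otherwise `coeff_eq_zero_of_top`, applied at the largest degree on which `c` is nonzero,
contradicts the choice of that degree. -/
theorem IsKernelExpansion.sum_pos (h : IsKernelExpansion d f r w φ)
    (hκ : IsPositiveDefiniteKernel (stationaryKernel d f)) (hd : 1 ≤ d)
    {c : (Fin d → ℕ) → ℝ} (hc : ∀ a, r ≤ ∑ i, a i → c a = 0) (hc0 : c ≠ 0) :
    0 < ∑ a ∈ monoLt d (2 * r), ∑ b ∈ monoLt d (2 * r), c a * w a b * c b := by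
  classical
  by_contra hW
  rw [not_lt] at hW
  obtain ⟨a₁, ha₁⟩ := Function.ne_iff.1 hc0
  have hne : ((monoLt d r).filter fun a => c a ≠ 0).Nonempty := by
    refine ⟨a₁, Finset.mem_filter.2 ⟨mem_monoLt.2 ?_, ha₁⟩⟩
    by_contra hlt
    exact ha₁ (hc a₁ (not_lt.1 hlt))
  obtain ⟨a₀, ha₀, hmax⟩ := Finset.exists_max_image _ (fun a : Fin d → ℕ => ∑ i, a i) hne
  rw [Finset.mem_filter, mem_monoLt] at ha₀
  refine ha₀.2 (h.coeff_eq_zero_of_top hκ hd ha₀.1 (fun a ha => ?_) hW rfl)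
  by_contra hca
  refine absurd (hmax a (Finset.mem_filter.2 ⟨mem_monoLt.2 ?_, hca⟩)) (not_le.2 ha)
  by_contra hlt
  exact hca (hc a (not_lt.1 hlt))

theorem IsKernelExpansion.wronskian_posDef (h : IsKernelExpansion d f r w φ)
    (hκ : IsPositiveDefiniteKernel (stationaryKernel d f)) (hd : 1 ≤ d) {k : ℕ} (hk : k ≤ r) :
    (wronskian (stationaryKernel d f) (monoLt d k) (monoLt d k)).PosDef := by
  classical
  have hlt : ∀ a : monoLt d k, ∑ i, a.1 i < r := fun a =>
    (mem_monoLt.1 a.2).trans_le hk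
  refine Matrix.PosDef.of_dotProduct_mulVec_pos ?_ fun v hv => ?_
  · ext a b
    rw [Matrix.conjTranspose_apply, star_trivial, h.wronskian_apply _ _ (hlt _) (hlt _),
      h.wronskian_apply _ _ (hlt _) (hlt _), h.coeff_symm]
  · let c : (Fin d → ℕ) → ℝ := fun a => if ha : a ∈ monoLt d k then v ⟨a, ha⟩ else 0
    have hcv : ∀ a : monoLt d k, c a.1 = v a := fun a => dif_pos a.2
    have hsub : monoLt d k ⊆ monoLt d (2 * r) := fun a ha =>
      mem_monoLt.2 (by have := mem_monoLt.1 ha; omega)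
    have hc0 : ∀ a, a ∉ monoLt d k → c a = 0 := fun a ha => dif_neg ha
    have h1 := h.sum_pos hκ hd (c := c) (fun a ha => hc0 a fun hm => by
      have := mem_monoLt.1 hm; omega) (by
        intro hc
        refine hv (funext fun a => ?_)
        rw [← hcv, hc]; rfl)
    refine h1.trans_le (le_of_eq ?_)
    rw [← Finset.sum_subset hsub fun a _ ha => by simp [hc0 a ha]]
    rw [← Finset.sum_coe_sort]
    simp only [dotProduct, Matrix.mulVec, Finset.mul_sum, star_trivial]
    refine Finset.sum_congr rfl fun a _ => ?_
    rw [← Finset.sum_subset hsub fun b _ hb => by simp [hc0 b hb]]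
    rw [← Finset.sum_coe_sort]
    refine Finset.sum_congr rfl fun b _ => ?_
    rw [hcv, hcv, h.wronskian_apply _ _ (hlt _) (hlt _)]
    ring

end WronskianPosDef

/-! ### Lower bounds on the kernel matrix -/

/-- A penalty argument: on the unit sphere the sets `{E + m G ≤ 0}` are compact and decreasing in
`m`. A common point would satisfy `G = 0` and `E ≤ 0`, so one of them is empty. The bound then
extends by homogeneity of degree two. -/
theorem exists_le_add_mul_of_pos {ι : Type*} [Fintype ι] {E G : (ι → ℝ) → ℝ} (hE : Continuous E)
    (hG : Continuous G) (hE2 : ∀ (c : ℝ) u, E (c • u) = c ^ 2 * E u)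
    (hG2 : ∀ (c : ℝ) u, G (c • u) = c ^ 2 * G u) (hG0 : ∀ u, 0 ≤ G u)
    (hpos : ∀ u, u ≠ 0 → G u = 0 → 0 < E u) :
    ∃ δ > 0, ∃ C ≥ 0, ∀ u, δ * (u ⬝ᵥ u) ≤ E u + C * G u := by
  have hN : Continuous fun u : ι → ℝ => u ⬝ᵥ u := by
    simp only [dotProduct]; fun_prop
  have hcomp : IsCompact {u : ι → ℝ | u ⬝ᵥ u = 1} := by
    refine Metric.isCompact_of_isClosed_isBounded (isClosed_eq hN continuous_const) ?_
    refine (Metric.isBounded_closedBall (x := (0 : ι → ℝ)) (r := 1)).subset fun u hu => ?_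
    rw [mem_closedBall_zero_iff, pi_norm_le_iff_of_nonneg zero_le_one]
    intro i
    have h1 : u i * u i ≤ u ⬝ᵥ u :=
      Finset.single_le_sum (f := fun i => u i * u i) (fun j _ => mul_self_nonneg _)
        (Finset.mem_univ i)
    rw [show u ⬝ᵥ u = 1 from hu] at h1
    rw [Real.norm_eq_abs]
    exact abs_le_one_iff_mul_self_le_one.2 h1
  obtain ⟨m, hm⟩ : ∃ m : ℕ, ∀ u : ι → ℝ, u ⬝ᵥ u = 1 → 0 < E u + m * G u := by
    by_contra hcon
    push Not at hcon
    let K : ℕ → Set (ι → ℝ) := fun m => {u | u ⬝ᵥ u = 1} ∩ {u | E u + m * G u ≤ 0}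
    have hcl : ∀ m, IsClosed {u | E u + m * G u ≤ 0} := fun m =>
      isClosed_le (hE.add (continuous_const.mul hG)) continuous_const
    obtain ⟨u, hu⟩ := IsCompact.nonempty_iInter_of_sequence_nonempty_isCompact_isClosed K
      (fun m u hu => ⟨hu.1, by
        have := hu.2
        simp only [Set.mem_ofPred_eq, Nat.cast_add, Nat.cast_one] at this ⊢
        linarith [hG0 u]⟩)
      (fun m => by
        obtain ⟨u, h1, h2⟩ := hcon m
        exact ⟨u, h1, h2⟩)
      (hcomp.inter_right (by simpa using hcl 0)) (fun m => hcomp.isClosed.inter (hcl m))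
    rw [Set.mem_iInter] at hu
    have hu1 : u ⬝ᵥ u = 1 := (hu 0).1
    have hu0 : u ≠ 0 := by
      rintro rfl
      simp at hu1
    have hGu : G u = 0 := by
      by_contra hne
      have hGp : 0 < G u := lt_of_le_of_ne (hG0 u) (Ne.symm hne)
      obtain ⟨m, hm⟩ := exists_nat_gt (-E u / G u)
      rw [div_lt_iff₀ hGp] at hm
      have := (hu m).2
      simp only [Set.mem_ofPred_eq] at this
      linarith
    have := (hu 0).2
    have h2 := hpos u hu0 hGu
    simp only [Set.mem_ofPred_eq, hGu, mul_zero, add_zero] at this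
    linarith
  obtain ⟨δ, hδ, hδ'⟩ : ∃ δ > 0, ∀ u : ι → ℝ, u ⬝ᵥ u = 1 → δ ≤ E u + m * G u := by
    rcases Set.eq_empty_or_nonempty {u : ι → ℝ | u ⬝ᵥ u = 1} with he | hne
    · exact ⟨1, one_pos, fun u hu => by
        have : u ∈ {u : ι → ℝ | u ⬝ᵥ u = 1} := hu
        rw [he] at this
        exact this.elim⟩
    · obtain ⟨v, hv, hmin⟩ := hcomp.exists_isMinOn hne
        (hE.add (continuous_const.mul hG) : Continuous fun u => E u + m * G u).continuousOn
      exact ⟨_, hm v hv, fun u hu => hmin hu⟩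
  refine ⟨δ, hδ, m, Nat.cast_nonneg _, fun u => ?_⟩
  have hnn : 0 ≤ u ⬝ᵥ u := Finset.sum_nonneg fun i _ => mul_self_nonneg _
  rcases hnn.eq_or_lt with h0 | h0
  · have hu : u = 0 := dotProduct_self_eq_zero.1 h0.symm
    have e1 := hE2 0 0
    have e2 := hG2 0 0
    rw [smul_zero, zero_pow two_ne_zero, zero_mul] at e1 e2
    rw [hu, e1, e2]
    simp
  · set t := Real.sqrt (u ⬝ᵥ u) with ht
    have ht2 : t ^ 2 = u ⬝ᵥ u := Real.sq_sqrt hnn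
    have htp : 0 < t := Real.sqrt_pos.2 h0
    have h1 := hδ' (t⁻¹ • u) (by
      rw [smul_dotProduct, dotProduct_smul, ← ht2, smul_eq_mul, smul_eq_mul]
      field_simp)
    rw [hE2, hG2] at h1
    rw [← ht2]
    have h2 := mul_le_mul_of_nonneg_left h1 (sq_nonneg t)
    calc δ * t ^ 2 = t ^ 2 * δ := mul_comm _ _
      _ ≤ _ := h2
      _ = _ := by field_simp

section LowerBounds

variable {d r : ℕ} {f : ℝ → ℝ} {w : (Fin d → ℕ) → (Fin d → ℕ) → ℝ} {φ : ℝ → ℝ}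

theorem dotProduct_kernelMatrix_mulVec {n : ℕ} (f : ℝ → ℝ) (x : Fin n → Pt d) (ε : ℝ)
    (u v : Fin n → ℝ) :
    u ⬝ᵥ (kernelMatrix f x ε *ᵥ v) = ∑ i, ∑ j, u i * v j * f (ε * ‖x i - x j‖) := by
  simp only [dotProduct, Matrix.mulVec, kernelMatrix, Matrix.of_apply, Finset.mul_sum]
  exact Finset.sum_congr rfl fun i _ => Finset.sum_congr rfl fun j _ => by ring

theorem continuous_moment {ι : Type*} [Fintype ι] (y : ι → Pt d) (a : Fin d → ℕ) :
    Continuous fun u : ι → ℝ => moment y u a := by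
  simp only [moment]; fun_prop

theorem moment_sq_le {ι : Type*} [Fintype ι] (y : ι → Pt d) (a : Fin d → ℕ) (u : ι → ℝ) :
    moment y u a ^ 2 ≤ (∑ i, monoVal (y i) a ^ 2) * (u ⬝ᵥ u) := by
  have := Finset.sum_mul_sq_le_sq_mul_sq Finset.univ u fun i => monoVal (y i) a
  rw [mul_comm]
  simpa [moment, dotProduct, pow_two] using this

/-- In the rescaled moments `ε ^ |a| m_a(u)` the polynomial part is a fixed form, positive definite
when the coordinates of degree `≥ k` vanish. Penalising those coordinates costs at most a multiple
of `ε ^ (2 k)`, and the others are weighted by at least `ε ^ (2 k - 2)` in the square. -/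
theorem IsKernelExpansion.exists_poly_lower_bound (h : IsKernelExpansion d f r w φ)
    (hκ : IsPositiveDefiniteKernel (stationaryKernel d f)) (hd : 1 ≤ d) {k : ℕ} (hk : k ≤ r)
    {ι : Type*} [Fintype ι] (y : ι → Pt d) :
    ∃ δ > 0, ∃ C ≥ 0, ∀ ε : ℝ, 0 < ε → ε ≤ 1 → ∀ u : ι → ℝ,
      δ * (ε ^ (2 * k - 2) * ∑ a ∈ monoLt d k, moment y u a ^ 2) ≤
        ∑ a ∈ monoLt d (2 * r), ∑ b ∈ monoLt d (2 * r),
          ε ^ (∑ i, a i + ∑ i, b i) * w a b * (moment y u a * moment y u b) +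
        C * (ε ^ (2 * k) * (u ⬝ᵥ u)) := by
  classical
  set T := monoLt d (2 * r) with hT
  have hsub : monoLt d k ⊆ T := fun a ha => mem_monoLt.2 (by have := mem_monoLt.1 ha; omega)
  let E : (T → ℝ) → ℝ := fun s => ∑ a, ∑ b, s a * w a.1 b.1 * s b
  let G : (T → ℝ) → ℝ := fun s => ∑ a, if ∑ i, a.1 i < k then 0 else s a ^ 2
  obtain ⟨δ, hδ, C, hC, hle⟩ := exists_le_add_mul_of_pos (E := E) (G := G)
    (by simp only [E]; fun_prop)
    (by
      refine continuous_finsetSum _ fun a _ => ?_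
      split_ifs <;> fun_prop)
    (by
      intro c u
      simp only [E, Finset.mul_sum, Pi.smul_apply, smul_eq_mul]
      exact Finset.sum_congr rfl fun a _ => Finset.sum_congr rfl fun b _ => by ring)
    (by
      intro c u
      simp only [G, Finset.mul_sum, Pi.smul_apply, smul_eq_mul]
      refine Finset.sum_congr rfl fun a _ => ?_
      split_ifs <;> ring)
    (by
      intro u
      refine Finset.sum_nonneg fun a _ => ?_
      split_ifs <;> positivity)
    (by
      intro s hs hGs
      let c : (Fin d → ℕ) → ℝ := fun a => if ha : a ∈ T then s ⟨a, ha⟩ else 0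
      have hcs : ∀ a : T, c a.1 = s a := fun a => dif_pos a.2
      have hz := (Finset.sum_eq_zero_iff_of_nonneg (fun a _ => by
        split_ifs <;> positivity)).1 hGs
      have h1 := h.sum_pos hκ hd (c := c) (by
        intro a ha
        by_cases haT : a ∈ T
        · have := hz ⟨a, haT⟩ (Finset.mem_univ _)
          rw [if_neg (by dsimp only; omega)] at this
          rw [hcs ⟨a, haT⟩]
          exact pow_eq_zero_iff two_ne_zero |>.1 this
        · exact dif_neg haT) (by
        intro hc
        refine hs (funext fun a => ?_)
        rw [← hcs, hc]; rfl)
      refine h1.trans_le (le_of_eq ?_)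
      rw [← hT, ← Finset.sum_coe_sort]
      refine Finset.sum_congr rfl fun a _ => ?_
      rw [← Finset.sum_coe_sort]
      exact Finset.sum_congr rfl fun b _ => by rw [hcs, hcs])
  set B : ℝ := ∑ a ∈ T, ∑ i, monoVal (y i) a ^ 2 with hB
  have hB0 : 0 ≤ B := by positivity
  refine ⟨δ, hδ, C * B, by positivity, fun ε hε hε1 u => ?_⟩
  have hnn : 0 ≤ u ⬝ᵥ u := Finset.sum_nonneg fun i _ => mul_self_nonneg _
  have h1 := hle fun a => ε ^ (∑ i, a.1 i) * moment y u a.1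
  have e1 : E (fun a => ε ^ (∑ i, a.1 i) * moment y u a.1) = ∑ a ∈ T, ∑ b ∈ T,
      ε ^ (∑ i, a i + ∑ i, b i) * w a b * (moment y u a * moment y u b) := by
    simp only [E]
    rw [← Finset.sum_coe_sort T]
    refine Finset.sum_congr rfl fun a _ => ?_
    rw [← Finset.sum_coe_sort T]
    exact Finset.sum_congr rfl fun b _ => by rw [pow_add]; ring
  rw [e1] at h1
  have e2 : G (fun a => ε ^ (∑ i, a.1 i) * moment y u a.1) ≤ B * (ε ^ (2 * k) * (u ⬝ᵥ u)) := by
    simp only [G]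
    rw [Finset.sum_coe_sort T fun a => if ∑ i, a i < k then 0 else
      (ε ^ (∑ i, a i) * moment y u a) ^ 2, hB, Finset.sum_mul]
    refine Finset.sum_le_sum fun a _ => ?_
    split_ifs with ha
    · positivity
    · rw [mul_pow, ← pow_mul]
      have h2 : ε ^ ((∑ i, a i) * 2) ≤ ε ^ (2 * k) := pow_le_pow_of_le_one hε.le hε1 (by omega)
      calc ε ^ ((∑ i, a i) * 2) * moment y u a ^ 2
          ≤ ε ^ (2 * k) * ((∑ i, monoVal (y i) a ^ 2) * (u ⬝ᵥ u)) :=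
            mul_le_mul h2 (moment_sq_le y a u) (sq_nonneg _) (by positivity)
        _ = _ := by ring
  have e3 : ε ^ (2 * k - 2) * ∑ a ∈ monoLt d k, moment y u a ^ 2 ≤
      (fun a : T => ε ^ (∑ i, a.1 i) * moment y u a.1) ⬝ᵥ
        fun a : T => ε ^ (∑ i, a.1 i) * moment y u a.1 := by
    rw [dotProduct, Finset.sum_coe_sort T fun a => ε ^ (∑ i, a i) * moment y u a *
      (ε ^ (∑ i, a i) * moment y u a), Finset.mul_sum]
    refine (Finset.sum_le_sum fun a ha => ?_).trans
      (Finset.sum_le_sum_of_subset_of_nonneg hsub fun a _ _ => mul_self_nonneg _)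
    have ha' := mem_monoLt.1 ha
    have h2 : ε ^ (2 * k - 2) ≤ ε ^ (2 * ∑ i, a i) := pow_le_pow_of_le_one hε.le hε1 (by omega)
    calc ε ^ (2 * k - 2) * moment y u a ^ 2 ≤ ε ^ (2 * ∑ i, a i) * moment y u a ^ 2 := by gcongr
      _ = _ := by ring
  calc _ ≤ _ := mul_le_mul_of_nonneg_left e3 hδ.le
    _ ≤ _ := h1
    _ ≤ _ := by
      rw [mul_assoc]
      gcongr

/-- Continuity of the remainder term at `ε = 0`. -/
theorem IsKernelExpansion.eventually_abs_remainder_sub_le (h : IsKernelExpansion d f r w φ)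
    {n : ℕ} (x : Fin n → Pt d) {η : ℝ} (hη : 0 < η) :
    ∀ᶠ ε in 𝓝[>] (0 : ℝ), ∀ u : Fin n → ℝ,
      |∑ i, ∑ j, u i * u j * (‖x i - x j‖ ^ (2 * r - 1) * φ (ε * ‖x i - x j‖)) -
        taylorCoeff f (2 * r - 1) * energy (2 * r - 1) x x u u| ≤ η * (u ⬝ᵥ u) := by
  have hlim : ∀ i j, Tendsto (fun ε => ‖x i - x j‖ ^ (2 * r - 1) * φ (ε * ‖x i - x j‖) -
      taylorCoeff f (2 * r - 1) * ‖x i - x j‖ ^ (2 * r - 1)) (𝓝[>] 0) (𝓝 0) := by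
    intro i j
    have h1 : Tendsto (fun ε : ℝ => ε * ‖x i - x j‖) (𝓝[>] 0) (𝓝 0) := by
      have : Tendsto (fun ε : ℝ => ε * ‖x i - x j‖) (𝓝 0) (𝓝 (0 * ‖x i - x j‖)) :=
        (continuous_id.mul continuous_const).tendsto 0
      rw [zero_mul] at this
      exact this.mono_left nhdsWithin_le_nhds
    have h2 := (h.analyticAt.continuousAt.tendsto.comp h1).const_mul (‖x i - x j‖ ^ (2 * r - 1))
    rw [h.apply_zero] at h2
    have h3 := h2.sub_const (taylorCoeff f (2 * r - 1) * ‖x i - x j‖ ^ (2 * r - 1))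
    rwa [mul_comm (‖x i - x j‖ ^ (2 * r - 1)) (taylorCoeff f (2 * r - 1)), sub_self] at h3
  have hn : 0 < η / (n + 1) := by positivity
  have hev : ∀ᶠ ε in 𝓝[>] (0 : ℝ), ∀ i j, |‖x i - x j‖ ^ (2 * r - 1) * φ (ε * ‖x i - x j‖) -
      taylorCoeff f (2 * r - 1) * ‖x i - x j‖ ^ (2 * r - 1)| ≤ η / (n + 1) := by
    rw [eventually_all]; intro i
    rw [eventually_all]; intro j
    have := (hlim i j).abs
    rw [abs_zero] at this
    exact this.eventually_le_const hn
  filter_upwards [hev] with ε hε u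
  have e1 : ∑ i, ∑ j, u i * u j * (‖x i - x j‖ ^ (2 * r - 1) * φ (ε * ‖x i - x j‖)) -
        taylorCoeff f (2 * r - 1) * energy (2 * r - 1) x x u u =
      ∑ i, ∑ j, u i * u j * (‖x i - x j‖ ^ (2 * r - 1) * φ (ε * ‖x i - x j‖) -
        taylorCoeff f (2 * r - 1) * ‖x i - x j‖ ^ (2 * r - 1)) := by
    rw [energy, Finset.mul_sum, ← Finset.sum_sub_distrib]
    refine Finset.sum_congr rfl fun i _ => ?_
    rw [Finset.mul_sum, ← Finset.sum_sub_distrib]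
    exact Finset.sum_congr rfl fun j _ => by ring
  have hS : (∑ i, |u i|) ^ 2 ≤ n * (u ⬝ᵥ u) := by
    have := sq_sum_le_card_mul_sum_sq (s := Finset.univ) (f := fun i => |u i|)
    simpa [dotProduct, pow_two] using this
  have hnn : 0 ≤ u ⬝ᵥ u := Finset.sum_nonneg fun i _ => mul_self_nonneg _
  rw [e1]
  calc _ ≤ ∑ i, ∑ j, |u i| * |u j| * (η / (n + 1)) := by
        refine (Finset.abs_sum_le_sum_abs _ _).trans (Finset.sum_le_sum fun i _ => ?_)
        refine (Finset.abs_sum_le_sum_abs _ _).trans (Finset.sum_le_sum fun j _ => ?_)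
        rw [abs_mul, abs_mul]
        exact mul_le_mul_of_nonneg_left (hε i j) (by positivity)
    _ = (∑ i, |u i|) ^ 2 * (η / (n + 1)) := by
        rw [pow_two, Finset.sum_mul_sum, Finset.sum_mul]
        exact Finset.sum_congr rfl fun i _ => by rw [Finset.sum_mul]
    _ ≤ n * (u ⬝ᵥ u) * (η / (n + 1)) := by gcongr
    _ ≤ η * (u ⬝ᵥ u) := by
        have : (n : ℝ) * (η / (n + 1)) ≤ η := by
          rw [mul_div_assoc', div_le_iff₀ (by positivity)]
          nlinarith
        nlinarith

theorem continuous_energy {n : ℕ} (s : ℕ) (x : Fin n → Pt d) :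
    Continuous fun u : Fin n → ℝ => energy s x x u u := by
  simp only [energy]; fun_prop

/-- The kernel matrix is bounded below by a multiple of `ε ^ (2 r - 1)`. -/
theorem IsKernelExpansion.eventually_le_of_injective (h : IsKernelExpansion d f r w φ)
    (hκ : IsPositiveDefiniteKernel (stationaryKernel d f)) (hd : 1 ≤ d) {n : ℕ}
    {x : Fin n → Pt d} (hx : Function.Injective x) :
    ∃ c > 0, ∀ᶠ ε in 𝓝[>] (0 : ℝ), ∀ u : Fin n → ℝ,
      c * ε ^ (2 * r - 1) * (u ⬝ᵥ u) ≤ u ⬝ᵥ (kernelMatrix f x ε *ᵥ u) := by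
  have hr := h.one_le
  obtain ⟨δ, hδ, C, hC, hpoly⟩ := h.exists_poly_lower_bound hκ hd le_rfl x
  -- The energy controls `u` up to a multiple of its squared moments of degree `< r`. The loss `ε ^
  -- (2 r - 1) D G` is absorbed by the larger polynomial term `δ ε ^ (2 r - 2) G` once `D ε < δ`.
  obtain ⟨γ, hγ, D, hD, hfin⟩ := exists_le_add_mul_of_pos
    (E := fun u => taylorCoeff f (2 * r - 1) * energy (2 * r - 1) x x u u)
    (G := fun u => ∑ a ∈ monoLt d r, moment x u a ^ 2)
    (continuous_const.mul (continuous_energy _ x))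
    (continuous_finsetSum _ fun a _ => (continuous_moment x a).pow 2)
    (by intro c u; rw [energy_smul]; ring)
    (by
      intro c u
      simp only [moment_smul, Finset.mul_sum, mul_pow])
    (fun u => Finset.sum_nonneg fun a _ => sq_nonneg _)
    (by
      intro u hu hG
      have hu0 : ∀ a ∈ monoLt d r, moment x u a = 0 := fun a ha =>
        pow_eq_zero_iff two_ne_zero |>.1
          ((Finset.sum_eq_zero_iff_of_nonneg fun a _ => sq_nonneg _).1 hG a ha)
      refine lt_of_le_of_ne (h.energy_nonneg hκ x hu0) fun h0 => hu ?_
      exact h.eq_zero_of_energy_eq_zero hκ hd hx hu0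
        ((mul_eq_zero.1 h0.symm).resolve_left h.ne_zero))
  refine ⟨γ / 2, by positivity, ?_⟩
  have hid : Tendsto (fun ε : ℝ => ε) (𝓝[>] 0) (𝓝 0) := tendsto_id.mono_left nhdsWithin_le_nhds
  have hev1 : ∀ᶠ ε in 𝓝[>] (0 : ℝ), D * ε < δ := by
    have := hid.const_mul D
    rw [mul_zero] at this
    exact this.eventually_lt_const hδ
  have hev2 : ∀ᶠ ε in 𝓝[>] (0 : ℝ), C * ε < γ / 4 := by
    have := hid.const_mul C
    rw [mul_zero] at this
    exact this.eventually_lt_const (by positivity)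
  filter_upwards [self_mem_nhdsWithin, hid.eventually_lt_const one_pos, hev1, hev2,
    h.eventually_abs_remainder_sub_le x (show 0 < γ / 4 by positivity)] with ε hε hε1 h1 h2 h3 u
  replace hε : 0 < ε := hε
  rw [dotProduct_kernelMatrix_mulVec, h.bilin_eq x u u hε]
  have hp := hpoly ε hε hε1.le u
  have hq := hfin u
  have hR := (abs_le.1 (h3 u)).1
  set G := ∑ a ∈ monoLt d r, moment x u a ^ 2
  set U := u ⬝ᵥ u with hU
  have hU0 : 0 ≤ U := Finset.sum_nonneg fun i _ => mul_self_nonneg _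
  have hG0 : 0 ≤ G := Finset.sum_nonneg fun a _ => sq_nonneg _
  set t := ε ^ (2 * r - 2) with ht
  have ht0 : 0 < t := by positivity
  have e1 : ε ^ (2 * r - 1) = t * ε := by rw [ht, ← pow_succ]; congr 1; omega
  have e2 : ε ^ (2 * r) = t * ε * ε := by rw [ht, ← pow_succ, ← pow_succ]; congr 1; omega
  rw [e2] at hp
  rw [e1]
  set P := ∑ a ∈ monoLt d (2 * r), ∑ b ∈ monoLt d (2 * r),
          ε ^ (∑ i, a i + ∑ i, b i) * w a b * (moment x u a * moment x u b)
  set Rm := ∑ i, ∑ j, u i * u j * (‖x i - x j‖ ^ (2 * r - 1) * φ (ε * ‖x i - x j‖))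
  have hRm : γ * U - D * G - γ / 4 * U ≤ Rm := by linarith
  have k1 := mul_le_mul_of_nonneg_left hRm (by positivity : 0 ≤ t * ε)
  have k2 : t * ε * (D * G) ≤ δ * (t * G) := by
    have := mul_le_mul_of_nonneg_right h1.le (by positivity : 0 ≤ t * G)
    linarith
  have k3 : C * (t * ε * ε * U) ≤ γ / 4 * (t * ε * U) := by
    have := mul_le_mul_of_nonneg_right h2.le (by positivity : 0 ≤ t * ε * U)
    linarith
  nlinarith

/-- If the monomials of degree `< k` separate the weights on `x`, the kernel matrix is bounded below
by a multiple of `ε ^ (2 k - 2)`. -/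
theorem IsKernelExpansion.eventually_le_of_forall_moment (h : IsKernelExpansion d f r w φ)
    (hκ : IsPositiveDefiniteKernel (stationaryKernel d f)) (hd : 1 ≤ d) {n k : ℕ} (hk : k ≤ r)
    (hk1 : 1 ≤ k) {x : Fin n → Pt d}
    (hx : ∀ u : Fin n → ℝ, (∀ a ∈ monoLt d k, moment x u a = 0) → u = 0) :
    ∃ c > 0, ∀ᶠ ε in 𝓝[>] (0 : ℝ), ∀ u : Fin n → ℝ,
      c * ε ^ (2 * k - 2) * (u ⬝ᵥ u) ≤ u ⬝ᵥ (kernelMatrix f x ε *ᵥ u) := by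
  obtain ⟨δ, hδ, C, hC, hpoly⟩ := h.exists_poly_lower_bound hκ hd hk x
  obtain ⟨γ, hγ, _, _, hfin⟩ := exists_le_add_mul_of_pos
    (E := fun u => ∑ a ∈ monoLt d k, moment x u a ^ 2) (G := fun _ => 0)
    (continuous_finsetSum _ fun a _ => (continuous_moment x a).pow 2) continuous_const
    (by
      intro c u
      simp only [moment_smul, Finset.mul_sum, mul_pow])
    (by simp) (by simp)
    (by
      intro u hu _
      refine lt_of_le_of_ne (Finset.sum_nonneg fun a _ => sq_nonneg _) fun h0 => hu (hx u ?_)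
      exact fun a ha => pow_eq_zero_iff two_ne_zero |>.1
        ((Finset.sum_eq_zero_iff_of_nonneg fun a _ => sq_nonneg _).1 h0.symm a ha))
  obtain ⟨D, hD, _, _, hener⟩ : ∃ D > 0, ∃ C ≥ (0 : ℝ), ∀ u : Fin n → ℝ,
      -D * (u ⬝ᵥ u) ≤ taylorCoeff f (2 * r - 1) * energy (2 * r - 1) x x u u + C * 0 := by
    have hN : Continuous fun u : Fin n → ℝ => u ⬝ᵥ u := by
      simp only [dotProduct]; fun_prop
    -- With `G` the squared norm the positivity hypothesis is vacuous, so this only bounds the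
    -- energy below by a multiple of `u ⬝ᵥ u`.
    obtain ⟨δ', hδ', C', hC', h'⟩ := exists_le_add_mul_of_pos
      (E := fun u => taylorCoeff f (2 * r - 1) * energy (2 * r - 1) x x u u)
      (G := fun u : Fin n → ℝ => u ⬝ᵥ u)
      (continuous_const.mul (continuous_energy _ x)) hN
      (by intro c u; rw [energy_smul]; ring)
      (by
        intro c u
        rw [smul_dotProduct, dotProduct_smul, smul_eq_mul, smul_eq_mul]; ring)
      (fun u => Finset.sum_nonneg fun i _ => mul_self_nonneg _)
      (fun u hu h0 => absurd (dotProduct_self_eq_zero.1 h0) hu)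
    refine ⟨C' + 1, by positivity, 0, le_rfl, fun u => ?_⟩
    have h1 := h' u
    have h2 : 0 ≤ u ⬝ᵥ u := Finset.sum_nonneg fun i _ => mul_self_nonneg _
    nlinarith
  refine ⟨δ * γ / 2, by positivity, ?_⟩
  have hid : Tendsto (fun ε : ℝ => ε) (𝓝[>] 0) (𝓝 0) := tendsto_id.mono_left nhdsWithin_le_nhds
  have hev1 : ∀ᶠ ε in 𝓝[>] (0 : ℝ), (C + (D + 1)) * ε < δ * γ / 2 := by
    have := hid.const_mul (C + (D + 1))
    rw [mul_zero] at this
    exact this.eventually_lt_const (by positivity)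
  filter_upwards [self_mem_nhdsWithin, hid.eventually_lt_const one_pos, hev1,
    h.eventually_abs_remainder_sub_le x one_pos] with ε hε hε1 h1 h3 u
  replace hε : 0 < ε := hε
  rw [dotProduct_kernelMatrix_mulVec, h.bilin_eq x u u hε]
  have hp := hpoly ε hε hε1.le u
  have hq := hfin u
  have hR := (abs_le.1 (h3 u)).1
  have hE := hener u
  set G := ∑ a ∈ monoLt d k, moment x u a ^ 2
  set U := u ⬝ᵥ u with hU
  have hU0 : 0 ≤ U := Finset.sum_nonneg fun i _ => mul_self_nonneg _
  set t := ε ^ (2 * k - 2) with ht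
  have ht0 : 0 < t := by positivity
  have e1 : ε ^ (2 * r - 1) ≤ t * ε := by
    rw [ht, ← pow_succ]; exact pow_le_pow_of_le_one hε.le hε1.le (by omega)
  have e2 : ε ^ (2 * k) ≤ t * ε := by
    rw [ht, ← pow_succ]; exact pow_le_pow_of_le_one hε.le hε1.le (by omega)
  set P := ∑ a ∈ monoLt d (2 * r), ∑ b ∈ monoLt d (2 * r),
          ε ^ (∑ i, a i + ∑ i, b i) * w a b * (moment x u a * moment x u b)
  set Rm := ∑ i, ∑ j, u i * u j * (‖x i - x j‖ ^ (2 * r - 1) * φ (ε * ‖x i - x j‖))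
  have k1 : -(t * ε * ((D + 1) * U)) ≤ ε ^ (2 * r - 1) * Rm := by
    have hRm : -((D + 1) * U) ≤ Rm := by linarith
    have a1 := mul_le_mul_of_nonneg_left hRm (by positivity : 0 ≤ ε ^ (2 * r - 1))
    have a2 := mul_le_mul_of_nonneg_right e1 (by positivity : 0 ≤ (D + 1) * U)
    linarith
  have k2 : C * (ε ^ (2 * k) * U) ≤ C * (t * ε * U) := by gcongr
  have k3 : δ * (t * (γ * U)) ≤ δ * (t * G) := by
    have : γ * U ≤ G := by linarith
    gcongr
  have k4 := mul_le_mul_of_nonneg_right h1.le (by positivity : 0 ≤ t * U)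
  nlinarith

end LowerBounds

/-! ### Projection onto the orthogonal complement of a column span -/

section Projection

theorem mulVec_injective_of_rank_eq_card {m ι : Type*} [Fintype ι] {M : Matrix m ι ℝ}
    (hM : M.rank = Fintype.card ι) : Function.Injective M.mulVec := by
  rw [Matrix.mulVec_injective_iff, linearIndependent_iff_card_eq_finrank_span, ← hM,
    Matrix.rank_eq_finrank_span_cols, Set.finrank]

theorem exists_eq_mul_of_span_le {m ι κ : Type*} [Fintype κ] {M : Matrix m κ ℝ}
    {N : Matrix m ι ℝ} (h : Submodule.span ℝ (Set.range N.col) ≤ Submodule.span ℝ (Set.range M.col)) :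
    ∃ C : Matrix κ ι ℝ, N = M * C := by
  have h1 : ∀ j, ∃ c : κ → ℝ, M *ᵥ c = N.col j := by
    intro j
    have := h (Submodule.subset_span (Set.mem_range_self j))
    rw [← Matrix.range_mulVecLin] at this
    exact this
  choose c hc using h1
  refine ⟨Matrix.of fun i j => c j i, ?_⟩
  ext i j
  have := congrFun (hc j) i
  rw [Matrix.col_apply] at this
  rw [← this]
  rfl

variable {n : ℕ} {ι : Type*} [Fintype ι] [DecidableEq ι]

/-- The left inverse `(Vᵀ V)⁻¹ Vᵀ`. -/
def leftInv (V : Matrix (Fin n) ι ℝ) : Matrix ι (Fin n) ℝ := (Vᵀ * V)⁻¹ * Vᵀ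

/-- The orthogonal projection onto the orthogonal complement of the column span. -/
def residual (V : Matrix (Fin n) ι ℝ) : Matrix (Fin n) (Fin n) ℝ := 1 - V * leftInv V

variable {V : Matrix (Fin n) ι ℝ}

theorem isUnit_det_transpose_mul_self (hV : Function.Injective V.mulVec) :
    IsUnit (Vᵀ * V).det := by
  have := (Matrix.PosDef.conjTranspose_mul_self V hV).det_pos
  rw [Matrix.conjTranspose_eq_transpose_of_trivial] at this
  exact this.ne'.isUnit

theorem leftInv_mul (hV : Function.Injective V.mulVec) : leftInv V * V = 1 := by
  rw [leftInv, Matrix.mul_assoc, Matrix.nonsing_inv_mul _ (isUnit_det_transpose_mul_self hV)]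

theorem transpose_mul_leftInv (V : Matrix (Fin n) ι ℝ) : (V * leftInv V)ᵀ = V * leftInv V := by
  rw [leftInv]
  simp [Matrix.transpose_nonsing_inv, Matrix.mul_assoc]

theorem residual_transpose (V : Matrix (Fin n) ι ℝ) : (residual V)ᵀ = residual V := by
  rw [residual, Matrix.transpose_sub, transpose_mul_leftInv, Matrix.transpose_one]

theorem residual_mul (hV : Function.Injective V.mulVec) : residual V * V = 0 := by
  rw [residual, Matrix.sub_mul, Matrix.mul_assoc, leftInv_mul hV, Matrix.one_mul, Matrix.mul_one,
    sub_self]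

theorem residual_mul_residual (hV : Function.Injective V.mulVec) :
    residual V * residual V = residual V := by
  nth_rw 2 [residual]
  rw [Matrix.mul_sub, ← Matrix.mul_assoc, residual_mul hV]
  simp

theorem mul_leftInv_add_residual (V : Matrix (Fin n) ι ℝ) : V * leftInv V + residual V = 1 :=
  add_sub_cancel _ _

/-- `Q Qᵀ` and `V (Vᵀ V)⁻¹ Vᵀ` are symmetric, and each fixes the columns of the other factor since
the spans agree. Transposing the product of the two shows they coincide. -/
theorem IsOrthonormalBasisOfSpan.one_sub_mul_transpose {q : ℕ} {Q : Matrix (Fin n) (Fin q) ℝ}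
    (hQ : IsOrthonormalBasisOfSpan Q V) (hV : Function.Injective V.mulVec) :
    1 - Q * Qᵀ = residual V := by
  obtain ⟨C, hC⟩ := exists_eq_mul_of_span_le hQ.2.ge
  obtain ⟨C', hC'⟩ := exists_eq_mul_of_span_le hQ.2.le
  have h1 : Q * Qᵀ * V = V := by
    rw [hC, Matrix.mul_assoc, ← Matrix.mul_assoc Qᵀ, hQ.1, Matrix.one_mul]
  have h2 : V * leftInv V * Q = Q := by
    rw [hC', ← Matrix.mul_assoc, Matrix.mul_assoc V, leftInv_mul hV, Matrix.mul_one]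
  have h3 : V * leftInv V * (Q * Qᵀ) = Q * Qᵀ := by rw [← Matrix.mul_assoc, h2]
  have h4 := congrArg Matrix.transpose h3
  rw [Matrix.transpose_mul, transpose_mul_leftInv, Matrix.transpose_mul,
    Matrix.transpose_transpose, ← Matrix.mul_assoc, h1] at h4
  rw [residual, h4]

end Projection

/-! ### Regimes in which every point is selected -/

section Coercive

variable {d r n p : ℕ} {f : ℝ → ℝ} {w : (Fin d → ℕ) → (Fin d → ℕ) → ℝ} {φ : ℝ → ℝ} {α : ℝ}
  {x : Fin n → Pt d} {S : ℝ → Type*} [∀ ε, MeasurableSpace (S ε)] {μ : ∀ ε, Measure (S ε)}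
  {X : ∀ ε, S ε → Finset (Fin n)}

theorem tendsto_real_card_eq_of_eventually_le (hα : 0 < α)
    (hX : ∀ ε, 0 < ε → IsLEnsemble (μ ε) (X ε) ((α / ε ^ p) • kernelMatrix f x ε)) {e : ℕ}
    (he : e < p) {c : ℝ} (hc : 0 < c)
    (hK : ∀ᶠ ε in 𝓝[>] (0 : ℝ), ∀ u : Fin n → ℝ,
      c * ε ^ e * (u ⬝ᵥ u) ≤ u ⬝ᵥ (kernelMatrix f x ε *ᵥ u)) :
    Tendsto (fun ε => (μ ε).real {s | (X ε s).card = n}) (𝓝[>] 0) (𝓝 1) := by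
  refine tendsto_real_card_eq_of_coercive (L := fun ε => (α / ε ^ p) • kernelMatrix f x ε)
    (c := fun ε => α * c * (ε⁻¹) ^ (p - e)) ?_ ?_ ?_
  · filter_upwards [self_mem_nhdsWithin] with ε hε using hX ε hε
  · exact ((tendsto_pow_atTop (by omega)).comp tendsto_inv_nhdsGT_zero).const_mul_atTop
      (by positivity)
  · filter_upwards [self_mem_nhdsWithin, hK] with ε hε h u
    replace hε : 0 < ε := hε
    rw [Matrix.smul_mulVec, dotProduct_smul, smul_eq_mul]
    refine le_trans (le_of_eq ?_) (mul_le_mul_of_nonneg_left (h u) (by positivity))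
    rw [inv_pow]
    have : ε ^ p = ε ^ (p - e) * ε ^ e := by rw [← pow_add]; congr 1; omega
    rw [this]
    field_simp

theorem IsKernelExpansion.tendsto_real_card_eq_of_two_mul_lt (h : IsKernelExpansion d f r w φ)
    (hκ : IsPositiveDefiniteKernel (stationaryKernel d f)) (hd : 1 ≤ d) (hα : 0 < α)
    (hx : Function.Injective x) (hrp : 2 * r < p + 1)
    (hX : ∀ ε, 0 < ε → IsLEnsemble (μ ε) (X ε) ((α / ε ^ p) • kernelMatrix f x ε)) :
    Tendsto (fun ε => (μ ε).real {s | (X ε s).card = n}) (𝓝[>] 0) (𝓝 1) := by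
  have := h.one_le
  obtain ⟨c, hc, hK⟩ := h.eventually_le_of_injective hκ hd hx
  exact tendsto_real_card_eq_of_eventually_le hα hX (by omega) hc hK

theorem transpose_vLt_mulVec (x : Fin n → Pt d) (k : ℕ) (u : Fin n → ℝ) (a : monoLt d k) :
    ((vLt x k)ᵀ *ᵥ u) a = moment x u a.1 := by
  simp only [Matrix.mulVec, dotProduct, Matrix.transpose_apply, vLt, vandermondeOn,
    Matrix.of_apply, moment, monoVal]
  exact Finset.sum_congr rfl fun i _ => mul_comm _ _

theorem IsKernelExpansion.tendsto_real_card_eq_of_rank_eq (h : IsKernelExpansion d f r w φ)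
    (hκ : IsPositiveDefiniteKernel (stationaryKernel d f)) (hd : 1 ≤ d) (hα : 0 < α) {l : ℕ}
    (hl : p = 2 * l ∨ p + 1 = 2 * l) (hlr : l ≤ r) (hrank : (vLt x l).rank = n)
    (hX : ∀ ε, 0 < ε → IsLEnsemble (μ ε) (X ε) ((α / ε ^ p) • kernelMatrix f x ε)) :
    Tendsto (fun ε => (μ ε).real {s | (X ε s).card = n}) (𝓝[>] 0) (𝓝 1) := by
  have hinj : Function.Injective ((vLt x l)ᵀ).mulVec :=
    mulVec_injective_of_rank_eq_card (by rw [Matrix.rank_transpose, hrank, Fintype.card_fin])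
  have hu0 : ∀ u : Fin n → ℝ, (∀ a ∈ monoLt d l, moment x u a = 0) → u = 0 := by
    intro u hu
    refine hinj ?_
    rw [Matrix.mulVec_zero]
    funext a
    rw [transpose_vLt_mulVec, hu a.1 a.2, Pi.zero_apply]
  -- For `l = 0` there are no monomials, so `n = 0`. This case is separate because `2 l - 2 < p`
  -- needs `l ≥ 1`.
  rcases Nat.eq_zero_or_pos l with rfl | hl1
  · have hn : n = 0 := by
      have h0 : ∀ u : Fin n → ℝ, u = 0 := fun u => hu0 u fun a ha => by
        have := mem_monoLt.1 ha; omega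
      by_contra hn
      have := congrFun (h0 fun _ => 1) ⟨0, Nat.pos_of_ne_zero hn⟩
      simp at this
    subst hn
    refine tendsto_const_nhds.congr' ?_
    filter_upwards [self_mem_nhdsWithin] with ε hε
    have := (hX ε hε).isProbabilityMeasure
    have he : {s | (X ε s).card = 0} = Set.univ := by
      ext s
      simp [Finset.eq_empty_of_isEmpty (X ε s)]
    rw [he, probReal_univ]
  · obtain ⟨c, hc, hK⟩ := h.eventually_le_of_forall_moment hκ hd hlr hl1 hu0
    exact tendsto_real_card_eq_of_eventually_le hα hX (by omega) hc hK

end Coercive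

/-! ### Convergence of the rescaled block matrix -/

section ScaledLimit

variable {d r n l p : ℕ} {f : ℝ → ℝ} {w : (Fin d → ℕ) → (Fin d → ℕ) → ℝ} {φ : ℝ → ℝ} {α : ℝ}
  {x : Fin n → Pt d}

/-- The rows of the block matrix `[R; Pr]`. -/
def blockRow (x : Fin n → Pt d) (l : ℕ) : monoLt d l ⊕ Fin n → Fin n → ℝ :=
  (Matrix.fromRows (leftInv (vLt x l)) (residual (vLt x l))).row

/-- The exponent of the leading term of a block row. -/
def blockDegree (d n l p : ℕ) : monoLt d l ⊕ Fin n → ℝ :=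
  Sum.elim (fun a => ((∑ i, a.1 i : ℕ) : ℝ)) fun _ => (p : ℝ) / 2

/-- The moments of a block row of leading degree. -/
def leadMoment (x : Fin n → Pt d) (l p : ℕ) (s : monoLt d l ⊕ Fin n) (a : Fin d → ℕ) : ℝ :=
  if ((∑ i, a i : ℕ) : ℝ) = blockDegree d n l p s then moment x (blockRow x l s) a else 0

theorem moment_row {ι' : Type*} (M : Matrix ι' (Fin n) ℝ) (x : Fin n → Pt d) (A : Finset (Fin d → ℕ)) (i : ι')
    (a : A) : moment x (M.row i) a.1 = (M * vandermondeOn x A) i a := rfl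

theorem moment_leftInv (hV : Function.Injective (vLt x l).mulVec) (a b : monoLt d l) :
    moment x ((leftInv (vLt x l)).row a) b.1 = if a = b then 1 else 0 := by
  rw [moment_row, ← vLt, leftInv_mul hV, Matrix.one_apply]

theorem moment_residual (hV : Function.Injective (vLt x l).mulVec) (i : Fin n) {a : Fin d → ℕ}
    (ha : a ∈ monoLt d l) : moment x ((residual (vLt x l)).row i) a = 0 := by
  rw [moment_row _ x (monoLt d l) i ⟨a, ha⟩, ← vLt, residual_mul hV, Matrix.zero_apply]

/-- A row of the left inverse is dual to the monomials of degree `< l`, so its first nonzero moment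
is its own. A residual row has no moment of degree `< l`, and `p / 2 ≤ l`. -/
theorem blockDegree_le_of_moment_ne_zero (hV : Function.Injective (vLt x l).mulVec)
    (hp : p ≤ 2 * l) {s : monoLt d l ⊕ Fin n} {a : Fin d → ℕ}
    (h : moment x (blockRow x l s) a ≠ 0) : blockDegree d n l p s ≤ ((∑ i, a i : ℕ) : ℝ) := by
  rcases s with b | i
  · change ((∑ i, b.1 i : ℕ) : ℝ) ≤ _
    rw [Nat.cast_le]
    have hb := mem_monoLt.1 b.2
    by_contra hlt
    have ha : a ∈ monoLt d l := mem_monoLt.2 (by omega)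
    have h1 := moment_leftInv hV b ⟨a, ha⟩
    change moment x ((leftInv (vLt x l)).row b) a ≠ 0 at h
    rw [h1] at h
    split_ifs at h with hba
    · rw [hba] at hlt; exact hlt le_rfl
    · exact h rfl
  · change (p : ℝ) / 2 ≤ _
    have h2 : l ≤ ∑ i, a i := by
      by_contra hlt
      exact h (moment_residual hV i (mem_monoLt.2 (by omega)))
    have h3 : (p : ℝ) ≤ 2 * (∑ i, a i : ℕ) := by exact_mod_cast (by omega)
    linarith

theorem tendsto_rpow_nhdsGT_zero {θ : ℝ} (hθ : 0 ≤ θ) :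
    Tendsto (fun ε : ℝ => ε ^ θ) (𝓝[>] 0) (𝓝 (if θ = 0 then 1 else 0)) := by
  split_ifs with h
  · simp [h]
  · have := (Real.continuousAt_rpow_const 0 θ (Or.inr hθ)).tendsto
    rw [Real.zero_rpow h] at this
    exact this.mono_left nhdsWithin_le_nhds

theorem tendsto_rpow_mul_moment (hV : Function.Injective (vLt x l).mulVec) (hp : p ≤ 2 * l)
    (s : monoLt d l ⊕ Fin n) (a : Fin d → ℕ) :
    Tendsto (fun ε : ℝ => ε ^ (((∑ i, a i : ℕ) : ℝ) - blockDegree d n l p s) *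
      moment x (blockRow x l s) a) (𝓝[>] 0) (𝓝 (leadMoment x l p s a)) := by
  by_cases h : moment x (blockRow x l s) a = 0
  · simp [leadMoment, h]
  · have h1 := (tendsto_rpow_nhdsGT_zero (sub_nonneg.2
      (blockDegree_le_of_moment_ne_zero hV hp h))).mul_const (moment x (blockRow x l s) a)
    simp only [sub_eq_zero, ite_mul, one_mul, zero_mul] at h1
    exact h1

theorem blockDegree_le (hl : p = 2 * l ∨ p + 1 = 2 * l) (s : monoLt d l ⊕ Fin n) :
    blockDegree d n l p s ≤ (p : ℝ) / 2 := by
  rcases s with b | i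
  · change ((∑ i, b.1 i : ℕ) : ℝ) ≤ _
    have hb := mem_monoLt.1 b.2
    have : (2 : ℝ) * (∑ i, b.1 i : ℕ) ≤ p := by exact_mod_cast (by omega)
    linarith
  · exact le_rfl

/-- Distributing `ε ^ (-p)` as `ε ^ (-p/2)` on each side combines it with the scaling of the first
block, and every row ends up divided by `ε` to its leading degree. -/
theorem scaledBlock_apply_eq_mul {ε : ℝ} (hε : 0 < ε) (K : Matrix (Fin n) (Fin n) ℝ)
    (s t : monoLt d l ⊕ Fin n) :
    scaledBlock (leftInv (vLt x l)) (residual (vLt x l)) ((α / ε ^ p) • K)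
      (fun a => ε ^ (((∑ i, a.1 i : ℕ) : ℝ) - (p : ℝ) / 2)) s t =
    α * (ε ^ (-blockDegree d n l p s) * ε ^ (-blockDegree d n l p t) *
      (blockRow x l s ⬝ᵥ (K *ᵥ blockRow x l t))) := by
  have hψ : ∀ s : monoLt d l ⊕ Fin n, (Sum.elim (fun a : monoLt d l =>
      (ε ^ (((∑ i, a.1 i : ℕ) : ℝ) - (p : ℝ) / 2))⁻¹) fun _ => 1 : _ → ℝ) s =
      ε ^ ((p : ℝ) / 2) * ε ^ (-blockDegree d n l p s) := by
    intro s
    rw [← Real.rpow_add hε]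
    rcases s with a | i
    · change (ε ^ (((∑ i, a.1 i : ℕ) : ℝ) - (p : ℝ) / 2))⁻¹ = _
      rw [← Real.rpow_neg hε.le]
      congr 1
      change _ = (p : ℝ) / 2 + -((∑ i, a.1 i : ℕ) : ℝ)
      ring
    · change 1 = ε ^ ((p : ℝ) / 2 + -((p : ℝ) / 2))
      rw [add_neg_cancel, Real.rpow_zero]
  have hpp : ε ^ ((p : ℝ) / 2) * ε ^ ((p : ℝ) / 2) = ε ^ p := by
    rw [← Real.rpow_add hε, add_halves, Real.rpow_natCast]
  have hB : (Matrix.fromRows (leftInv (vLt x l)) (residual (vLt x l)) * K *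
      (Matrix.fromRows (leftInv (vLt x l)) (residual (vLt x l)))ᵀ) s t =
      blockRow x l s ⬝ᵥ (K *ᵥ blockRow x l t) := by
    rw [Matrix.mul_assoc, Matrix.mul_apply, dotProduct]
    rfl
  rw [scaledBlock, Matrix.mul_diagonal, Matrix.diagonal_mul, Matrix.mul_smul, Matrix.smul_mul,
    Matrix.smul_apply, hB, hψ, hψ, smul_eq_mul, ← hpp]
  have : ε ^ ((p : ℝ) / 2) ≠ 0 := (Real.rpow_pos_of_pos hε _).ne'
  field_simp

/-- Every power of `ε` attached to a nonzero moment is nonnegative, so only the leading moments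
survive. The singular remainder carries the exponent `2 r - 1 - deg s - deg t`, which is nonnegative
because block degrees are at most `p / 2` and `p ≤ 2 r - 1`. -/
theorem IsKernelExpansion.tendsto_scaledBlock_apply (h : IsKernelExpansion d f r w φ)
    (hV : Function.Injective (vLt x l).mulVec) (hl : p = 2 * l ∨ p + 1 = 2 * l)
    (hpr : p + 1 ≤ 2 * r) (s t : monoLt d l ⊕ Fin n) :
    Tendsto (fun ε : ℝ => scaledBlock (leftInv (vLt x l)) (residual (vLt x l))
        ((α / ε ^ p) • kernelMatrix f x ε)
        (fun a => ε ^ (((∑ i, a.1 i : ℕ) : ℝ) - (p : ℝ) / 2)) s t) (𝓝[>] 0)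
      (𝓝 (α * (∑ a ∈ monoLt d (2 * r), ∑ b ∈ monoLt d (2 * r),
          w a b * (leadMoment x l p s a * leadMoment x l p t b) +
        (if ((2 * r - 1 : ℕ) : ℝ) = blockDegree d n l p s + blockDegree d n l p t then
          taylorCoeff f (2 * r - 1) *
            energy (2 * r - 1) x x (blockRow x l s) (blockRow x l t) else 0)))) := by
  have hrem : Tendsto (fun ε : ℝ => ∑ i, ∑ j, blockRow x l s i * blockRow x l t j *
      (‖x i - x j‖ ^ (2 * r - 1) * φ (ε * ‖x i - x j‖))) (𝓝[>] 0)
      (𝓝 (taylorCoeff f (2 * r - 1) *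
        energy (2 * r - 1) x x (blockRow x l s) (blockRow x l t))) := by
    rw [energy, Finset.mul_sum]
    refine tendsto_finsetSum _ fun i _ => ?_
    rw [Finset.mul_sum]
    refine tendsto_finsetSum _ fun j _ => ?_
    have h1 : Tendsto (fun ε : ℝ => ε * ‖x i - x j‖) (𝓝[>] 0) (𝓝 0) := by
      have : Tendsto (fun ε : ℝ => ε * ‖x i - x j‖) (𝓝 0) (𝓝 (0 * ‖x i - x j‖)) :=
        (continuous_id.mul continuous_const).tendsto 0
      rw [zero_mul] at this
      exact this.mono_left nhdsWithin_le_nhds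
    have h2 := ((h.analyticAt.continuousAt.tendsto.comp h1).const_mul
      (‖x i - x j‖ ^ (2 * r - 1))).const_mul (blockRow x l s i * blockRow x l t j)
    rw [h.apply_zero] at h2
    have e : taylorCoeff f (2 * r - 1) *
        (blockRow x l s i * blockRow x l t j * ‖x i - x j‖ ^ (2 * r - 1)) =
        blockRow x l s i * blockRow x l t j *
          (‖x i - x j‖ ^ (2 * r - 1) * taylorCoeff f (2 * r - 1)) := by ring
    rw [e]
    exact h2
  have hexp : 0 ≤ ((2 * r - 1 : ℕ) : ℝ) - (blockDegree d n l p s + blockDegree d n l p t) := by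
    have h1 := blockDegree_le hl s
    have h2 := blockDegree_le hl t
    have h3 : (p : ℝ) ≤ (2 * r - 1 : ℕ) := by exact_mod_cast (by omega)
    linarith
  have hR := (tendsto_rpow_nhdsGT_zero hexp).mul hrem
  simp only [sub_eq_zero, ite_mul, one_mul, zero_mul] at hR
  have hP : Tendsto (fun ε : ℝ => ∑ a ∈ monoLt d (2 * r), ∑ b ∈ monoLt d (2 * r),
      w a b * ((ε ^ (((∑ i, a i : ℕ) : ℝ) - blockDegree d n l p s) * moment x (blockRow x l s) a) *
        (ε ^ (((∑ i, b i : ℕ) : ℝ) - blockDegree d n l p t) * moment x (blockRow x l t) b)))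
      (𝓝[>] 0) (𝓝 (∑ a ∈ monoLt d (2 * r), ∑ b ∈ monoLt d (2 * r),
          w a b * (leadMoment x l p s a * leadMoment x l p t b))) :=
    tendsto_finsetSum _ fun a _ => tendsto_finsetSum _ fun b _ =>
      ((tendsto_rpow_mul_moment hV (by omega) s a).mul
        (tendsto_rpow_mul_moment hV (by omega) t b)).const_mul _
  refine ((hP.add hR).const_mul α).congr' ?_
  filter_upwards [self_mem_nhdsWithin] with ε hε
  replace hε : 0 < ε := hε
  rw [scaledBlock_apply_eq_mul hε, dotProduct_kernelMatrix_mulVec, h.bilin_eq x _ _ hε, mul_add]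
  rw [mul_add, mul_add]
  congr 2
  · simp_rw [Finset.mul_sum]
    refine Finset.sum_congr rfl fun a _ => Finset.sum_congr rfl fun b _ => ?_
    rw [sub_eq_add_neg, sub_eq_add_neg, Real.rpow_add hε, Real.rpow_add hε, Real.rpow_natCast,
      Real.rpow_natCast, pow_add]
    ring
  · rw [sub_eq_add_neg, neg_add, Real.rpow_add hε, Real.rpow_add hε, Real.rpow_natCast]
    ring

theorem leadMoment_inl (hV : Function.Injective (vLt x l).mulVec) (a : monoLt d l)
    (b : Fin d → ℕ) : leadMoment x l p (Sum.inl a) b = if a.1 = b then 1 else 0 := by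
  have h1 : leadMoment x l p (Sum.inl a) b = if ((∑ i, b i : ℕ) : ℝ) = (∑ i, a.1 i : ℕ) then
    moment x ((leftInv (vLt x l)).row a) b else 0 := rfl
  simp only [h1, Nat.cast_inj]
  by_cases hb : b ∈ monoLt d l
  · rw [moment_leftInv hV a ⟨b, hb⟩]
    by_cases hab : a.1 = b
    · rw [if_pos (by rw [hab]), if_pos (Subtype.ext hab), if_pos hab]
    · rw [if_neg (fun h => hab (congrArg Subtype.val h)), if_neg hab, ite_self]
  · have ha := mem_monoLt.1 a.2
    rw [mem_monoLt] at hb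
    rw [if_neg (by omega), if_neg]
    rintro rfl
    exact hb ha

/-- The leading exponent `p / 2` is not an integer, so no moment has that degree. -/
theorem leadMoment_inr_of_odd (hp : Odd p) (i : Fin n) (b : Fin d → ℕ) :
    leadMoment x l p (Sum.inr i) b = 0 := by
  refine if_neg fun h => ?_
  change ((∑ i, b i : ℕ) : ℝ) = (p : ℝ) / 2 at h
  have h1 : 2 * (∑ i, b i) = p := by
    have : (2 : ℝ) * (∑ i, b i : ℕ) = p := by linarith
    exact_mod_cast this
  exact (Nat.not_even_iff_odd.2 hp) ⟨_, by rw [← h1]; ring⟩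

theorem leadMoment_inr_of_even (i : Fin n) (b : Fin d → ℕ) :
    leadMoment x l (2 * l) (Sum.inr i) b =
      if b ∈ monoEq d l then moment x ((residual (vLt x l)).row i) b else 0 := by
  have h1 : leadMoment x l (2 * l) (Sum.inr i) b = if ((∑ i, b i : ℕ) : ℝ) =
    ((2 * l : ℕ) : ℝ) / 2 then moment x ((residual (vLt x l)).row i) b else 0 := rfl
  simp only [h1, mem_monoEq]
  simp only [Nat.cast_mul, Nat.cast_ofNat, mul_div_cancel_left₀ _ (two_ne_zero' ℝ), Nat.cast_inj]

end ScaledLimit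

/-- The determinant can be computed on the inner index set, by `det (1 + A B) = det (1 + B A)`. This
bounds the cardinality in the even case. -/
theorem natDegree_minorPoly_mul_le {n : ℕ} {ι : Type*} [Fintype ι] [DecidableEq ι]
    (A : Matrix (Fin n) ι ℝ) (B : Matrix ι (Fin n) ℝ) :
    (minorPoly (A * B)).natDegree ≤ Fintype.card ι := by
  have h : minorPoly (A * B) = ((Polynomial.X : Polynomial ℝ) • (B * A).map (Polynomial.C : ℝ → Polynomial ℝ) +
      (1 : Matrix ι ι ℝ).map (Polynomial.C : ℝ → Polynomial ℝ)).det := by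
    have h1 : (A * B).map (Polynomial.C : ℝ → Polynomial ℝ) =
      A.map Polynomial.C * B.map Polynomial.C := Matrix.map_mul
    have h2 : (B * A).map (Polynomial.C : ℝ → Polynomial ℝ) =
      B.map Polynomial.C * A.map Polynomial.C := Matrix.map_mul
    rw [minorPoly, h1, h2, ← Matrix.smul_mul, Matrix.det_one_add_mul_comm, Matrix.mul_smul, add_comm]
    simp
  rw [h]
  exact Polynomial.natDegree_det_X_add_C_le _ _

/-! ### Limit laws of the cardinality in the three threshold regimes -/

section Limits

variable {d r n l p : ℕ} {f : ℝ → ℝ} {w : (Fin d → ℕ) → (Fin d → ℕ) → ℝ} {φ : ℝ → ℝ} {α : ℝ}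
  {x : Fin n → Pt d}

/-- The limit of an entry of the rescaled block matrix, divided by `α`. -/
def limitEntry (f : ℝ → ℝ) (x : Fin n → Pt d) (w : (Fin d → ℕ) → (Fin d → ℕ) → ℝ) (r l p : ℕ)
    (s t : monoLt d l ⊕ Fin n) : ℝ :=
  ∑ a ∈ monoLt d (2 * r), ∑ b ∈ monoLt d (2 * r),
      w a b * (leadMoment x l p s a * leadMoment x l p t b) +
    (if ((2 * r - 1 : ℕ) : ℝ) = blockDegree d n l p s + blockDegree d n l p t then
      taylorCoeff f (2 * r - 1) * energy (2 * r - 1) x x (blockRow x l s) (blockRow x l t) else 0)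

theorem IsKernelExpansion.limitEntry_comm (h : IsKernelExpansion d f r w φ)
    (s t : monoLt d l ⊕ Fin n) : limitEntry f x w r l p s t = limitEntry f x w r l p t s := by
  rw [limitEntry, limitEntry, Finset.sum_comm, energy_comm, add_comm (blockDegree d n l p s)]
  congr 1
  refine Finset.sum_congr rfl fun a _ => Finset.sum_congr rfl fun b _ => ?_
  rw [h.coeff_symm, mul_comm (leadMoment x l p s b)]

theorem blockDegree_inl_lt (hl : p = 2 * l ∨ p + 1 = 2 * l) (a : monoLt d l) :
    blockDegree d n l p (Sum.inl a) < (p : ℝ) / 2 := by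
  change ((∑ i, a.1 i : ℕ) : ℝ) < _
  have ha := mem_monoLt.1 a.2
  have : (2 : ℝ) * (∑ i, a.1 i : ℕ) < p := by exact_mod_cast (by omega)
  linarith

/-- The singular term needs block degrees adding up to `2 r - 1`. They add up to at most `p`, and to
less when one row is in the first block, so the term survives only between residual rows and only
for `p = 2 r - 1`. -/
theorem limitEntry_eq_sum (hl : p = 2 * l ∨ p + 1 = 2 * l) (hpr : p + 1 ≤ 2 * r)
    {s t : monoLt d l ⊕ Fin n} (h : p + 1 < 2 * r ∨ ∃ a, s = Sum.inl a) :
    limitEntry f x w r l p s t = ∑ a ∈ monoLt d (2 * r), ∑ b ∈ monoLt d (2 * r),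
      w a b * (leadMoment x l p s a * leadMoment x l p t b) := by
  rw [limitEntry, if_neg, add_zero]
  have h2 := blockDegree_le (n := n) hl t
  rcases h with h | ⟨a, rfl⟩
  · have h1 := blockDegree_le (n := n) hl s
    have h3 : (p : ℝ) < (2 * r - 1 : ℕ) := by exact_mod_cast (by omega)
    intro h4
    linarith
  · have h1 := blockDegree_inl_lt (n := n) hl a
    have h3 : (p : ℝ) ≤ (2 * r - 1 : ℕ) := by exact_mod_cast (by omega)
    intro h4
    linarith

theorem sum_leadMoment_inl_mul (hV : Function.Injective (vLt x l).mulVec) (hlr : l ≤ 2 * r)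
    (a : monoLt d l) (g : (Fin d → ℕ) → ℝ) :
    ∑ b ∈ monoLt d (2 * r), leadMoment x l p (Sum.inl a) b * g b = g a.1 := by
  simp_rw [leadMoment_inl hV, ite_mul, one_mul, zero_mul]
  rw [Finset.sum_ite_eq, if_pos]
  have := mem_monoLt.1 a.2
  exact mem_monoLt.2 (by omega)

theorem sum_leadMoment_inr_mul (hlr : l < 2 * r) (i : Fin n) (g : (Fin d → ℕ) → ℝ) :
    ∑ b ∈ monoLt d (2 * r), leadMoment x l (2 * l) (Sum.inr i) b * g b =
      ∑ b : monoEq d l, (residual (vLt x l) * vEq x l) i b * g b.1 := by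
  simp_rw [leadMoment_inr_of_even, ite_mul, zero_mul]
  rw [Finset.sum_ite_mem, Finset.inter_eq_right.2, ← Finset.sum_coe_sort]
  · rfl
  · intro b hb
    have := mem_monoEq.1 hb
    exact mem_monoLt.2 (by omega)

variable {S : ℝ → Type*} [∀ ε, MeasurableSpace (S ε)] {μ : ∀ ε, Measure (S ε)}
  {X : ∀ ε, S ε → Finset (Fin n)}

/-- The upper left limit is always `α W_{<l}`, since the leading moments of a dual row are an
indicator. Only the blocks `B` and `D` depend on the regime. The scalar `α` passes through the Schur
complement. -/
theorem IsKernelExpansion.tendsto_real_card_eq_of_limitEntry (h : IsKernelExpansion d f r w φ)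
    (hκ : IsPositiveDefiniteKernel (stationaryKernel d f)) (hd : 1 ≤ d) (hα : 0 < α)
    (hV : Function.Injective (vLt x l).mulVec) (hl : p = 2 * l ∨ p + 1 = 2 * l)
    (hpr : p + 1 ≤ 2 * r)
    (hX : ∀ ε, 0 < ε → IsLEnsemble (μ ε) (X ε) ((α / ε ^ p) • kernelMatrix f x ε))
    {B : Matrix (monoLt d l) (Fin n) ℝ} {D : Matrix (Fin n) (Fin n) ℝ}
    (hB : ∀ a i, limitEntry f x w r l p (Sum.inl a) (Sum.inr i) = B a i)
    (hD : ∀ i j, limitEntry f x w r l p (Sum.inr i) (Sum.inr j) = D i j)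
    {T : Matrix (Fin n) (Fin n) ℝ}
    (hT : T = D - Bᵀ * (wronskian (stationaryKernel d f) (monoLt d l) (monoLt d l))⁻¹ * B)
    (m : ℕ) :
    Tendsto (fun ε => (μ ε).real {s | (X ε s).card = m}) (𝓝[>] 0)
      (𝓝 ((Polynomial.X ^ dimLt l d * minorPoly (α • T)).coeff m / (1 + α • T).det)) := by
  have hlr : l ≤ r := by omega
  set W := wronskian (stationaryKernel d f) (monoLt d l) (monoLt d l) with hWdef
  have hW : W.PosDef := h.wronskian_posDef hκ hd hlr
  have hWu : IsUnit W.det := hW.det_pos.ne'.isUnit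
  have hαT : α • T = α • D - (α • B)ᵀ * (α • W)⁻¹ * (α • B) := by
    let _ := invertibleOfNonzero hα.ne'
    rw [Matrix.inv_smul W α hWu, hT, smul_sub, Matrix.transpose_smul, Matrix.smul_mul,
      Matrix.mul_smul Bᵀ, smul_smul, mul_invOf_self, one_smul, Matrix.mul_smul]
  have hG : Tendsto (fun ε : ℝ => scaledBlock (leftInv (vLt x l)) (residual (vLt x l))
      ((α / ε ^ p) • kernelMatrix f x ε) (fun a => ε ^ (((∑ i, a.1 i : ℕ) : ℝ) - (p : ℝ) / 2)))
      (𝓝[>] 0) (𝓝 (Matrix.fromBlocks (α • W) (α • B) (α • B)ᵀ (α • D))) := by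
    refine tendsto_pi_nhds.2 fun s => tendsto_pi_nhds.2 fun t => ?_
    have key := h.tendsto_scaledBlock_apply (α := α) hV hl hpr s t
    rw [← limitEntry] at key
    suffices hE : Matrix.fromBlocks (α • W) (α • B) (α • B)ᵀ (α • D) s t =
        α * limitEntry f x w r l p s t by rw [hE]; exact key
    rcases s with a | i <;> rcases t with b | j
    · have ha := mem_monoLt.1 a.2
      have hb := mem_monoLt.1 b.2
      rw [Matrix.fromBlocks_apply₁₁, Matrix.smul_apply, hWdef,
        h.wronskian_apply _ _ (by omega) (by omega), smul_eq_mul,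
        limitEntry_eq_sum hl hpr (Or.inr ⟨a, rfl⟩)]
      have e1 : ∀ a' ∈ monoLt d (2 * r), ∑ b' ∈ monoLt d (2 * r), w a' b' *
          (leadMoment x l p (Sum.inl a) a' * leadMoment x l p (Sum.inl b) b') =
          leadMoment x l p (Sum.inl a) a' * w a' b.1 := by
        intro a' _
        rw [← sum_leadMoment_inl_mul hV (by omega : l ≤ 2 * r) b (p := p) fun b' => w a' b',
          Finset.mul_sum]
        exact Finset.sum_congr rfl fun b' _ => by ring
      rw [Finset.sum_congr rfl e1, sum_leadMoment_inl_mul hV (by omega) a fun a' => w a' b.1]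
    · rw [hB]; rfl
    · rw [h.limitEntry_comm, hB]; rfl
    · rw [hD]; rfl
  have key := tendsto_real_card_eq_of_tendsto_scaledBlock (V := vLt x l)
    (mul_leftInv_add_residual _)
    (residual_mul_residual hV) (residual_transpose _) (residual_mul hV)
    (isUnit_det_transpose_mul_self hV) (L := fun ε => (α / ε ^ p) • kernelMatrix f x ε)
    (F := 𝓝[>] (0 : ℝ)) (μ := μ) (X := X)
    (by filter_upwards [self_mem_nhdsWithin] with ε hε using hX ε hε)
    (φ := fun ε a => ε ^ (((∑ i, a.1 i : ℕ) : ℝ) - (p : ℝ) / 2))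
    (by
      filter_upwards [self_mem_nhdsWithin] with ε hε a
      exact (Real.rpow_pos_of_pos hε _).ne')
    (by
      intro a
      have hlt : 0 < (p : ℝ) / 2 - ((∑ i, a.1 i : ℕ) : ℝ) :=
        sub_pos.2 (blockDegree_inl_lt (n := n) hl a)
      have := tendsto_rpow_nhdsGT_zero hlt.le
      rw [if_neg hlt.ne'] at this
      refine this.congr' ?_
      filter_upwards [self_mem_nhdsWithin] with ε hε
      rw [← Real.rpow_neg (le_of_lt hε), neg_sub])
    (hW.smul hα) hG m
  rw [← hαT, Fintype.card_coe, card_monoLt hd] at key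
  exact key

theorem mul_mul_residual_apply (M : Matrix (Fin n) (Fin n) ℝ) (i j : Fin n) :
    (residual (vLt x l) * M * residual (vLt x l)) i j =
      ∑ k, ∑ k', residual (vLt x l) i k * residual (vLt x l) j k' * M k k' := by
  nth_rw 2 [← residual_transpose]
  rw [Matrix.mul_apply, Finset.sum_comm]
  refine Finset.sum_congr rfl fun k' _ => ?_
  rw [Matrix.mul_apply, Finset.sum_mul]
  exact Finset.sum_congr rfl fun k _ => by rw [Matrix.transpose_apply]; ring

/-- The boundary case `p = 2 r - 1`. -/
theorem IsKernelExpansion.tendsto_real_card_eq_of_eq (h : IsKernelExpansion d f r w φ)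
    (hκ : IsPositiveDefiniteKernel (stationaryKernel d f)) (hd : 1 ≤ d) (hα : 0 < α)
    (hV : Function.Injective (vLt x r).mulVec) (hpr : 2 * r = p + 1)
    (hX : ∀ ε, 0 < ε → IsLEnsemble (μ ε) (X ε) ((α / ε ^ p) • kernelMatrix f x ε)) (m : ℕ) :
    let T := taylorCoeff f (2 * r - 1) •
      (residual (vLt x r) * distMatrix x (2 * r - 1) * residual (vLt x r))
    Tendsto (fun ε => (μ ε).real {s | (X ε s).card = m}) (𝓝[>] 0)
      (𝓝 ((Polynomial.X ^ dimLt r d * minorPoly (α • T)).coeff m / (1 + α • T).det)) := by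
  intro T
  have hodd : Odd p := ⟨r - 1, by have := h.one_le; omega⟩
  refine h.tendsto_real_card_eq_of_limitEntry hκ hd hα hV (Or.inr hpr.symm) hpr.ge hX
    (B := 0) (D := T) (fun a i => ?_) (fun i j => ?_) (by simp) m
  · rw [limitEntry_eq_sum (Or.inr hpr.symm) hpr.ge (Or.inr ⟨a, rfl⟩)]
    simp [leadMoment_inr_of_odd hodd]
  · rw [limitEntry, if_pos]
    · simp only [leadMoment_inr_of_odd hodd, mul_zero, Finset.sum_const_zero, zero_add, T,
        Matrix.smul_apply, smul_eq_mul, mul_mul_residual_apply]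
      rfl
    · change ((2 * r - 1 : ℕ) : ℝ) = (p : ℝ) / 2 + (p : ℝ) / 2
      rw [add_halves]
      congr 1
      omega

/-- Odd `p` below the smoothness threshold. -/
theorem IsKernelExpansion.tendsto_real_card_eq_of_odd (h : IsKernelExpansion d f r w φ)
    (hκ : IsPositiveDefiniteKernel (stationaryKernel d f)) (hd : 1 ≤ d) (hα : 0 < α)
    (hV : Function.Injective (vLt x l).mulVec) (hl : p + 1 = 2 * l) (hpr : p + 1 < 2 * r)
    (hX : ∀ ε, 0 < ε → IsLEnsemble (μ ε) (X ε) ((α / ε ^ p) • kernelMatrix f x ε)) :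
    Tendsto (fun ε => (μ ε).real {s | (X ε s).card = dimLt l d}) (𝓝[>] 0) (𝓝 1) := by
  have hodd : Odd p := ⟨l - 1, by omega⟩
  have key := h.tendsto_real_card_eq_of_limitEntry hκ hd hα hV (Or.inr hl) hpr.le hX
    (B := 0) (D := 0) (fun a i => by
      rw [limitEntry_eq_sum (Or.inr hl) hpr.le (Or.inl hpr)]
      simp [leadMoment_inr_of_odd hodd]) (fun i j => by
      rw [limitEntry_eq_sum (Or.inr hl) hpr.le (Or.inl hpr)]
      simp [leadMoment_inr_of_odd hodd]) (T := 0) (by simp) (dimLt l d)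
  simpa [minorPoly, Polynomial.coeff_X_pow] using key

/-- Symmetry of `w` identifies the lower left Wronskian block with the transpose of the upper right
one, which is the form `D - Bᵀ W⁻¹ B` produced by the limit. -/
theorem IsKernelExpansion.schurWronskian_eq (h : IsKernelExpansion d f r w φ) (hlr : l < r) :
    schurWronskian (stationaryKernel d f) l =
      wronskian (stationaryKernel d f) (monoEq d l) (monoEq d l) -
      (wronskian (stationaryKernel d f) (monoLt d l) (monoEq d l))ᵀ *
        (wronskian (stationaryKernel d f) (monoLt d l) (monoLt d l))⁻¹ *
        wronskian (stationaryKernel d f) (monoLt d l) (monoEq d l) := by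
  rw [schurWronskian]
  congr 3
  ext b a
  have ha := mem_monoLt.1 a.2
  have hb := mem_monoEq.1 b.2
  rw [Matrix.transpose_apply, h.wronskian_apply _ _ (by omega) (by omega),
    h.wronskian_apply _ _ (by omega) (by omega), h.coeff_symm]

theorem IsKernelExpansion.schurWronskian_transpose (h : IsKernelExpansion d f r w φ)
    (hκ : IsPositiveDefiniteKernel (stationaryKernel d f)) (hd : 1 ≤ d) (hlr : l < r) :
    (schurWronskian (stationaryKernel d f) l)ᵀ = schurWronskian (stationaryKernel d f) l := by
  have h1 := (h.wronskian_posDef hκ hd hlr.le).isHermitian.eq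
  rw [Matrix.conjTranspose_eq_transpose_of_trivial] at h1
  have h2 : (wronskian (stationaryKernel d f) (monoEq d l) (monoEq d l))ᵀ =
      wronskian (stationaryKernel d f) (monoEq d l) (monoEq d l) := by
    ext a b
    have ha := mem_monoEq.1 a.2
    have hb := mem_monoEq.1 b.2
    rw [Matrix.transpose_apply, h.wronskian_apply _ _ (by omega) (by omega),
      h.wronskian_apply _ _ (by omega) (by omega), h.coeff_symm]
  rw [h.schurWronskian_eq hlr, Matrix.transpose_sub, h2, Matrix.transpose_mul, Matrix.transpose_mul,
    Matrix.transpose_nonsing_inv, h1, Matrix.transpose_transpose, Matrix.mul_assoc]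

/-- Even `p` below the smoothness threshold. -/
theorem IsKernelExpansion.tendsto_real_card_eq_of_even (h : IsKernelExpansion d f r w φ)
    (hκ : IsPositiveDefiniteKernel (stationaryKernel d f)) (hd : 1 ≤ d) (hα : 0 < α)
    (hV : Function.Injective (vLt x l).mulVec) (hl : p = 2 * l) (hpr : p + 1 < 2 * r)
    (hX : ∀ ε, 0 < ε → IsLEnsemble (μ ε) (X ε) ((α / ε ^ p) • kernelMatrix f x ε)) (m : ℕ) :
    let T := residual (vLt x l) *
      (vEq x l * schurWronskian (stationaryKernel d f) l * (vEq x l)ᵀ) * residual (vLt x l)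
    Tendsto (fun ε => (μ ε).real {s | (X ε s).card = m}) (𝓝[>] 0)
      (𝓝 ((Polynomial.X ^ dimLt l d * minorPoly (α • T)).coeff m / (1 + α • T).det)) := by
  intro T
  subst hl
  have hlr : l < r := by omega
  set Y := residual (vLt x l) * vEq x l with hY
  set B := wronskian (stationaryKernel d f) (monoLt d l) (monoEq d l) * Yᵀ with hB
  set D := Y * wronskian (stationaryKernel d f) (monoEq d l) (monoEq d l) * Yᵀ with hD
  refine h.tendsto_real_card_eq_of_limitEntry hκ hd hα hV (Or.inl rfl) hpr.le hX
    (B := B) (D := D) (fun a i => ?_) (fun i j => ?_) ?_ m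
  · have ha := mem_monoLt.1 a.2
    rw [limitEntry_eq_sum (Or.inl rfl) hpr.le (Or.inl hpr), Finset.sum_comm]
    have e1 : ∀ b ∈ monoLt d (2 * r), ∑ a' ∈ monoLt d (2 * r), w a' b *
        (leadMoment x l (2 * l) (Sum.inl a) a' * leadMoment x l (2 * l) (Sum.inr i) b) =
        leadMoment x l (2 * l) (Sum.inr i) b * w a.1 b := by
      intro b _
      rw [← sum_leadMoment_inl_mul hV (by omega : l ≤ 2 * r) a (p := 2 * l) fun a' => w a' b,
        Finset.mul_sum]
      exact Finset.sum_congr rfl fun a' _ => by ring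
    rw [Finset.sum_congr rfl e1, sum_leadMoment_inr_mul (by omega), hB, Matrix.mul_apply]
    refine Finset.sum_congr rfl fun b _ => ?_
    have hb := mem_monoEq.1 b.2
    rw [h.wronskian_apply _ _ (by omega) (by omega), Matrix.transpose_apply, mul_comm]
  · rw [limitEntry_eq_sum (Or.inl rfl) hpr.le (Or.inl hpr), Finset.sum_comm]
    have e1 : ∀ b ∈ monoLt d (2 * r), ∑ a ∈ monoLt d (2 * r), w a b *
        (leadMoment x l (2 * l) (Sum.inr i) a * leadMoment x l (2 * l) (Sum.inr j) b) =
        leadMoment x l (2 * l) (Sum.inr j) b * ∑ a : monoEq d l, Y i a * w a.1 b := by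
      intro b _
      rw [hY, ← sum_leadMoment_inr_mul (by omega : l < 2 * r) i fun a => w a b, Finset.mul_sum]
      exact Finset.sum_congr rfl fun a' _ => by ring
    rw [Finset.sum_congr rfl e1, sum_leadMoment_inr_mul (by omega), hD, Matrix.mul_apply]
    refine Finset.sum_congr rfl fun b _ => ?_
    have hb := mem_monoEq.1 b.2
    rw [Matrix.transpose_apply, mul_comm, Matrix.mul_apply]
    congr 1
    refine Finset.sum_congr rfl fun a _ => ?_
    have ha := mem_monoEq.1 a.2
    change _ = Y i a * wronskian (stationaryKernel d f) (monoEq d l) (monoEq d l) a b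
    rw [h.wronskian_apply _ _ (by omega) (by omega)]
  · have hYt : Yᵀ = (vEq x l)ᵀ * residual (vLt x l) := by
      rw [hY, Matrix.transpose_mul, residual_transpose]
    have e1 : T = Y * schurWronskian (stationaryKernel d f) l * Yᵀ := by
      rw [hYt, hY]
      simp only [T, Matrix.mul_assoc]
    rw [e1, h.schurWronskian_eq hlr, hD, hB, Matrix.mul_sub, Matrix.sub_mul,
      Matrix.transpose_mul _ Yᵀ, Matrix.transpose_transpose]
    simp only [Matrix.mul_assoc]

end Limits
end FlatLimit
end
-- Assembling the cases
open FlatLimit in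
theorem mainTheorem3
    (d n p l r : ℕ) (hd : 1 ≤ d)
    (α : ℝ) (hα : 0 < α)
    (x : Fin n → Pt d) (hx : Function.Injective x)
    (f : ℝ → ℝ) (hf : AnalyticAt ℝ f 0)
    (hκ : IsPositiveDefiniteKernel (stationaryKernel d f))
    (hr : IsSmoothnessOrder f r)
    (hl : p = 2 * l ∨ p + 1 = 2 * l)
    (hgen : p + 1 ≤ 2 * r → (vLt x l).rank = min n (dimLt l d))
    {S : ℝ → Type*} [∀ ε, MeasurableSpace (S ε)] (μ : ∀ ε, Measure (S ε))
    (X : ∀ ε, S ε → Finset (Fin n))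
    (hX : ∀ ε, 0 < ε → IsLEnsemble (μ ε) (X ε) ((α / ε ^ p) • kernelMatrix f x ε)) :
    (n ≤ dimLt l d →
      Tendsto (fun ε => (μ ε).real {s | (X ε s).card = n}) (𝓝[>] 0) (𝓝 1)) ∧
    (dimLt l d < n →
      (2 * r < p + 1 →
        Tendsto (fun ε => (μ ε).real {s | (X ε s).card = n}) (𝓝[>] 0) (𝓝 1)) ∧
      (p + 1 < 2 * r →
        (Odd p →
          Tendsto (fun ε => (μ ε).real {s | (X ε s).card = dimLt l d}) (𝓝[>] 0) (𝓝 1)) ∧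
        (Even p →
          ∀ (q : ℕ) (Q : Matrix (Fin n) (Fin q) ℝ), IsOrthonormalBasisOfSpan Q (vLt x l) →
          ∀ M : Matrix (Fin n) (Fin n) ℝ,
            M = compress Q
              (vEq x l * schurWronskian (stationaryKernel d f) l * (vEq x l)ᵀ) →
          ∀ m : ℕ,
            Tendsto (fun ε => (μ ε).real {s | (X ε s).card = m}) (𝓝[>] 0)
              (𝓝 (if m < dimLt l d ∨ dimLt (l + 1) d < m then 0
                else elemSymm (m - dimLt l d) (α • M) / (1 + α • M).det)))) ∧
      (2 * r = p + 1 →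
        ∀ (q : ℕ) (Q : Matrix (Fin n) (Fin q) ℝ), IsOrthonormalBasisOfSpan Q (vLt x r) →
        ∀ M : Matrix (Fin n) (Fin n) ℝ,
          M = taylorCoeff f (2 * r - 1) • compress Q (distMatrix x (2 * r - 1)) →
        ∀ m : ℕ,
          Tendsto (fun ε => (μ ε).real {s | (X ε s).card = m}) (𝓝[>] 0)
            (𝓝 (if m < dimLt r d ∨ n < m then 0
              else elemSymm (m - dimLt r d) (α • M) / (1 + α • M).det)))) := by
  obtain ⟨w, φ, h⟩ := exists_isKernelExpansion d hf hr
  have hinj : p + 1 ≤ 2 * r → dimLt l d < n → Function.Injective (vLt x l).mulVec :=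
    fun hpr hn => mulVec_injective_of_rank_eq_card (by
      rw [hgen hpr, min_eq_right hn.le, Fintype.card_coe, card_monoLt hd])
  refine ⟨fun hn => ?_, fun hn => ⟨fun hrp => ?_, fun hpr => ⟨fun hodd => ?_, fun heven => ?_⟩,
    fun hpr => ?_⟩⟩
  -- Below or at the threshold, the full rank of `vLt x l` separates all weights. Above it no rank
  -- information is available, and the bound by `ε ^ (2 r - 1)` is used instead.
  · by_cases hrp : p + 1 ≤ 2 * r
    · exact h.tendsto_real_card_eq_of_rank_eq hκ hd hα hl (by omega)
        (by rw [hgen hrp, min_eq_left hn]) hX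
    · exact h.tendsto_real_card_eq_of_two_mul_lt hκ hd hα hx (by omega) hX
  · exact h.tendsto_real_card_eq_of_two_mul_lt hκ hd hα hx hrp hX
  · obtain ⟨k, hk⟩ := hodd
    exact h.tendsto_real_card_eq_of_odd hκ hd hα (hinj hpr.le hn) (by omega) hpr hX
  · intro q Q hQ M hM m
    obtain ⟨k, hk⟩ := heven
    have hV := hinj hpr.le hn
    have key := h.tendsto_real_card_eq_of_even hκ hd hα hV (by omega) hpr hX m
    rw [compress, hQ.one_sub_mul_transpose hV] at hM
    dsimp only at key
    rw [← hM, Polynomial.coeff_X_pow_mul'] at key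
    have hMt : (α • M).IsHermitian := by
      rw [Matrix.IsHermitian, Matrix.conjTranspose_eq_transpose_of_trivial, Matrix.transpose_smul,
        hM]
      simp only [Matrix.transpose_mul, residual_transpose, Matrix.transpose_transpose,
        h.schurWronskian_transpose hκ hd (show l < r by omega), Matrix.mul_assoc]
    -- `M` factors through the monomials of degree `l`. This gives probability zero in the limit to
    -- cardinalities above `dimLt (l + 1) d`.
    have hdeg : (minorPoly (α • M)).natDegree ≤ numHom l d := by
      rw [← card_monoEq hd l, ← Fintype.card_coe]
      have hfac : α • M = (α • (residual (vLt x l) * vEq x l)) *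
          (schurWronskian (stationaryKernel d f) l * (vEq x l)ᵀ * residual (vLt x l)) := by
        rw [hM, Matrix.smul_mul]
        simp only [Matrix.mul_assoc]
      rw [hfac]
      exact natDegree_minorPoly_mul_le _ _
    have hsucc : dimLt (l + 1) d = dimLt l d + numHom l d := Finset.sum_range_succ _ _
    split_ifs with hm
    · rcases hm with hm | hm
      · rwa [if_neg (by omega), zero_div] at key
      · rwa [if_pos (by omega), Polynomial.coeff_eq_zero_of_natDegree_lt (by omega), zero_div]
          at key
    · rwa [if_pos (by omega), ← elemSymm_eq_coeff_minorPoly hMt] at key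
  · intro q Q hQ M hM m
    -- Here `p = 2 r - 1` is odd, which rules out `p = 2 l`.
    obtain rfl : l = r := by have := h.one_le; omega
    have hV := hinj hpr.ge hn
    have key := h.tendsto_real_card_eq_of_eq hκ hd hα hV hpr hX m
    rw [compress, hQ.one_sub_mul_transpose hV] at hM
    dsimp only at key
    rw [← hM, Polynomial.coeff_X_pow_mul'] at key
    have hDt : (distMatrix x (2 * l - 1))ᵀ = distMatrix x (2 * l - 1) := by
      ext i j
      simp [distMatrix, norm_sub_rev]
    have hMt : (α • M).IsHermitian := by
      rw [Matrix.IsHermitian, Matrix.conjTranspose_eq_transpose_of_trivial, Matrix.transpose_smul,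
        hM]
      simp only [Matrix.transpose_smul, Matrix.transpose_mul, residual_transpose, hDt,
        Matrix.mul_assoc]
    split_ifs with hm
    -- Cardinalities above `n` are impossible for every `ε`, with no limit needed.
    · by_cases hmn : n < m
      · have he : ∀ ε, {s | (X ε s).card = m} = ∅ := fun ε =>
          Set.eq_empty_of_forall_notMem fun s hs => by
            have h1 : (X ε s).card = m := hs
            have h2 := card_finset_fin_le (X ε s)
            omega
        simp [he]
      · rwa [if_neg (by omega), zero_div] at key
    · rwa [if_pos (by omega), ← elemSymm_eq_coeff_minorPoly hMt] at key
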